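/- Let $\gamma_n\in(0,\tfrac12)$ ($n\ge 1$) and $\gamma_\infty\in(0,\tfrac12)$ with $\lim_{n\to\infty}\gamma_n=\gamma_\infty$, and let $T_n:[0,1]\to[0,1]$ be the intermittent map $$T_nx=\begin{cases} x(1+2^{\gamma_n}x^{\gamma_n}), & 0\le x<\tfrac12,\\ 2x-1, & \tfrac12\le x\le 1,\end{cases}$$ with absolutely continuous $T_n$-invariant probability measure $\mu_n$. Let $p\in(2,\gamma_\infty^{-1})$, $\eta\in(0,1]$ and $d\in\mathbb{N}$. For $v:[0,1]\to\mathbb{R}^d$ write $\|v\|_\eta=\sup_x|v(x)|+\sup_{x\ne y}|v(x)-v(y)|/|x-y|^\eta$, and for $a,b\in\mathbb{R}^d$ write $a\otimes b=ab^T\in\mathbb{R}^{d\times d}$; vectors carry the Euclidean norm and matrices the Frobenius norm. Then there is a constant $C$, depending only on the sequence $(\gamma_n)$ and on $p,\eta,d$, such that for every $n\ge1$, every $v_n:[0,1]\to\mathbb{R}^d$ with $\|v_n\|_\eta<\infty$ and $\int v_n\,d\mu_n=0$, and all integers $0\le\ell<k<n$, $$\Big|\sum_{\ell\le j<k}v_n\circ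 T_n^j\Big|_{L^{2(p-1)}(\mathrm{Leb})}\le C(k-\ell)^{1/2}\|v_n\|_\eta$$ and $$\Big|\sum_{\ell\le i<j<k}(v_n\circ T_n^i)\otimes(v_n\circ T_n^j)\Big|_{L^{p-1}(\mathrm{Leb})}\le C(k-\ell)\|v_n\|_\eta^2 .$$ -/

import Mathlib

open MeasureTheory Filter Topology
open scoped NNReal ENNReal unitInterval Matrix

-- The Frobenius norm on real matrices.
attribute [local instance] Matrix.frobeniusNormedAddCommGroup

theorem lsv_left_mem {γ : ℝ} (hγ : 0 < γ) {x : ℝ} (h0 : 0 ≤ x) (h1 : x < 1 / 2) :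
    x * (1 + 2 ^ γ * x ^ γ) ∈ Set.Icc (0 : ℝ) 1 := by
  have h2 : (2 : ℝ) ^ γ * x ^ γ = (2 * x) ^ γ := (Real.mul_rpow (by norm_num) h0).symm
  have h3 : 0 ≤ (2 * x) ^ γ := Real.rpow_nonneg (by linarith) γ
  have h4 : (2 * x) ^ γ ≤ 1 := Real.rpow_le_one (by linarith) (by linarith) hγ.le
  rw [h2]
  constructor
  · positivity
  · nlinarith

theorem lsv_right_mem {x : ℝ} (h0 : 1 / 2 ≤ x) (h1 : x ≤ 1) :
    2 * x - 1 ∈ Set.Icc (0 : ℝ) 1 :=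
  ⟨by linarith, by linarith⟩

/-- The intermittent (Pomeau–Manneville / Liverani–Saussol–Vaienti) map with parameter `γ`:
`x ↦ x (1 + 2^γ x^γ)` for `x < 1/2` and `x ↦ 2x - 1` for `x ≥ 1/2`. -/
noncomputable def lsvMap (γ : ℝ) (hγ : 0 < γ) (x : I) : I :=
  if h : (x : ℝ) < 1 / 2 then
    ⟨(x : ℝ) * (1 + 2 ^ γ * (x : ℝ) ^ γ), lsv_left_mem hγ x.2.1 h⟩
  else
    ⟨2 * (x : ℝ) - 1, lsv_right_mem (not_lt.mp h) x.2.2⟩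

/-- `μ` is an absolutely continuous `T`-invariant probability measure on `[0,1]`. -/
structure IsACIP (T : I → I) (μ : Measure I) : Prop where
  isProbabilityMeasure : IsProbabilityMeasure μ
  absolutelyContinuous : μ ≪ volume
  invariant : MeasurePreserving T μ μ

/-- The Hölder norm `‖v‖_η = sup |v| + sup_{x ≠ y} |v x - v y| / |x - y|^η`
(for `v` Hölder continuous with exponent `η`). -/
noncomputable def holderNorm {d : ℕ} (η : ℝ≥0) (v : I → EuclideanSpace ℝ (Fin d)) : ℝ :=
  (⨆ x : I, ‖v x‖) + (nnHolderNorm η v : ℝ)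

/-- The sum `∑_{ℓ ≤ j < k} v ∘ T^j`. -/
noncomputable def birkhoffSumFromTo {d : ℕ} (T : I → I) (v : I → EuclideanSpace ℝ (Fin d))
    (ℓ k : ℕ) (x : I) : EuclideanSpace ℝ (Fin d) :=
  ∑ j ∈ Finset.Ico ℓ k, v (T^[j] x)

/-- The iterated sum `∑_{ℓ ≤ i < j < k} (v ∘ T^i) ⊗ (v ∘ T^j)`, where `a ⊗ b = a bᵀ`. -/
noncomputable def iteratedSumFromTo {d : ℕ} (T : I → I) (v : I → EuclideanSpace ℝ (Fin d))
    (ℓ k : ℕ) (x : I) : Matrix (Fin d) (Fin d) ℝ :=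
  ∑ j ∈ Finset.Ico ℓ k, ∑ i ∈ Finset.Ico ℓ j, Matrix.vecMulVec (v (T^[i] x)) (v (T^[j] x))

/-! The map is expanding except at the neutral fixed point 0, so orbits are cut into excursions,
each ending with a visit to [1/2, 1]. Let τ be `excursionTime` and G = T^τ the jump map. The inverse
branches of G contract by 1/2, their Jacobians have bounded distortion, and τ has a p-th Lebesgue
moment. All constants are uniform over parameters γ ≤ g once g * p < 1 (`fullBranchMap_lsvMap`).
Choosing g strictly between the limit parameter and 1/p covers all but finitely many n, and for
those n trivial bounds suffice.

The transfer operator of G contracts a cone of functions with Hölder logarithm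
(`abs_iterate_transfer_sub_le`). This gives a G-invariant probability measure λ with density bounded
above and below. It is the only absolutely continuous one, and the conditional moments of τ^p given
G are bounded. Summing iterates of the operator gives, for a centred observable V, a bounded χ for
which V + χ - χ ∘ G integrates to zero against every bounded function of G (`exists_coboundary`): a
reverse martingale difference. Kakutani's formula `lintegral_eq_lintegral_excursion` expresses μ by
sums over excursions, and uniqueness identifies the induced measure with a multiple of λ.

For a horizon k, the excursion sums of v are discarded where τ > k and recentred by a constant
O(1/k). The result V satisfies |V| ≤ C min(τ, k). Since 2(p - 1) = (p - 2) + p, its conditional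
moment of order 2(p - 1) is at most a constant times k^(p-2), and k terms contribute k^(p-1), the
same order as the (p - 1)-st power of the sum of the conditional variances. A Rosenthal-type bound
(`integral_abs_revSum_rpow_le`), obtained by iterating a Taylor inequality, and Doob's inequality
(`integral_revMax_rpow_le`) turn this into maximal bounds. The same two lemmas treat iterated sums,
which are martingale transforms whose weights are Birkhoff sums, up to boundary terms.

Chen's relation `iterSum_add` passes between sums over excursions and sums along the orbit of T
(`pathwise_bound`, `pathwise_bound_iterate`). Returning from λ to μ costs one factor τ, which is
affordable because τ * τ^(p-1) = τ^p (`lintegral_rpow_le`). Finally Lebesgue measure is at most a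
constant times μ, and invariance of μ removes the initial shift ℓ. -/

/-! ### Elementary inequalities for real powers -/

/-- Young's inequality with a free small parameter and unsharp constants. Either `b ^ s ≤ ε * a ^ s`
and the first term dominates, or a is at most a multiple of b and the second does. A small ε allows
the first term to be absorbed. -/
theorem rpow_sub_mul_rpow_le {r s ε a b : ℝ} (hs : 0 < s) (hsr : s ≤ r) (hε : 0 < ε)
    (ha : 0 ≤ a) (hb : 0 ≤ b) :
    a ^ (r - s) * b ^ s ≤ ε * a ^ r + ε ^ (-((r - s) / s)) * b ^ r := by
  have hr : 0 < r := hs.trans_le hsr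
  have key : ∀ c : ℝ, 0 ≤ c → c ^ (r - s) * c ^ s = c ^ r := fun c hc => by
    rw [← Real.rpow_add' hc (by linarith)]; congr 1; ring
  by_cases h : b ^ s ≤ ε * a ^ s
  · have h1 : a ^ (r - s) * b ^ s ≤ a ^ (r - s) * (ε * a ^ s) :=
      mul_le_mul_of_nonneg_left h (Real.rpow_nonneg ha _)
    have h2 := key a ha
    have h3 : 0 ≤ ε ^ (-((r - s) / s)) * b ^ r := by positivity
    nlinarith
  · have h := (not_le.mp h).le
    have h1 : a ≤ ε ^ (-(1 / s)) * b := by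
      have h4 : (ε * a ^ s) ^ (1 / s) ≤ (b ^ s) ^ (1 / s) :=
        Real.rpow_le_rpow (by positivity) h (by positivity)
      rw [Real.mul_rpow hε.le (by positivity), ← Real.rpow_mul ha, ← Real.rpow_mul hb,
        mul_one_div_cancel hs.ne', Real.rpow_one, Real.rpow_one] at h4
      rw [Real.rpow_neg hε.le, inv_mul_eq_div, le_div_iff₀ (by positivity)]
      linarith
    have h2 : a ^ (r - s) ≤ ε ^ (-((r - s) / s)) * b ^ (r - s) := by
      refine (Real.rpow_le_rpow ha h1 (by linarith)).trans_eq ?_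
      rw [Real.mul_rpow (by positivity) hb, ← Real.rpow_mul hε.le]
      congr 2
      field_simp
    have h3 := mul_le_mul_of_nonneg_right h2 (Real.rpow_nonneg hb s)
    rw [mul_assoc, key b hb] at h3
    have : 0 ≤ ε * a ^ r := by positivity
    linarith

/-- Convexity: on [1, 2] the power lies below its chord. -/
theorem one_add_rpow_le_chord {q t : ℝ} (hq : 1 ≤ q) (h0 : 0 ≤ t) (h1 : t ≤ 1) :
    (1 + t) ^ q ≤ 1 + t * (2 ^ q - 1) := by
  have h := (convexOn_rpow hq).2 (show (1 : ℝ) ∈ Set.Ici 0 by simp)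
    (show (2 : ℝ) ∈ Set.Ici 0 by simp) (show 0 ≤ 1 - t by linarith) h0 (by ring)
  simp only [smul_eq_mul, Real.one_rpow] at h
  have e : (1 - t) * 1 + t * 2 = 1 + t := by ring
  rw [e] at h
  linarith

/-- The coefficient of `a ^ q` is exactly 1, so that the estimate can be iterated along a sum
without exponential growth of constants. -/
theorem add_rpow_le_add_mul {q a b : ℝ} (hq : 1 ≤ q) (ha : 0 ≤ a) (hb : 0 ≤ b) :
    (a + b) ^ q ≤ a ^ q + 2 ^ q * (a ^ (q - 1) * b + b ^ q) := by
  have h2 : (0 : ℝ) < 2 ^ q := by positivity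
  by_cases h : b ≤ a
  · rcases ha.eq_or_lt with rfl | ha'
    · have : b = 0 := le_antisymm h hb
      subst this
      simp only [add_zero]
      have : 0 ≤ (2 : ℝ) ^ q * ((0 : ℝ) ^ (q - 1) * 0 + 0 ^ q) := by positivity
      linarith
    have e : a + b = a * (1 + b / a) := by field_simp
    have h3 := one_add_rpow_le_chord hq (div_nonneg hb ha) ((div_le_one ha').2 h)
    rw [e, Real.mul_rpow ha (by positivity)]
    have h4 : a ^ q = a ^ (q - 1) * a := by
      rw [← Real.rpow_add_one ha'.ne']; congr 1; ring
    have h5 : a ^ q * (b / a) = a ^ (q - 1) * b := by rw [h4]; field_simp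
    have h6 : 0 ≤ b ^ q := by positivity
    have h7 : 0 ≤ a ^ (q - 1) * b := by positivity
    have h8 : 0 ≤ a ^ q := by positivity
    calc a ^ q * (1 + b / a) ^ q ≤ a ^ q * (1 + b / a * (2 ^ q - 1)) := by gcongr
      _ = a ^ q + (2 ^ q - 1) * (a ^ (q - 1) * b) := by rw [← h5]; ring
      _ ≤ _ := by nlinarith
  · have h' := (not_le.mp h).le
    have : (a + b) ^ q ≤ (2 * b) ^ q := Real.rpow_le_rpow (by positivity) (by linarith) (by linarith)
    rw [Real.mul_rpow (by norm_num) hb] at this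
    have h7 : 0 ≤ a ^ (q - 1) * b := by positivity
    have h8 : 0 ≤ a ^ q := by positivity
    nlinarith

theorem one_add_rpow_le_taylor {r t : ℝ} (hr : 2 ≤ r) (h0 : -1 < t) (h1 : t ≤ 1) :
    (1 + t) ^ r ≤ 1 + r * t + (r * 2 ^ r + r ^ 2) * t ^ 2 := by
  have hp : 0 < 1 + t := by linarith
  -- Bernoulli's inequality for 1 / (1 + t) = 1 - t / (1 + t), multiplied by (1 + t)^r. The
  -- remaining factor (1 + t)^(r-1) is bounded above by the chord when t ≥ 0, and below by Bernoulli
  -- when t ≤ 0, where its coefficient is nonpositive.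
  have ha : (1 + t) ^ r ≤ 1 + r * t * (1 + t) ^ (r - 1) := by
    have hb := one_add_mul_self_le_rpow_one_add (s := -t / (1 + t))
      (by rw [le_div_iff₀ hp]; linarith) (p := r) (by linarith)
    have e : 1 + -t / (1 + t) = (1 + t)⁻¹ := by field_simp; ring
    rw [e, Real.inv_rpow hp.le] at hb
    have h3 : (1 + t) ^ r = (1 + t) ^ (r - 1) * (1 + t) := by
      rw [← Real.rpow_add_one hp.ne']; congr 1; ring
    have h4 : 0 < (1 + t) ^ r := by positivity
    have h5 := mul_le_mul_of_nonneg_left hb h4.le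
    rw [mul_inv_cancel₀ h4.ne'] at h5
    have h6 : (1 + t) ^ r * (1 + r * (-t / (1 + t))) = (1 + t) ^ r - r * t * (1 + t) ^ (r - 1) := by
      rw [h3]; field_simp; ring
    linarith
  have hpow : (0 : ℝ) < 2 ^ r := by positivity
  rcases le_total 0 t with ht | ht
  · have h3 := one_add_rpow_le_chord (q := r - 1) (by linarith) ht h1
    have h4 : (2 : ℝ) ^ (r - 1) ≤ 2 ^ r := Real.rpow_le_rpow_of_exponent_le (by norm_num) (by linarith)
    have h5 : r * t * (1 + t) ^ (r - 1) ≤ r * t * (1 + t * 2 ^ r) := by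
      refine mul_le_mul_of_nonneg_left ?_ (by positivity)
      nlinarith
    have h6 : 0 ≤ r ^ 2 * t ^ 2 := by positivity
    nlinarith
  · have h3 := one_add_mul_self_le_rpow_one_add (s := t) h0.le (p := r - 1) (by linarith)
    have h5 : r * t * (1 + t) ^ (r - 1) ≤ r * t * (1 + (r - 1) * t) :=
      mul_le_mul_of_nonpos_left h3 (by nlinarith)
    have h6 : 0 ≤ r * 2 ^ r * t ^ 2 := by positivity
    have h7 : 0 ≤ r * t ^ 2 := by positivity
    nlinarith

/-- The linear term is kept exactly, because orthogonality of a martingale difference will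
annihilate it after integration. For |y| < |x| the inequality is the one-variable bound at t = y /
x. Otherwise every term is dominated by a multiple of `|y| ^ r`. -/
theorem abs_add_rpow_le_taylor {r : ℝ} (hr : 2 ≤ r) (x y : ℝ) :
    |x + y| ^ r ≤ |x| ^ r + r * (|x| ^ (r - 2) * x) * y
      + (r * 2 ^ r + r ^ 2 + 2 ^ r + r) * (|x| ^ (r - 2) * y ^ 2 + |y| ^ r) := by
  have hpow : (0 : ℝ) < 2 ^ r := by positivity
  have hsq : ∀ z : ℝ, |z| ^ (r - 2) * z ^ 2 = |z| ^ r := fun z => by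
    rw [← sq_abs z, ← Real.rpow_natCast |z| 2, ← Real.rpow_add' (abs_nonneg z) (by norm_num; linarith)]
    congr 1; norm_num
  have hy : 0 ≤ |y| ^ r := by positivity
  have hxy : 0 ≤ |x| ^ (r - 2) * y ^ 2 := by positivity
  have hx : 0 ≤ |x| ^ r := by positivity
  by_cases h : |x| ≤ |y|
  · have h1 : |x + y| ^ r ≤ 2 ^ r * |y| ^ r := by
      rw [← Real.mul_rpow (by norm_num) (abs_nonneg y)]
      exact Real.rpow_le_rpow (abs_nonneg _) ((abs_add_le x y).trans (by linarith)) (by linarith)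
    have h2 : |(|x| ^ (r - 2) * x) * y| ≤ |y| ^ r := by
      rw [abs_mul, abs_mul, abs_of_nonneg (by positivity : 0 ≤ |x| ^ (r - 2)), ← hsq y, mul_assoc]
      have : |x| ^ (r - 2) ≤ |y| ^ (r - 2) := Real.rpow_le_rpow (abs_nonneg x) h (by linarith)
      refine mul_le_mul this ?_ (by positivity) (by positivity)
      rw [← sq_abs y]; nlinarith [abs_nonneg y]
    have h3 := neg_le_of_abs_le h2
    have h4 : 0 ≤ (r * 2 ^ r + r ^ 2 + 2 ^ r + r) * (|x| ^ (r - 2) * y ^ 2) := by positivity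
    have h5 : 0 ≤ (r * 2 ^ r + r ^ 2) * |y| ^ r := by positivity
    nlinarith
  · have h' := not_le.mp h
    have hx0 : x ≠ 0 := by rintro rfl; simp at h'; linarith [abs_nonneg y]
    have ht : |y / x| < 1 := by rw [abs_div]; exact (div_lt_one (abs_pos.2 hx0)).2 h'
    have h3 := one_add_rpow_le_taylor hr (abs_lt.1 ht).1 (abs_lt.1 ht).2.le
    have e : |x + y| = |x| * (1 + y / x) := by
      rw [← abs_of_pos (by linarith [(abs_lt.1 ht).1] : 0 < 1 + y / x), ← abs_mul]
      congr 1; field_simp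
    rw [e, Real.mul_rpow (abs_nonneg x) (by linarith [(abs_lt.1 ht).1])]
    have h4 := mul_le_mul_of_nonneg_left h3 hx
    have e1 : |x| ^ r * (y / x) = (|x| ^ (r - 2) * x) * y := by
      rw [← hsq x]; field_simp
    have e2 : |x| ^ r * (y / x) ^ 2 = |x| ^ (r - 2) * y ^ 2 := by
      rw [← hsq x]; field_simp
    have e3 : |x| ^ r * (1 + r * (y / x) + (r * 2 ^ r + r ^ 2) * (y / x) ^ 2)
        = |x| ^ r + r * (|x| ^ r * (y / x)) + (r * 2 ^ r + r ^ 2) * (|x| ^ r * (y / x) ^ 2) := by ring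
    rw [e3, e1, e2] at h4
    have h5 : 0 ≤ (2 ^ r + r) * (|x| ^ (r - 2) * y ^ 2) := by positivity
    have h6 : 0 ≤ (r * 2 ^ r + r ^ 2 + 2 ^ r + r) * |y| ^ r := by positivity
    nlinarith

/-- The pathwise inequality behind Doob's maximal inequality. -/
theorem doob_step {r : ℝ} (hr : 2 ≤ r) {a w D : ℝ} (haw : |w| ≤ a) :
    max |w + D| a ^ r - r / (r - 1) * (max |w + D| a ^ (r - 1) * |w + D|)
      ≤ a ^ r - r / (r - 1) * (a ^ (r - 1) * |w|)
        - r / (r - 1) * (a ^ (r - 1) * (if 0 ≤ w then 1 else -1)) * D := by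
  have ha : 0 ≤ a := (abs_nonneg w).trans haw
  have hc : 0 < r / (r - 1) := div_pos (by linarith) (by linarith)
  -- The tangent to the absolute value at w. Its slope depends on w only, so the term linear in D is
  -- again killed by orthogonality.
  have hs : |w| + (if 0 ≤ w then 1 else -1) * D ≤ |w + D| := by
    split_ifs with h
    · rw [abs_of_nonneg h, one_mul]; exact le_abs_self _
    · rw [abs_of_neg (not_le.1 h)]; have := neg_le_abs (w + D); linarith
  have hA : 0 ≤ r / (r - 1) * a ^ (r - 1) := by positivity
  have h1 := mul_le_mul_of_nonneg_left hs hA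
  suffices h : max |w + D| a ^ r - r / (r - 1) * (max |w + D| a ^ (r - 1) * |w + D|)
      ≤ a ^ r - r / (r - 1) * (a ^ (r - 1) * |w + D|) by
    calc _ ≤ _ := h
      _ ≤ _ := by nlinarith
  rcases le_total |w + D| a with hb | hb
  · rw [max_eq_right hb]
  · rw [max_eq_left hb]
    set b := |w + D| with hbdef
    have hb0 : 0 ≤ b := abs_nonneg _
    have e : b ^ (r - 1) * b = b ^ r := by
      rw [← Real.rpow_add_one' hb0 (by linarith)]; congr 1; ring
    rw [e]
    -- The case of a new maximum b ≥ a reduces to Young's inequality for `a ^ (r - 1) * b`; here the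
    -- constant r / (r - 1) is forced.
    have hY := Real.young_inequality_of_nonneg (a := a ^ (r - 1)) (b := b) (p := r / (r - 1)) (q := r)
      (by positivity) hb0
      (by rw [Real.holderConjugate_iff]; refine ⟨by rw [lt_div_iff₀ (by linarith)]; linarith, ?_⟩
          have : r - 1 ≠ 0 := by linarith
          field_simp; ring)
    rw [← Real.rpow_mul ha] at hY
    have e2 : (r - 1) * (r / (r - 1)) = r := by
      have : r - 1 ≠ 0 := by linarith
      field_simp
    rw [e2] at hY
    have h2 := mul_le_mul_of_nonneg_left hY hc.le
    have e3 : r / (r - 1) * (a ^ r / (r / (r - 1)) + b ^ r / r)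
        = a ^ r + (r / (r - 1) - 1) * b ^ r := by
      have : r - 1 ≠ 0 := by linarith
      field_simp; ring
    rw [e3] at h2
    linarith

/-! ### Bounded measurable functions -/

/-- Bounded measurable real functions. -/
def BddMeas {X : Type*} [MeasurableSpace X] (f : X → ℝ) : Prop :=
  Measurable f ∧ ∃ C, ∀ x, |f x| ≤ C

namespace BddMeas

variable {X : Type*} [MeasurableSpace X] {f g : X → ℝ}

theorem integrable (hf : BddMeas f) (μ : Measure X) [IsFiniteMeasure μ] : Integrable f μ := by
  obtain ⟨C, hC⟩ := hf.2
  exact Integrable.of_bound hf.1.aestronglyMeasurable C (ae_of_all _ hC)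

theorem const (c : ℝ) : BddMeas (fun _ : X => c) := ⟨measurable_const, |c|, fun _ => le_rfl⟩

theorem add (hf : BddMeas f) (hg : BddMeas g) : BddMeas (fun x => f x + g x) := by
  obtain ⟨C, hC⟩ := hf.2
  obtain ⟨D, hD⟩ := hg.2
  exact ⟨hf.1.add hg.1, C + D, fun x => (abs_add_le _ _).trans (add_le_add (hC x) (hD x))⟩

theorem mul (hf : BddMeas f) (hg : BddMeas g) : BddMeas (fun x => f x * g x) := by
  obtain ⟨C, hC⟩ := hf.2
  obtain ⟨D, hD⟩ := hg.2
  refine ⟨hf.1.mul hg.1, C * D, fun x => ?_⟩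
  rw [abs_mul]
  exact mul_le_mul (hC x) (hD x) (abs_nonneg _) ((abs_nonneg _).trans (hC x))

theorem const_mul (c : ℝ) (hf : BddMeas f) : BddMeas (fun x => c * f x) := (const c).mul hf

theorem neg (hf : BddMeas f) : BddMeas (fun x => - f x) := by
  simpa using hf.const_mul (-1)

theorem sub (hf : BddMeas f) (hg : BddMeas g) : BddMeas (fun x => f x - g x) := by
  simpa [sub_eq_add_neg] using hf.add hg.neg

theorem abs (hf : BddMeas f) : BddMeas (fun x => |f x|) :=
  ⟨hf.1.abs, hf.2.imp fun C hC x => by rw [abs_abs]; exact hC x⟩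

theorem pow (hf : BddMeas f) (n : ℕ) : BddMeas (fun x => f x ^ n) := by
  obtain ⟨C, hC⟩ := hf.2
  exact ⟨hf.1.pow_const n, C ^ n, fun x => by rw [abs_pow]; exact pow_le_pow_left₀ (abs_nonneg _) (hC x) n⟩

theorem rpow (hf : BddMeas f) (h0 : ∀ x, 0 ≤ f x) {r : ℝ} (hr : 0 ≤ r) :
    BddMeas (fun x => f x ^ r) := by
  obtain ⟨C, hC⟩ := hf.2
  refine ⟨hf.1.pow_const r, C ^ r, fun x => ?_⟩
  rw [abs_of_nonneg (Real.rpow_nonneg (h0 x) r)]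
  exact Real.rpow_le_rpow (h0 x) ((le_abs_self _).trans (hC x)) hr

theorem abs_rpow (hf : BddMeas f) {r : ℝ} (hr : 0 ≤ r) : BddMeas (fun x => |f x| ^ r) :=
  hf.abs.rpow (fun _ => abs_nonneg _) hr

theorem max (hf : BddMeas f) (hg : BddMeas g) : BddMeas (fun x => max (f x) (g x)) := by
  obtain ⟨C, hC⟩ := hf.2
  obtain ⟨D, hD⟩ := hg.2
  refine ⟨hf.1.max hg.1, Max.max C D, fun x => ?_⟩
  exact (abs_max_le_max_abs_abs).trans (max_le_max (hC x) (hD x))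

theorem comp (hf : BddMeas f) {Y : Type*} [MeasurableSpace Y] {G : Y → X} (hG : Measurable G) :
    BddMeas (fun x => f (G x)) :=
  ⟨hf.1.comp hG, hf.2.imp fun _ hC x => hC (G x)⟩

theorem sum {ι : Type*} (s : Finset ι) {F : ι → X → ℝ} (hF : ∀ i ∈ s, BddMeas (F i)) :
    BddMeas (fun x => ∑ i ∈ s, F i x) := by
  classical
  induction s using Finset.induction_on with
  | empty => simpa using const (X := X) 0
  | insert i s hi ih =>
    simp only [Finset.sum_insert hi]
    exact (hF i (by simp)).add (ih fun j hj => hF j (by simp [hj]))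

end BddMeas

/-! ### Reverse martingale transforms -/

section ReverseMartingale

variable {X : Type*}

/-- The sums `∑_{l < n} (m ∘ G^l) * (s_{n-1-l} ∘ G^{l+1})`. -/
def revSum (G : X → X) (m : X → ℝ) (s : ℕ → X → ℝ) : ℕ → X → ℝ
  | 0 => fun _ => 0
  | n + 1 => fun x => m x * s n (G x) + revSum G m s n (G x)

/-- The maximal function `max_{j ≤ n} |u_{n-j} ∘ G^j|`. -/
def revMax (G : X → X) (u : ℕ → X → ℝ) : ℕ → X → ℝ
  | 0 => fun x => |u 0 x|
  | n + 1 => fun x => max |u (n + 1) x| (revMax G u n (G x))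

theorem abs_le_revMax (G : X → X) (u : ℕ → X → ℝ) (n : ℕ) (x : X) : |u n x| ≤ revMax G u n x := by
  cases n with
  | zero => exact le_rfl
  | succ n => exact le_max_left _ _

theorem revMax_nonneg (G : X → X) (u : ℕ → X → ℝ) (n : ℕ) (x : X) : 0 ≤ revMax G u n x :=
  (abs_nonneg _).trans (abs_le_revMax G u n x)

/-- For a reverse martingale the natural maximal function runs over sums that start later and end at
a common time. Sums from time 0 are recovered afterwards as differences of two of these. -/
theorem abs_iterate_le_revMax (G : X → X) (u : ℕ → X → ℝ) (n j : ℕ) (x : X) :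
    |u n (G^[j] x)| ≤ revMax G u (n + j) x := by
  induction j generalizing x with
  | zero => exact abs_le_revMax G u n x
  | succ j ih => exact (ih (G x)).trans (le_max_right _ _)

variable [MeasurableSpace X]

theorem BddMeas.revSum {G : X → X} (hG : Measurable G) {m : X → ℝ} (hm : BddMeas m)
    {s : ℕ → X → ℝ} (hs : ∀ n, BddMeas (s n)) (n : ℕ) : BddMeas (revSum G m s n) := by
  induction n with
  | zero => exact BddMeas.const 0
  | succ n ih => exact (hm.mul ((hs n).comp hG)).add (ih.comp hG)

theorem BddMeas.revMax {G : X → X} (hG : Measurable G) {u : ℕ → X → ℝ} (hu : ∀ n, BddMeas (u n))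
    (n : ℕ) : BddMeas (revMax G u n) := by
  induction n with
  | zero => exact (hu 0).abs
  | succ n ih => exact (hu (n + 1)).abs.max (ih.comp hG)

theorem integral_comp_of_measurePreserving {lam : Measure X} {G : X → X}
    (hG : MeasurePreserving G lam lam) {f : X → ℝ} (hf : Measurable f) :
    ∫ x, f (G x) ∂lam = ∫ x, f x ∂lam := by
  conv_rhs => rw [← hG.map_eq]
  rw [integral_map hG.measurable.aemeasurable hf.aestronglyMeasurable]

/-- Moments of a reverse martingale transform. -/
theorem integral_abs_revSum_rpow_le {r : ℝ} (hr : 2 ≤ r) {lam : Measure X} [IsProbabilityMeasure lam]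
    {G : X → X} (hG : MeasurePreserving G lam lam) {m : X → ℝ} (hm : BddMeas m)
    (horth : ∀ w : X → ℝ, BddMeas w → ∫ x, m x * w (G x) ∂lam = 0)
    {A B S C₀ : ℝ} (hA0 : 0 < A) (hC₀ : C₀ = r * 2 ^ r + r ^ 2 + 2 ^ r + r)
    (hA : ∀ w : X → ℝ, BddMeas w → (∀ x, 0 ≤ w x) →
      ∫ x, m x ^ 2 * w (G x) ∂lam ≤ A * ∫ x, w x ∂lam)
    (hB0 : 0 ≤ B) (hB : ∀ w : X → ℝ, BddMeas w → (∀ x, 0 ≤ w x) →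
      ∫ x, |m x| ^ r * w (G x) ∂lam ≤ B * ∫ x, w x ∂lam)
    {s : ℕ → X → ℝ} (hs : ∀ n, BddMeas (s n)) {k : ℕ} (hk : 0 < k)
    (hS0 : 0 ≤ S) (hS : ∀ n < k, ∫ x, |s n x| ^ r ∂lam ≤ S) {n : ℕ} (hn : n ≤ k) :
    ∫ x, |revSum G m s n x| ^ r ∂lam
      ≤ 2 * C₀ * (1 + (2 * C₀) ^ ((r - 2) / 2)) * ((k * A) ^ (r / 2) + k * B) * S := by
  have hGm := hG.measurable
  have hC0 : 0 < C₀ := by rw [hC₀]; positivity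
  set W := revSum G m s with hW
  have hWb : ∀ n, BddMeas (W n) := fun n => BddMeas.revSum hGm hm hs n
  set u : ℕ → ℝ := fun n => ∫ x, |W n x| ^ r ∂lam with hu
  have hu0 : ∀ n, 0 ≤ u n := fun n => integral_nonneg fun x => by positivity
  have hkR : (0 : ℝ) < k := by exact_mod_cast hk
  -- With this ε, k steps accumulate at most half of the largest moment, which can then be absorbed.
  set ε : ℝ := (2 * C₀ * A * k)⁻¹ with hε
  have hε0 : 0 < ε := by positivity
  set ε' : ℝ := ε ^ (-((r - 2) / 2)) with hε'
  have hε'0 : 0 < ε' := by positivity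
  have step : ∀ n < k, u (n + 1) ≤ u n + C₀ * (A * (ε * u n + ε' * S) + B * S) := by
    intro n hnk
    have b1 : BddMeas (fun x => |W n x| ^ r) := (hWb n).abs_rpow (by linarith)
    have b2 : BddMeas (fun x => r * (|W n x| ^ (r - 2) * W n x) * s n x) :=
      ((((hWb n).abs_rpow (by linarith)).mul (hWb n)).const_mul r).mul (hs n)
    have b3 : BddMeas (fun x => |W n x| ^ (r - 2) * s n x ^ 2) :=
      ((hWb n).abs_rpow (by linarith)).mul ((hs n).pow 2)
    have b4 : BddMeas (fun x => |s n x| ^ r) := (hs n).abs_rpow (by linarith)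
    -- Taylor expansion of W (n + 1) = W n ∘ G + m * s n ∘ G. After integration the first term keeps
    -- its moment by invariance, the linear one vanishes by `horth`, and the last two are bounded
    -- through `hA` and `hB`.
    have hpt : ∀ x, |W (n + 1) x| ^ r ≤ |W n (G x)| ^ r
        + m x * (r * (|W n (G x)| ^ (r - 2) * W n (G x)) * s n (G x))
        + (C₀ * (m x ^ 2 * (|W n (G x)| ^ (r - 2) * s n (G x) ^ 2))
          + C₀ * (|m x| ^ r * |s n (G x)| ^ r)) := by
      intro x
      have h := abs_add_rpow_le_taylor hr (W n (G x)) (m x * s n (G x))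
      rw [← hC₀, abs_mul, Real.mul_rpow (abs_nonneg _) (abs_nonneg _)] at h
      have e : W (n + 1) x = W n (G x) + m x * s n (G x) := by
        simp only [hW, _root_.revSum]; ring
      rw [e]
      refine h.trans (le_of_eq ?_)
      ring
    have i1 := b1.comp hGm
    have i2 := hm.mul (b2.comp hGm)
    have i3 := ((hm.pow 2).mul (b3.comp hGm)).const_mul C₀
    have i4 := ((hm.abs_rpow (r := r) (by linarith)).mul (b4.comp hGm)).const_mul C₀
    have hint := integral_mono (((hWb (n + 1)).abs_rpow (r := r) (by linarith)).integrable lam)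
      (((i1.add i2).add (i3.add i4)).integrable lam) hpt
    rw [integral_add ((i1.add i2).integrable lam) ((i3.add i4).integrable lam),
      integral_add (i1.integrable lam) (i2.integrable lam),
      integral_add (i3.integrable lam) (i4.integrable lam), horth _ b2,
      integral_const_mul, integral_const_mul, integral_comp_of_measurePreserving hG b1.1] at hint
    have hAA := hA _ b3 (fun x => by positivity)
    have hBB := hB _ b4 (fun x => by positivity)
    have h3 : ∫ x, |W n x| ^ (r - 2) * s n x ^ 2 ∂lam ≤ ε * u n + ε' * S := by
      have hpt3 : ∀ x, |W n x| ^ (r - 2) * s n x ^ 2 ≤ ε * |W n x| ^ r + ε' * |s n x| ^ r := by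
        intro x
        have := rpow_sub_mul_rpow_le (r := r) (s := 2) (by norm_num) hr hε0 (abs_nonneg (W n x))
          (abs_nonneg (s n x))
        rwa [Real.rpow_two, sq_abs] at this
      have i5 := (b1.const_mul ε).integrable lam
      have i6 := (b4.const_mul ε').integrable lam
      have := integral_mono (b3.integrable lam) (i5.add i6) hpt3
      simp only [Pi.add_apply] at this
      rw [integral_add i5 i6, integral_const_mul, integral_const_mul] at this
      have := mul_le_mul_of_nonneg_left (hS n hnk) hε'0.le
      linarith
    have h4 := mul_le_mul_of_nonneg_left (hS n hnk) hB0
    have h5 := mul_le_mul_of_nonneg_left h3 hA0.le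
    have h6 : C₀ * ∫ x, m x ^ 2 * (|W n (G x)| ^ (r - 2) * s n (G x) ^ 2) ∂lam
        ≤ C₀ * (A * (ε * u n + ε' * S)) := by gcongr; linarith
    have h7 : C₀ * ∫ x, |m x| ^ r * |s n (G x)| ^ r ∂lam ≤ C₀ * (B * S) := by gcongr; linarith
    linarith
  -- All increments are estimated by the largest moment u N, which bounds u N by half of itself plus
  -- the desired quantity.
  obtain ⟨N, hN, hNmax⟩ := Finset.exists_max_image (Finset.range (k + 1)) u ⟨0, by simp⟩
  have hZ : ∀ n ≤ k, u n ≤ u N := fun n hn => hNmax n (by simp; omega)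
  have hsum : ∀ n ≤ k, u n ≤ n * (C₀ * (A * (ε * u N + ε' * S) + B * S)) := by
    intro n
    induction n with
    | zero =>
      intro _
      have h0 : ∀ x, |W 0 x| ^ r = 0 := fun x => by
        simp only [hW, _root_.revSum, abs_zero]
        exact Real.zero_rpow (by linarith)
      simp [hu, h0]
    | succ n ih =>
      intro hn
      have h1 := ih (by omega)
      have h2 := step n (by omega)
      have h3 : C₀ * (A * (ε * u n + ε' * S) + B * S) ≤ C₀ * (A * (ε * u N + ε' * S) + B * S) := by
        have := hZ n (by omega)
        gcongr
      push_cast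
      linarith
  have hNk : N ≤ k := by have := Finset.mem_range.1 hN; omega
  have h1 := hsum N hNk
  have h2 : (N : ℝ) * (C₀ * (A * (ε * u N + ε' * S) + B * S))
      ≤ k * (C₀ * (A * (ε * u N + ε' * S) + B * S)) := by
    have := hu0 N
    gcongr
  have e1 : (k : ℝ) * (C₀ * (A * (ε * u N + ε' * S) + B * S))
      = u N / 2 + C₀ * (k * A * ε' + k * B) * S := by
    rw [hε]; field_simp; ring
  have e2 : k * A * ε' = (2 * C₀) ^ ((r - 2) / 2) * (k * A) ^ (r / 2) := by
    rw [hε', hε, Real.rpow_neg (by positivity), Real.inv_rpow (by positivity), inv_inv,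
      show 2 * C₀ * A * k = (2 * C₀) * (k * A) by ring, Real.mul_rpow (by positivity) (by positivity)]
    have : (k * A) ^ (r / 2) = (k * A) ^ ((r - 2) / 2) * (k * A) := by
      rw [← Real.rpow_add_one (by positivity)]; congr 1; ring
    rw [this]; ring
  have h3 : u N ≤ 2 * C₀ * (k * A * ε' + k * B) * S := by linarith
  refine (hZ n hn).trans (h3.trans ?_)
  rw [e2]
  have hP : 0 ≤ (k * A) ^ (r / 2) := by positivity
  have hQ : 0 ≤ (2 * C₀) ^ ((r - 2) / 2) := by positivity
  have hR : 0 ≤ k * B := by positivity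
  have : (2 * C₀) ^ ((r - 2) / 2) * (k * A) ^ (r / 2) + k * B
      ≤ (1 + (2 * C₀) ^ ((r - 2) / 2)) * ((k * A) ^ (r / 2) + k * B) := by nlinarith [mul_nonneg hQ hR]
  calc _ ≤ 2 * C₀ * ((1 + (2 * C₀) ^ ((r - 2) / 2)) * ((k * A) ^ (r / 2) + k * B)) * S := by gcongr
    _ = _ := by ring

/-- Doob's maximal inequality for reverse martingale transforms. -/
theorem integral_revMax_rpow_le {r : ℝ} (hr : 2 ≤ r) {lam : Measure X} [IsProbabilityMeasure lam]
    {G : X → X} (hG : MeasurePreserving G lam lam) {m : X → ℝ} (hm : BddMeas m)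
    (horth : ∀ w : X → ℝ, BddMeas w → ∫ x, m x * w (G x) ∂lam = 0)
    {s : ℕ → X → ℝ} (hs : ∀ n, BddMeas (s n)) (n : ℕ) :
    ∫ x, revMax G (revSum G m s) n x ^ r ∂lam
      ≤ 2 * (r / (r - 1)) * (2 * (r / (r - 1))) ^ (r - 1) * ∫ x, |revSum G m s n x| ^ r ∂lam := by
  have hGm := hG.measurable
  set c := r / (r - 1) with hc
  have hc0 : 0 < c := div_pos (by linarith) (by linarith)
  set W := revSum G m s with hW
  have hWb : ∀ n, BddMeas (W n) := fun n => BddMeas.revSum hGm hm hs n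
  set M := revMax G W with hM
  have hMb : ∀ n, BddMeas (M n) := fun n => BddMeas.revMax hGm hWb n
  have hM0 : ∀ n x, 0 ≤ M n x := fun n x => revMax_nonneg G W n x
  have hMr : ∀ n, BddMeas (fun x => M n x ^ r) := fun n => (hMb n).rpow (hM0 n) (by linarith)
  have hMW : ∀ n, BddMeas (fun x => M n x ^ (r - 1) * |W n x|) := fun n =>
    ((hMb n).rpow (hM0 n) (by linarith)).mul (hWb n).abs
  -- This integral vanishes for n = 0 and does not increase with n, by `doob_step` and
  -- orthogonality.
  have key : ∀ n, ∫ x, (M n x ^ r - c * (M n x ^ (r - 1) * |W n x|)) ∂lam ≤ 0 := by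
    intro n
    induction n with
    | zero =>
      have : ∀ x, M 0 x ^ r - c * (M 0 x ^ (r - 1) * |W 0 x|) = 0 := fun x => by
        simp only [hM, hW, _root_.revMax, _root_.revSum, abs_zero, mul_zero, sub_zero]
        exact Real.zero_rpow (by linarith)
      simp [this]
    | succ n ih =>
      have hsg : BddMeas (fun x => if 0 ≤ W n x then (1 : ℝ) else -1) := by
        refine ⟨Measurable.ite (measurableSet_le measurable_const (hWb n).1) measurable_const
          measurable_const, 1, fun x => ?_⟩
        dsimp only
        split_ifs <;> simp
      have b2 : BddMeas (fun x => c * (M n x ^ (r - 1) * (if 0 ≤ W n x then 1 else -1)) * s n x) :=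
        ((((hMb n).rpow (hM0 n) (by linarith)).mul hsg).const_mul c).mul (hs n)
      have b1 : BddMeas (fun x => M n x ^ r - c * (M n x ^ (r - 1) * |W n x|)) :=
        (hMr n).sub ((hMW n).const_mul c)
      have hpt : ∀ x, M (n + 1) x ^ r - c * (M (n + 1) x ^ (r - 1) * |W (n + 1) x|)
          ≤ (M n (G x) ^ r - c * (M n (G x) ^ (r - 1) * |W n (G x)|))
            - m x * (c * (M n (G x) ^ (r - 1) * (if 0 ≤ W n (G x) then 1 else -1)) * s n (G x)) := by
        intro x
        have e : W (n + 1) x = W n (G x) + m x * s n (G x) := by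
          simp only [hW, _root_.revSum]; ring
        have h := doob_step hr (a := M n (G x)) (w := W n (G x)) (D := m x * s n (G x))
          (abs_le_revMax G W n (G x))
        have e2 : M (n + 1) x = max |W n (G x) + m x * s n (G x)| (M n (G x)) := by
          rw [← e]; rfl
        rw [e2, e]
        refine h.trans (le_of_eq ?_)
        rw [← hc]; ring
      have i1 := (b1.comp hGm).integrable lam
      have i2 := (hm.mul (b2.comp hGm)).integrable lam
      have hint := integral_mono (((hMr (n + 1)).sub ((hMW (n + 1)).const_mul c)).integrable lam)
        (i1.sub i2) hpt
      simp only [Pi.sub_apply] at hint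
      rw [integral_sub i1 i2, horth _ b2, integral_comp_of_measurePreserving hG b1.1] at hint
      linarith
  have h1 := key n
  rw [integral_sub ((hMr n).integrable lam) (((hMW n).const_mul c).integrable lam),
    integral_const_mul] at h1
  -- Chosen to absorb half of the moment of M.
  set ε : ℝ := (2 * c)⁻¹ with hε
  have hε0 : 0 < ε := by positivity
  have hpt : ∀ x, M n x ^ (r - 1) * |W n x| ≤ ε * M n x ^ r + ε ^ (-(r - 1)) * |W n x| ^ r := by
    intro x
    have := rpow_sub_mul_rpow_le (r := r) (s := 1) (by norm_num) (by linarith) hε0 (hM0 n x)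
      (abs_nonneg (W n x))
    rwa [Real.rpow_one, div_one] at this
  have i5 := ((hMr n).const_mul ε).integrable lam
  have i6 := (((hWb n).abs_rpow (r := r) (by linarith)).const_mul (ε ^ (-(r - 1)))).integrable lam
  have h2 := integral_mono ((hMW n).integrable lam) (i5.add i6) hpt
  simp only [Pi.add_apply] at h2
  rw [integral_add i5 i6, integral_const_mul, integral_const_mul] at h2
  have h3 := mul_le_mul_of_nonneg_left h2 hc0.le
  have e1 : c * (ε * ∫ x, M n x ^ r ∂lam + ε ^ (-(r - 1)) * ∫ x, |W n x| ^ r ∂lam)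
      = (∫ x, M n x ^ r ∂lam) / 2 + c * (2 * c) ^ (r - 1) * ∫ x, |W n x| ^ r ∂lam := by
    rw [Real.rpow_neg hε0.le, hε, Real.inv_rpow (by positivity), inv_inv]
    field_simp
  rw [e1] at h3
  linarith

end ReverseMartingale

/-! ### Iterated sums along orbits -/

section IterSum

variable {X : Type*}

/-- The iterated sum `∑_{i < j < n} (v ∘ G^i) * (w ∘ G^j)`. -/
def iterSum (G : X → X) (v w : X → ℝ) : ℕ → X → ℝ
  | 0 => fun _ => 0
  | n + 1 => fun x => iterSum G v w n (G x) + v x * birkhoffSum G w n (G x)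

/-- Chen's relation: a pair i < j lies before time m, after it, or on both sides of it. -/
theorem iterSum_add (G : X → X) (v w : X → ℝ) (m n : ℕ) (x : X) :
    iterSum G v w (m + n) x = iterSum G v w m x + iterSum G v w n (G^[m] x)
      + birkhoffSum G v m x * birkhoffSum G w n (G^[m] x) := by
  induction m generalizing x with
  | zero => simp [iterSum]
  | succ m ih =>
    rw [show m + 1 + n = (m + n) + 1 by ring]
    simp only [iterSum]
    rw [ih, birkhoffSum_add, birkhoffSum_succ' G v]
    simp only [Function.iterate_succ_apply]
    ring

/-- The coboundary telescopes and leaves two boundary values. -/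
theorem birkhoffSum_eq_revSum (G : X → X) (V χ : X → ℝ) (n : ℕ) (x : X) :
    birkhoffSum G V n x
      = revSum G (fun x => V x + χ x - χ (G x)) (fun _ _ => 1) n x + χ (G^[n] x) - χ x := by
  induction n generalizing x with
  | zero => simp [revSum]
  | succ n ih => rw [birkhoffSum_succ', ih, revSum, Function.iterate_succ_apply]; ring

/-- Only the earlier factor is replaced by a martingale difference. Summation by parts of the
coboundary against the Birkhoff sums of w leaves one boundary product and one diagonal sum, and
nothing is required of w. -/
theorem iterSum_eq_revSum (G : X → X) (V χ w : X → ℝ) (n : ℕ) (x : X) :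
    iterSum G V w n x = revSum G (fun x => V x + χ x - χ (G x)) (birkhoffSum G w) n x
      - χ x * birkhoffSum G w n x + birkhoffSum G (fun y => χ y * w y) n x := by
  induction n generalizing x with
  | zero => simp [iterSum, revSum]
  | succ n ih =>
    simp only [iterSum, revSum]
    rw [ih, birkhoffSum_succ', birkhoffSum_succ']; ring

variable [MeasurableSpace X]

theorem BddMeas.birkhoffSum {G : X → X} (hG : Measurable G) {v : X → ℝ} (hv : BddMeas v) (n : ℕ) :
    BddMeas (birkhoffSum G v n) := by
  have : BddMeas (fun x => ∑ l ∈ Finset.range n, v (G^[l] x)) :=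
    BddMeas.sum _ fun i _ => hv.comp (hG.iterate i)
  exact this

theorem BddMeas.iterSum {G : X → X} (hG : Measurable G) {v w : X → ℝ} (hv : BddMeas v)
    (hw : BddMeas w) (n : ℕ) : BddMeas (iterSum G v w n) := by
  induction n with
  | zero => exact BddMeas.const 0
  | succ n ih => exact (ih.comp hG).add (hv.mul ((BddMeas.birkhoffSum hG hw n).comp hG))

end IterSum

/-! ### Moments of sums over a measure preserving map -/

theorem add_rpow_le_two_rpow_mul {s a b : ℝ} (hs : 0 ≤ s) (ha : 0 ≤ a) (hb : 0 ≤ b) :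
    (a + b) ^ s ≤ 2 ^ s * (a ^ s + b ^ s) := by
  have ha' : 0 ≤ a ^ s := by positivity
  have hb' : 0 ≤ b ^ s := by positivity
  have h2 : (0 : ℝ) ≤ 2 ^ s := by positivity
  rcases le_total a b with h | h
  · calc (a + b) ^ s ≤ (2 * b) ^ s := Real.rpow_le_rpow (by positivity) (by linarith) hs
      _ = 2 ^ s * b ^ s := Real.mul_rpow (by norm_num) hb
      _ ≤ _ := by nlinarith
  · calc (a + b) ^ s ≤ (2 * a) ^ s := Real.rpow_le_rpow (by positivity) (by linarith) hs
      _ = 2 ^ s * a ^ s := Real.mul_rpow (by norm_num) ha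
      _ ≤ _ := by nlinarith

/-- Lowering an exponent at the scale c: compare a / c with 1. -/
theorem rpow_le_mul_one_add_rpow_div {s t c a : ℝ} (hs : 0 ≤ s) (hst : s ≤ t) (hc : 0 < c) (ha : 0 ≤ a) :
    a ^ s ≤ c ^ s * (1 + a ^ t / c ^ t) := by
  have hd : 0 ≤ a / c := by positivity
  have h : (a / c) ^ s ≤ 1 + (a / c) ^ t := by
    rcases le_total (a / c) 1 with h1 | h1
    · have := Real.rpow_le_one hd h1 hs
      have : 0 ≤ (a / c) ^ t := by positivity
      linarith
    · have := Real.rpow_le_rpow_of_exponent_le h1 hst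
      linarith
  rw [Real.div_rpow ha hc.le, Real.div_rpow ha hc.le] at h
  have hcs : 0 < c ^ s := by positivity
  rw [div_le_iff₀ hcs] at h
  linarith

section Moments

variable {X : Type*} [MeasurableSpace X]

/-- Lower moments are controlled by higher moments, with scaling. -/
theorem integral_rpow_le_of_rpow_le {lam : Measure X} [IsProbabilityMeasure lam] {f : X → ℝ}
    (hf : BddMeas f) (hf0 : ∀ x, 0 ≤ f x) {s t c D : ℝ} (hs : 0 ≤ s) (hst : s ≤ t) (hc : 0 < c)
    (h : ∫ x, f x ^ t ∂lam ≤ D * c ^ t) : ∫ x, f x ^ s ∂lam ≤ (1 + D) * c ^ s := by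
  have b1 := (hf.rpow hf0 (hs.trans hst)).const_mul (c ^ s / c ^ t)
  have hm := integral_mono ((hf.rpow hf0 hs).integrable lam) (((BddMeas.const (c ^ s)).add b1).integrable lam)
    (fun x => by
      have := rpow_le_mul_one_add_rpow_div hs hst hc (hf0 x)
      refine this.trans (le_of_eq ?_)
      ring)
  rw [integral_add ((BddMeas.const (c ^ s)).integrable lam) (b1.integrable lam), integral_const,
    integral_const_mul] at hm
  simp only [probReal_univ, smul_eq_mul, one_mul] at hm
  have hct : 0 < c ^ t := by positivity
  have hcs : 0 < c ^ s := by positivity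
  have := mul_le_mul_of_nonneg_left h (div_pos hcs hct).le
  have e : c ^ s / c ^ t * (D * c ^ t) = D * c ^ s := by field_simp
  linarith

/-- Moments of sums of nonnegative functions with bounded conditional expectations. -/
theorem integral_birkhoffSum_rpow_le {q : ℝ} (hq : 1 ≤ q) {lam : Measure X} [IsProbabilityMeasure lam]
    {G : X → X} (hG : MeasurePreserving G lam lam) {w : X → ℝ} (hw : BddMeas w) (hw0 : ∀ x, 0 ≤ w x)
    {A B : ℝ} (hA0 : 0 < A)
    (hA : ∀ u : X → ℝ, BddMeas u → (∀ x, 0 ≤ u x) →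
      ∫ x, w x * u (G x) ∂lam ≤ A * ∫ x, u x ∂lam)
    (hB0 : 0 ≤ B) (hB : ∫ x, w x ^ q ∂lam ≤ B) {k : ℕ} (hk : 0 < k) {n : ℕ} (hn : n ≤ k) :
    ∫ x, birkhoffSum G w n x ^ q ∂lam
      ≤ 2 * 2 ^ q * (1 + (2 * 2 ^ q) ^ (q - 1)) * ((k * A) ^ q + k * B) := by
  have hGm := hG.measurable
  set C₀ : ℝ := 2 ^ q with hC₀
  have hC0 : 0 < C₀ := by positivity
  set W := birkhoffSum G w with hW
  have hWb : ∀ n, BddMeas (W n) := fun n => BddMeas.birkhoffSum hGm hw n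
  have hW0 : ∀ n x, 0 ≤ W n x := fun n x => Finset.sum_nonneg fun i _ => hw0 _
  set u : ℕ → ℝ := fun n => ∫ x, W n x ^ q ∂lam with hu
  have hu0 : ∀ n, 0 ≤ u n := fun n => integral_nonneg fun x => Real.rpow_nonneg (hW0 n x) _
  have hkR : (0 : ℝ) < k := by exact_mod_cast hk
  -- The same absorption as for martingale transforms, now with the first order expansion
  -- `add_rpow_le_add_mul`. The linear term does not vanish here, which is why the bound grows like
  -- (k * A)^q rather than with exponent q / 2.
  set ε : ℝ := (2 * C₀ * A * k)⁻¹ with hε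
  have hε0 : 0 < ε := by positivity
  set ε' : ℝ := ε ^ (-(q - 1)) with hε'
  have hε'0 : 0 < ε' := by positivity
  have step : ∀ n, u (n + 1) ≤ u n + C₀ * (A * (ε * u n + ε') + B) := by
    intro n
    have b1 : BddMeas (fun x => W n x ^ q) := (hWb n).rpow (hW0 n) (by linarith)
    have b2 : BddMeas (fun x => W n x ^ (q - 1)) := (hWb n).rpow (hW0 n) (by linarith)
    have b3 : BddMeas (fun x => w x ^ q) := hw.rpow hw0 (by linarith)
    have hpt : ∀ x, W (n + 1) x ^ q ≤ W n (G x) ^ q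
        + (C₀ * (w x * W n (G x) ^ (q - 1)) + C₀ * w x ^ q) := by
      intro x
      have h := add_rpow_le_add_mul hq (hW0 n (G x)) (hw0 x)
      have e : W (n + 1) x = W n (G x) + w x := by
        simp only [hW, birkhoffSum_succ']; ring
      rw [e]
      refine h.trans (le_of_eq ?_)
      ring
    have i1 := b1.comp hGm
    have i2 := (hw.mul (b2.comp hGm)).const_mul C₀
    have i3 := b3.const_mul C₀
    have hint := integral_mono (((hWb (n + 1)).rpow (hW0 (n + 1)) (r := q) (by linarith)).integrable lam)
      ((i1.add (i2.add i3)).integrable lam) hpt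
    rw [integral_add (i1.integrable lam) ((i2.add i3).integrable lam),
      integral_add (i2.integrable lam) (i3.integrable lam),
      integral_const_mul, integral_const_mul, integral_comp_of_measurePreserving hG b1.1] at hint
    have hAA := hA _ b2 (fun x => Real.rpow_nonneg (hW0 n x) _)
    have h3 : ∫ x, W n x ^ (q - 1) ∂lam ≤ ε * u n + ε' := by
      have hpt3 : ∀ x, W n x ^ (q - 1) ≤ ε * W n x ^ q + ε' := by
        intro x
        have := rpow_sub_mul_rpow_le (r := q) (s := 1) (b := 1) (by norm_num) hq hε0 (hW0 n x)
          zero_le_one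
        simpa only [Real.rpow_one, mul_one, Real.one_rpow, div_one] using this
      have i5 := b1.const_mul ε
      have := integral_mono (b2.integrable lam) ((i5.add (BddMeas.const ε')).integrable lam) hpt3
      rw [integral_add (i5.integrable lam) ((BddMeas.const ε').integrable lam), integral_const_mul,
        integral_const] at this
      simpa using this
    have h5 := mul_le_mul_of_nonneg_left h3 hA0.le
    have h6 : C₀ * ∫ x, w x * W n (G x) ^ (q - 1) ∂lam ≤ C₀ * (A * (ε * u n + ε')) := by
      gcongr; linarith
    have h7 : C₀ * ∫ x, w x ^ q ∂lam ≤ C₀ * B := by gcongr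
    linarith
  obtain ⟨N, hN, hNmax⟩ := Finset.exists_max_image (Finset.range (k + 1)) u ⟨0, by simp⟩
  have hZ : ∀ n ≤ k, u n ≤ u N := fun n hn => hNmax n (by simp; omega)
  have hsum : ∀ n ≤ k, u n ≤ n * (C₀ * (A * (ε * u N + ε') + B)) := by
    intro n
    induction n with
    | zero =>
      intro _
      have h0 : ∀ x, W 0 x ^ q = 0 := fun x => by
        simp only [hW, birkhoffSum_zero]
        exact Real.zero_rpow (by linarith)
      simp [hu, h0]
    | succ n ih =>
      intro hn
      have h1 := ih (by omega)
      have h2 := step n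
      have h3 : C₀ * (A * (ε * u n + ε') + B) ≤ C₀ * (A * (ε * u N + ε') + B) := by
        have := hZ n (by omega)
        gcongr
      push_cast
      linarith
  have hNk : N ≤ k := by have := Finset.mem_range.1 hN; omega
  have h1 := hsum N hNk
  have h2 : (N : ℝ) * (C₀ * (A * (ε * u N + ε') + B)) ≤ k * (C₀ * (A * (ε * u N + ε') + B)) := by
    have := hu0 N
    gcongr
  have e1 : (k : ℝ) * (C₀ * (A * (ε * u N + ε') + B)) = u N / 2 + C₀ * (k * A * ε' + k * B) := by
    rw [hε]; field_simp; ring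
  have e2 : k * A * ε' = (2 * C₀) ^ (q - 1) * (k * A) ^ q := by
    rw [hε', hε, Real.rpow_neg (by positivity), Real.inv_rpow (by positivity), inv_inv,
      show 2 * C₀ * A * k = (2 * C₀) * (k * A) by ring, Real.mul_rpow (by positivity) (by positivity)]
    have : (k * A) ^ q = (k * A) ^ (q - 1) * (k * A) := by
      rw [← Real.rpow_add_one (by positivity)]; congr 1; ring
    rw [this]; ring
  have h3 : u N ≤ 2 * C₀ * (k * A * ε' + k * B) := by linarith
  refine (hZ n hn).trans (h3.trans ?_)
  rw [e2, mul_assoc (2 * C₀)]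
  have hP : 0 ≤ (k * A) ^ q := by positivity
  have hQ : 0 ≤ (2 * C₀) ^ (q - 1) := by positivity
  have hR : 0 ≤ k * B := by positivity
  gcongr
  nlinarith [mul_nonneg hQ hR]

/-- A measure preserving map together with a return time whose conditional `p`-th moments are
bounded, and a time horizon `k`. -/
structure ReturnSystem (p K : ℝ) (lam : Measure X) (G : X → X) (τ : X → ℕ) (k : ℕ) : Prop where
  measurePreserving : MeasurePreserving G lam lam
  measurable_time : Measurable τ
  one_le_time : ∀ x, 1 ≤ τ x
  kac : ∀ w : X → ℝ≥0∞, Measurable w →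
    ∫⁻ x, ENNReal.ofReal ((τ x : ℝ) ^ p) * w (G x) ∂lam ≤ ENNReal.ofReal K * ∫⁻ x, w x ∂lam
  horizon_pos : 0 < k

/-- `V + χ - χ ∘ G` is a reverse martingale difference, with `χ` bounded and `V` bounded by the
truncated return time. -/
structure MartingaleCoboundary (C : ℝ) (lam : Measure X) (G : X → X) (τ : X → ℕ) (k : ℕ)
    (V χ : X → ℝ) : Prop where
  bddMeas : BddMeas V
  bddMeas_coboundary : BddMeas χ
  abs_le : ∀ x, |V x| ≤ C * min (τ x : ℝ) k
  abs_coboundary_le : ∀ x, |χ x| ≤ C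
  orthogonal : ∀ w : X → ℝ, BddMeas w → ∫ x, (V x + χ x - χ (G x)) * w (G x) ∂lam = 0

/-! ### Conditional moments of the truncated return time -/

namespace ReturnSystem

variable {p K : ℝ} {lam : Measure X} {G : X → X} {τ : X → ℕ} {k : ℕ}

/-- The field `kac` for real integrals: a function below c τ^p has conditional expectation given G
at most c K. -/
theorem integral_mul_comp_le [IsProbabilityMeasure lam] (h : ReturnSystem p K lam G τ k) (hK : 0 ≤ K) {f : X → ℝ} (hf : BddMeas f)
    {c : ℝ} (hc : 0 ≤ c) (hf0 : ∀ x, 0 ≤ f x) (hfc : ∀ x, f x ≤ c * (τ x : ℝ) ^ p) {w : X → ℝ}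
    (hw : BddMeas w) (hw0 : ∀ x, 0 ≤ w x) :
    ∫ x, f x * w (G x) ∂lam ≤ c * K * ∫ x, w x ∂lam := by
  have hGm := h.measurePreserving.measurable
  have hfw := hf.mul (hw.comp hGm)
  have hw1 : 0 ≤ ∫ x, w x ∂lam := integral_nonneg hw0
  rw [← ENNReal.ofReal_le_ofReal_iff (by positivity),
    ofReal_integral_eq_lintegral_ofReal (hfw.integrable lam)
      (ae_of_all _ fun x => mul_nonneg (hf0 x) (hw0 _)),
    ENNReal.ofReal_mul (by positivity), ENNReal.ofReal_mul hc,
    ofReal_integral_eq_lintegral_ofReal (hw.integrable lam) (ae_of_all _ hw0)]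
  have h1 := h.kac (fun x => ENNReal.ofReal (w x)) hw.1.ennreal_ofReal
  have hτ : Measurable fun x => ENNReal.ofReal ((τ x : ℝ) ^ p) :=
    ((measurable_from_top.comp h.measurable_time).pow_const p).ennreal_ofReal
  calc ∫⁻ x, ENNReal.ofReal (f x * w (G x)) ∂lam
      ≤ ∫⁻ x, ENNReal.ofReal c * (ENNReal.ofReal ((τ x : ℝ) ^ p) * ENNReal.ofReal (w (G x))) ∂lam := by
        refine lintegral_mono fun x => ?_
        rw [ENNReal.ofReal_mul (hf0 x), ← mul_assoc, ← ENNReal.ofReal_mul hc]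
        gcongr
        exact hfc x
    _ = ENNReal.ofReal c * ∫⁻ x, ENNReal.ofReal ((τ x : ℝ) ^ p) * ENNReal.ofReal (w (G x)) ∂lam :=
        lintegral_const_mul _ (hτ.mul (hw.comp hGm).1.ennreal_ofReal)
    _ ≤ _ := by rw [mul_assoc]; gcongr

theorem one_le_min (h : ReturnSystem p K lam G τ k) (x : X) : (1 : ℝ) ≤ min (τ x : ℝ) k :=
  le_min (by exact_mod_cast h.one_le_time x) (by exact_mod_cast h.horizon_pos)

theorem bddMeas_min (h : ReturnSystem p K lam G τ k) : BddMeas (fun x => min (τ x : ℝ) k) := by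
  refine ⟨(measurable_from_top.comp h.measurable_time).min measurable_const, k, fun x => ?_⟩
  rw [abs_of_nonneg (by positivity)]
  exact min_le_right _ _

theorem min_rpow_le (h : ReturnSystem p K lam G τ k) (hp : 0 ≤ p) {s : ℝ} (hsp : s ≤ p) (x : X) :
    (min (τ x : ℝ) k) ^ s ≤ (τ x : ℝ) ^ p := by
  have h1 := h.one_le_min x
  calc (min (τ x : ℝ) k) ^ s ≤ (min (τ x : ℝ) k) ^ p := Real.rpow_le_rpow_of_exponent_le h1 hsp
    _ ≤ _ := Real.rpow_le_rpow (by positivity) (min_le_left _ _) hp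

/-- This is where the exponent 2(p - 1) = (p - 2) + p comes from: p powers are controlled by the
moment of τ, and the p - 2 surplus powers are paid for by the truncation at k. Multiplied by k terms
the cost is k^(p-1), the order of the diffusive contribution. -/
theorem min_rpow_two_mul_le (h : ReturnSystem p K lam G τ k) (hp : 2 < p) (x : X) :
    (min (τ x : ℝ) k) ^ (2 * (p - 1)) ≤ (k : ℝ) ^ (p - 2) * (τ x : ℝ) ^ p := by
  have h1 := h.one_le_min x
  have : (min (τ x : ℝ) k) ^ (2 * (p - 1)) = (min (τ x : ℝ) k) ^ (p - 2) * (min (τ x : ℝ) k) ^ p := by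
    rw [← Real.rpow_add (by positivity)]; congr 1; ring
  rw [this]
  have h2 : (min (τ x : ℝ) k) ^ (p - 2) ≤ (k : ℝ) ^ (p - 2) :=
    Real.rpow_le_rpow (by positivity) (min_le_right _ _) (by linarith)
  exact mul_le_mul h2 (h.min_rpow_le (by linarith) le_rfl x) (by positivity) (by positivity)

/-- Moments of the sums of squared truncated return times. -/
theorem exists_integral_sq_sum_le (hp : 2 < p) (hK : 1 ≤ K) : ∃ C₁ : ℝ, 0 ≤ C₁ ∧
    ∀ (lam : Measure X) [IsProbabilityMeasure lam] (G : X → X) (τ : X → ℕ) (k : ℕ),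
      ReturnSystem p K lam G τ k →
      ∫ x, birkhoffSum G (fun y => (min (τ y : ℝ) k) ^ 2) (k + 1) x ^ (p - 1) ∂lam
        ≤ C₁ * (k : ℝ) ^ (p - 1) := by
  refine ⟨2 * 2 ^ (p - 1) * (1 + (2 * 2 ^ (p - 1)) ^ (p - 1 - 1)) * ((2 * K) ^ (p - 1) + 2 * K),
    by positivity, fun lam _ G τ k h => ?_⟩
  have hk := h.horizon_pos
  have hkR : (0 : ℝ) < k := by exact_mod_cast hk
  have hw : BddMeas (fun x => (min (τ x : ℝ) k) ^ 2) := h.bddMeas_min.pow 2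
  have e2 : ∀ x, ((min (τ x : ℝ) k) ^ 2) ^ (p - 1) = (min (τ x : ℝ) k) ^ (2 * (p - 1)) := fun x => by
    rw [← Real.rpow_two, ← Real.rpow_mul (by positivity)]
  have hA := fun (u : X → ℝ) (hu : BddMeas u) hu0 =>
    h.integral_mul_comp_le (by linarith) hw zero_le_one (fun x => by positivity)
      (fun x => by rw [one_mul, ← Real.rpow_two]; exact h.min_rpow_le (by linarith) hp.le x) hu hu0
  have hB := h.integral_mul_comp_le (by linarith) (hw.rpow (r := p - 1) (fun x => by positivity) (by linarith))
    (c := (k : ℝ) ^ (p - 2)) (by positivity) (fun x => by positivity)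
    (fun x => by rw [e2]; exact h.min_rpow_two_mul_le hp x) (BddMeas.const 1) (fun _ => zero_le_one)
  simp only [mul_one, integral_const, probReal_univ, smul_eq_mul] at hB
  -- The horizon 2 * k accommodates the k + 1 summands, since k ≥ 1.
  have := integral_birkhoffSum_rpow_le (q := p - 1) (by linarith) h.measurePreserving hw
    (fun x => by positivity) (by linarith : 0 < 1 * K) hA (by positivity) hB
    (k := 2 * k) (by omega) (n := k + 1) (by omega)
  refine this.trans (le_of_eq ?_)
  push_cast
  rw [one_mul, show 2 * (k : ℝ) * K = (2 * K) * k by ring, Real.mul_rpow (by positivity) hkR.le,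
    show 2 * (k : ℝ) * (k ^ (p - 2) * K) = 2 * K * (k ^ (p - 2) * k) by ring,
    ← Real.rpow_add_one hkR.ne', show p - 2 + 1 = p - 1 by ring]
  ring

end ReturnSystem

/-! ### Maximal inequalities for martingale-coboundary observables -/

namespace MartingaleCoboundary

variable {p K C : ℝ} {lam : Measure X} {G : X → X} {τ : X → ℕ} {k : ℕ}
  {V χ : X → ℝ}

theorem bddMeas_martingale (hd : MartingaleCoboundary C lam G τ k V χ) (hG : Measurable G) :
    BddMeas (fun x => V x + χ x - χ (G x)) :=
  (hd.bddMeas.add hd.bddMeas_coboundary).sub (hd.bddMeas_coboundary.comp hG)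

theorem abs_martingale_le (h : ReturnSystem p K lam G τ k) (hC : 0 ≤ C)
    (hd : MartingaleCoboundary C lam G τ k V χ) (x : X) :
    |V x + χ x - χ (G x)| ≤ 3 * C * min (τ x : ℝ) k := by
  have h1 := hd.abs_le x
  have h2 := hd.abs_coboundary_le x
  have h3 := hd.abs_coboundary_le (G x)
  have h4 := h.one_le_min x
  have h5 : |V x + χ x - χ (G x)| ≤ |V x| + |χ x| + |χ (G x)| :=
    (abs_sub _ _).trans (add_le_add (abs_add_le _ _) le_rfl)
  nlinarith

theorem integral_martingale_rpow_mul_le [IsProbabilityMeasure lam] (h : ReturnSystem p K lam G τ k) (hK : 0 ≤ K) (hC : 0 ≤ C)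
    (hd : MartingaleCoboundary C lam G τ k V χ) {s c : ℝ} (hs : 0 ≤ s) (hc : 0 ≤ c)
    (hsc : ∀ x, (min (τ x : ℝ) k) ^ s ≤ c * (τ x : ℝ) ^ p)
    {w : X → ℝ} (hw : BddMeas w) (hw0 : ∀ x, 0 ≤ w x) :
    ∫ x, |V x + χ x - χ (G x)| ^ s * w (G x) ∂lam ≤ (3 * C) ^ s * c * K * ∫ x, w x ∂lam := by
  refine h.integral_mul_comp_le hK
    ((hd.bddMeas_martingale h.measurePreserving.measurable).abs_rpow hs) (by positivity)
    (fun x => by positivity) (fun x => ?_) hw hw0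
  calc |V x + χ x - χ (G x)| ^ s ≤ (3 * C * min (τ x : ℝ) k) ^ s :=
        Real.rpow_le_rpow (abs_nonneg _) (abs_martingale_le h hC hd x) hs
    _ = (3 * C) ^ s * (min (τ x : ℝ) k) ^ s := Real.mul_rpow (by positivity) (by positivity)
    _ ≤ (3 * C) ^ s * (c * (τ x : ℝ) ^ p) := by gcongr; exact hsc x
    _ = _ := by ring

theorem integral_martingale_sq_mul_le [IsProbabilityMeasure lam] (h : ReturnSystem p K lam G τ k) (hp : 2 < p) (hK : 0 ≤ K)
    (hC : 0 ≤ C) (hd : MartingaleCoboundary C lam G τ k V χ)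
    {w : X → ℝ} (hw : BddMeas w) (hw0 : ∀ x, 0 ≤ w x) :
    ∫ x, (V x + χ x - χ (G x)) ^ 2 * w (G x) ∂lam ≤ (3 * C) ^ 2 * K * ∫ x, w x ∂lam := by
  have := integral_martingale_rpow_mul_le h hK hC hd (s := 2) (c := 1) (by norm_num) zero_le_one
    (fun x => by rw [one_mul]; exact h.min_rpow_le (by linarith) hp.le x) hw hw0
  simpa [sq_abs] using this

/-- A maximal inequality for Birkhoff sums of `V`. -/
theorem exists_birkhoffSum_majorant (hp : 2 < p) (hK : 1 ≤ K) (hC : 1 ≤ C) : ∃ C₁ : ℝ, 0 ≤ C₁ ∧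
    ∀ (lam : Measure X) [IsProbabilityMeasure lam] (G : X → X) (τ : X → ℕ) (k : ℕ) (V χ : X → ℝ),
      ReturnSystem p K lam G τ k → MartingaleCoboundary C lam G τ k V χ →
      ∃ Φ : X → ℝ, BddMeas Φ ∧ (∀ x, 0 ≤ Φ x) ∧
        ∫ x, Φ x ^ (2 * (p - 1)) ∂lam ≤ C₁ * (k : ℝ) ^ (p - 1) ∧
        ∀ N ≤ k, ∀ x, |birkhoffSum G V N x| ≤ Φ x := by
  set r : ℝ := 2 * (p - 1) with hr
  have hr2 : 2 ≤ r := by linarith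
  set C₀ : ℝ := r * 2 ^ r + r ^ 2 + 2 ^ r + r with hC₀
  set D₁ : ℝ := 2 * C₀ * (1 + (2 * C₀) ^ ((r - 2) / 2)) with hD₁
  set D₂ : ℝ := 2 * (r / (r - 1)) * (2 * (r / (r - 1))) ^ (r - 1) with hD₂
  have hrr : 0 ≤ r / (r - 1) := div_nonneg (by linarith) (by linarith)
  have hC₀0 : 0 ≤ C₀ := by positivity
  have hD₁0 : 0 ≤ D₁ := by positivity
  have hD₂0 : 0 ≤ D₂ := by positivity
  set E : ℝ := D₂ * (D₁ * (((3 * C) ^ 2 * K) ^ (p - 1) + (3 * C) ^ r * K)) with hE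
  have hE0 : 0 ≤ E := by positivity
  refine ⟨2 ^ r * (2 ^ r * E + (4 * C) ^ r), by positivity, fun lam _ G τ k V χ h hd => ?_⟩
  have hk := h.horizon_pos
  have hkR : (1 : ℝ) ≤ k := by exact_mod_cast hk
  have hk0 : (0 : ℝ) < k := by linarith
  have hGm := h.measurePreserving.measurable
  set m := fun x => V x + χ x - χ (G x) with hm
  have hmb : BddMeas m := hd.bddMeas_martingale hGm
  have hs : ∀ n : ℕ, BddMeas (fun _ : X => (1 : ℝ)) := fun _ => BddMeas.const 1
  set M := revMax G (revSum G m fun _ _ => 1) k with hM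
  have hMb : BddMeas M := BddMeas.revMax hGm (fun n => BddMeas.revSum hGm hmb hs n) k
  have hM0 : ∀ x, 0 ≤ M x := revMax_nonneg G _ k
  have hmom := integral_abs_revSum_rpow_le hr2 h.measurePreserving hmb hd.orthogonal
    (A := (3 * C) ^ 2 * K) (B := (3 * C) ^ r * (k : ℝ) ^ (p - 2) * K) (S := 1)
    (by positivity) hC₀
    (fun w hw hw0 => integral_martingale_sq_mul_le h hp (by linarith) (by linarith) hd hw hw0)
    (by positivity)
    (fun w hw hw0 => integral_martingale_rpow_mul_le h (by linarith) (by linarith) hd (by linarith)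
      (by positivity) (h.min_rpow_two_mul_le hp) hw hw0)
    hs hk zero_le_one (fun n _ => by simp) le_rfl
  have hdoob := integral_revMax_rpow_le hr2 h.measurePreserving hmb hd.orthogonal hs k
  -- Both contributions have the same order: r / 2 = p - 1 for the variances, and k * k^(p-2) for
  -- the large jumps.
  have hME : ∫ x, M x ^ r ∂lam ≤ E * (k : ℝ) ^ (p - 1) := by
    refine (hdoob.trans (mul_le_mul_of_nonneg_left hmom hD₂0)).trans (le_of_eq ?_)
    rw [← hD₁, ← hD₂, hE, show r / 2 = p - 1 by rw [hr]; ring, Real.mul_rpow hk0.le (by positivity),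
      show (k : ℝ) * ((3 * C) ^ r * k ^ (p - 2) * K) = (3 * C) ^ r * K * (k ^ (p - 2) * k) by ring,
      ← Real.rpow_add_one hk0.ne', show p - 2 + 1 = p - 1 by ring]
    ring
  have hΦb : BddMeas (fun x => 2 * M x + 4 * C) := (hMb.const_mul 2).add (BddMeas.const _)
  have hΦ0 : ∀ x, 0 ≤ 2 * M x + 4 * C := fun x => by have := hM0 x; positivity
  refine ⟨fun x => 2 * M x + 4 * C, hΦb, hΦ0, ?_, fun N hN x => ?_⟩
  · have hpt : ∀ x, (2 * M x + 4 * C) ^ r ≤ 2 ^ r * 2 ^ r * M x ^ r + 2 ^ r * (4 * C) ^ r := fun x => by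
      have := add_rpow_le_two_rpow_mul (s := r) (a := 2 * M x) (b := 4 * C) (by linarith)
        (by have := hM0 x; positivity) (by positivity)
      rw [Real.mul_rpow (by norm_num) (hM0 x)] at this
      linarith
    have b1 : BddMeas (fun x => 2 ^ r * 2 ^ r * M x ^ r) := (hMb.rpow hM0 (by linarith)).const_mul _
    have hi := integral_mono ((hΦb.rpow hΦ0 (by linarith : 0 ≤ r)).integrable lam)
      ((b1.add (BddMeas.const _)).integrable lam) hpt
    rw [integral_add (b1.integrable lam) ((BddMeas.const _).integrable lam), integral_const_mul,
      integral_const] at hi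
    simp only [probReal_univ, smul_eq_mul, one_mul] at hi
    refine hi.trans ?_
    have hk1 : (1 : ℝ) ≤ (k : ℝ) ^ (p - 1) := Real.one_le_rpow hkR (by linarith)
    have h1 := mul_le_mul_of_nonneg_left hME (by positivity : (0 : ℝ) ≤ 2 ^ r * 2 ^ r)
    have h2 := mul_le_mul_of_nonneg_left hk1 (by positivity : (0 : ℝ) ≤ 2 ^ r * (4 * C) ^ r)
    linarith
  -- These sums all end at time k, so M controls them up to two values of χ. A sum from time 0 is a
  -- difference of two of them, hence the majorant 2 * M + 4 * C.
  · have hb : ∀ n ≤ k, |birkhoffSum G V (k - n) (G^[n] x)| ≤ M x + 2 * C := by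
      intro n hn
      rw [birkhoffSum_eq_revSum G V χ]
      have h1 := abs_iterate_le_revMax G (revSum G m fun _ _ => 1) (k - n) n x
      rw [show k - n + n = k by omega] at h1
      have h2 := hd.abs_coboundary_le (G^[k - n] (G^[n] x))
      have h3 := hd.abs_coboundary_le (G^[n] x)
      refine (abs_sub _ _).trans ((add_le_add (abs_add_le _ _) le_rfl).trans ?_)
      have h1' : |revSum G (fun x => V x + χ x - χ (G x)) (fun _ _ => 1) (k - n) (G^[n] x)| ≤ M x := h1
      linarith
    have e : birkhoffSum G V N x = birkhoffSum G V k x - birkhoffSum G V (k - N) (G^[N] x) := by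
      have := birkhoffSum_add G V N (k - N) x
      rw [show N + (k - N) = k by omega] at this
      rw [this]; ring
    rw [e]
    have h0 := hb 0 (by omega)
    simp only [Nat.sub_zero, Function.iterate_zero, id] at h0
    have h1 := hb N hN
    refine (abs_sub _ _).trans ?_
    linarith

set_option maxHeartbeats 1000000 in
/-- A maximal inequality for iterated sums. -/
theorem exists_iterSum_majorant (hp : 2 < p) (hK : 1 ≤ K) (hC : 1 ≤ C) : ∃ C₁ : ℝ, 0 ≤ C₁ ∧
    ∀ (lam : Measure X) [IsProbabilityMeasure lam] (G : X → X) (τ : X → ℕ) (k : ℕ)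
      (V χ V' χ' : X → ℝ), ReturnSystem p K lam G τ k →
      MartingaleCoboundary C lam G τ k V χ → MartingaleCoboundary C lam G τ k V' χ' →
      ∃ H : X → ℝ, BddMeas H ∧ (∀ x, 0 ≤ H x) ∧
        ∫ x, H x ^ (p - 1) ∂lam ≤ C₁ * (k : ℝ) ^ (p - 1) ∧
        (∀ N ≤ k, ∀ x, birkhoffSum G V N x ^ 2 ≤ H x ∧ birkhoffSum G V' N x ^ 2 ≤ H x ∧
          |iterSum G V V' N x| ≤ H x) ∧
        ∀ x, birkhoffSum G (fun y => (min (τ y : ℝ) k) ^ 2) (k + 1) x ≤ H x := by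
  obtain ⟨CΦ, hCΦ0, hCΦ⟩ := exists_birkhoffSum_majorant (X := X) hp hK hC
  obtain ⟨CQ, hCQ0, hCQ⟩ := ReturnSystem.exists_integral_sq_sum_le (X := X) hp hK
  set q : ℝ := p - 1 with hq
  -- The Taylor inequality needs an exponent at least 2, whereas p - 1 may lie between 1 and 2. This
  -- r is at most p, so conditional moments need no help from the truncation, and at most 2 * q, so
  -- the inner Birkhoff sums have moments of order r.
  set r : ℝ := max q 2 with hr
  have hr2 : 2 ≤ r := le_max_right _ _
  have hrp : r ≤ p := max_le (by linarith) hp.le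
  have hrq : r ≤ 2 * q := max_le (by linarith) (by linarith)
  set C₀ : ℝ := r * 2 ^ r + r ^ 2 + 2 ^ r + r with hC₀
  set D₁ : ℝ := 2 * C₀ * (1 + (2 * C₀) ^ ((r - 2) / 2)) with hD₁
  set D₂ : ℝ := 2 * (r / (r - 1)) * (2 * (r / (r - 1))) ^ (r - 1) with hD₂
  have hrr : 0 ≤ r / (r - 1) := div_nonneg (by linarith) (by linarith)
  have hC₀0 : 0 ≤ C₀ := by positivity
  have hD₁0 : 0 ≤ D₁ := by positivity
  have hD₂0 : 0 ≤ D₂ := by positivity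
  set E : ℝ := D₂ * (D₁ * (((3 * C) ^ 2 * K) ^ (r / 2) + (3 * C) ^ r * K) * (1 + CΦ)) with hE
  have hE0 : 0 ≤ E := by positivity
  set B : ℝ := 4 * C ^ 2 with hB
  refine ⟨2 ^ q * (2 ^ q * (2 ^ q * (CΦ + CΦ) + 2 ^ q * (1 + E)) + B ^ q * CQ), by positivity,
    fun lam _ G τ k V χ V' χ' h hd hd' => ?_⟩
  have hk := h.horizon_pos
  have hkR : (1 : ℝ) ≤ k := by exact_mod_cast hk
  have hk0 : (0 : ℝ) < k := by linarith
  have hGm := h.measurePreserving.measurable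
  obtain ⟨Φ, hΦb, hΦ0, hΦi, hΦ⟩ := hCΦ lam G τ k V χ h hd
  obtain ⟨Φ', hΦb', hΦ0', hΦi', hΦ'⟩ := hCΦ lam G τ k V' χ' h hd'
  have hQi := hCQ lam G τ k h
  set t : X → ℝ := fun y => (min (τ y : ℝ) k) ^ 2 with ht
  have ht0 : ∀ y, 0 ≤ t y := fun y => by positivity
  have htb : BddMeas t := h.bddMeas_min.pow 2
  set Q := birkhoffSum G t (k + 1) with hQ
  have hQb : BddMeas Q := BddMeas.birkhoffSum hGm htb _
  have hQ0 : ∀ x, 0 ≤ Q x := fun x => Finset.sum_nonneg fun i _ => ht0 _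
  set m := fun x => V x + χ x - χ (G x) with hm
  have hmb : BddMeas m := hd.bddMeas_martingale hGm
  have hs : ∀ n : ℕ, BddMeas (birkhoffSum G V' n) := fun n => BddMeas.birkhoffSum hGm hd'.bddMeas n
  -- The weights of the transform are the Birkhoff sums of V', of size k^(1/2); their r-th moments
  -- come from the majorant Φ'.
  set S : ℝ := (1 + CΦ) * (k : ℝ) ^ (r / 2) with hS
  have hSn : ∀ n < k, ∫ x, |birkhoffSum G V' n x| ^ r ∂lam ≤ S := by
    intro n hn
    have h1 : ∫ x, Φ' x ^ r ∂lam ≤ (1 + CΦ) * ((k : ℝ) ^ (1 / 2 : ℝ)) ^ r := by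
      refine integral_rpow_le_of_rpow_le hΦb' hΦ0' (by linarith) hrq (by positivity) ?_
      rw [← Real.rpow_mul hk0.le, show 1 / 2 * (2 * q) = q by ring]
      exact hΦi'
    rw [← Real.rpow_mul hk0.le, show 1 / 2 * r = r / 2 by ring] at h1
    refine (integral_mono (((hs n).abs_rpow (by linarith)).integrable lam)
      ((hΦb'.rpow hΦ0' (by linarith)).integrable lam) fun x => ?_).trans h1
    exact Real.rpow_le_rpow (abs_nonneg _) (hΦ' n hn.le x) (by linarith)
  set M := revMax G (revSum G m (birkhoffSum G V')) k with hM
  have hMb : BddMeas M := BddMeas.revMax hGm (fun n => BddMeas.revSum hGm hmb hs n) k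
  have hM0 : ∀ x, 0 ≤ M x := revMax_nonneg G _ k
  have hmom := integral_abs_revSum_rpow_le hr2 h.measurePreserving hmb hd.orthogonal
    (A := (3 * C) ^ 2 * K) (B := (3 * C) ^ r * 1 * K) (S := S)
    (by positivity) hC₀
    (fun w hw hw0 => integral_martingale_sq_mul_le h hp (by linarith) (by linarith) hd hw hw0)
    (by positivity)
    (fun w hw hw0 => integral_martingale_rpow_mul_le h (by linarith) (by linarith) hd (by linarith)
      zero_le_one (fun x => by rw [one_mul]; exact h.min_rpow_le (by linarith) hrp x) hw hw0)
    hs hk (by positivity) hSn le_rfl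
  have hdoob := integral_revMax_rpow_le hr2 h.measurePreserving hmb hd.orthogonal hs k
  have hME : ∫ x, M x ^ r ∂lam ≤ E * (k : ℝ) ^ r := by
    refine (hdoob.trans (mul_le_mul_of_nonneg_left hmom hD₂0)).trans ?_
    rw [← hD₁, ← hD₂]
    have e1 : (k : ℝ) ≤ (k : ℝ) ^ (r / 2) := by
      conv_lhs => rw [← Real.rpow_one (k : ℝ)]
      exact Real.rpow_le_rpow_of_exponent_le hkR (by linarith)
    have e2 : (k * ((3 * C) ^ 2 * K)) ^ (r / 2) + k * ((3 * C) ^ r * 1 * K)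
        ≤ (((3 * C) ^ 2 * K) ^ (r / 2) + (3 * C) ^ r * K) * (k : ℝ) ^ (r / 2) := by
      rw [Real.mul_rpow hk0.le (by positivity)]
      have : 0 ≤ (3 * C) ^ r * K := by positivity
      nlinarith only [this, e1]
    have e3 : (k : ℝ) ^ r = (k : ℝ) ^ (r / 2) * (k : ℝ) ^ (r / 2) := by
      rw [← Real.rpow_add hk0]; congr 1; ring
    calc _ ≤ D₂ * (D₁ * ((((3 * C) ^ 2 * K) ^ (r / 2) + (3 * C) ^ r * K) * (k : ℝ) ^ (r / 2)) * S) := by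
          gcongr
      _ = _ := by rw [hE, e3, hS]; ring
  -- Descent from the exponent r to q at the scale k.
  have hMq : ∫ x, M x ^ q ∂lam ≤ (1 + E) * (k : ℝ) ^ q :=
    integral_rpow_le_of_rpow_le hMb hM0 (by linarith) (le_max_left _ _) hk0 hME
  have hCC : 1 ≤ C ^ 2 := one_le_pow₀ hC
  have hB0 : 0 ≤ B := by positivity
  set H : X → ℝ := fun x => ((Φ x ^ 2 + Φ' x ^ 2) + 2 * M x) + B * Q x with hH
  have hHb : BddMeas H :=
    (((hΦb.pow 2).add (hΦb'.pow 2)).add (hMb.const_mul 2)).add (hQb.const_mul B)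
  have hH0 : ∀ x, 0 ≤ H x := fun x => by
    have := hM0 x; have := hQ0 x; positivity
  -- Q has one summand beyond k. It is not needed here, but it will account for an unfinished last
  -- excursion.
  have hsum_mono : ∀ n ≤ k, ∀ x, birkhoffSum G t (k - n) (G^[n] x) ≤ Q x := by
    intro n hn x
    have e := birkhoffSum_add G t n (k + 1 - n) x
    rw [show n + (k + 1 - n) = k + 1 by omega, show k + 1 - n = (k - n) + 1 by omega,
      birkhoffSum_succ G t (k - n)] at e
    have h1 : 0 ≤ birkhoffSum G t n x := Finset.sum_nonneg fun i _ => ht0 _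
    have h2 := ht0 (G^[k - n] (G^[n] x))
    have e' : Q x = birkhoffSum G t (k + 1) x := rfl
    linarith
  have hV't : ∀ n x, |birkhoffSum G V' n x| ≤ C * birkhoffSum G t n x := by
    intro n x
    rw [birkhoffSum, birkhoffSum, Finset.mul_sum]
    refine (Finset.abs_sum_le_sum_abs _ _).trans (Finset.sum_le_sum fun i _ => ?_)
    have h1 := hd'.abs_le (G^[i] x)
    have h2 := h.one_le_min (G^[i] x)
    have h3 : C * min (τ (G^[i] x) : ℝ) k ≤ C * t (G^[i] x) := by
      refine mul_le_mul_of_nonneg_left ?_ (by linarith)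
      simp only [ht]; nlinarith only [h2]
    linarith only [h1, h3]
  have hχV't : ∀ n x, |birkhoffSum G (fun y => χ y * V' y) n x| ≤ C ^ 2 * birkhoffSum G t n x := by
    intro n x
    rw [birkhoffSum, birkhoffSum, Finset.mul_sum]
    refine (Finset.abs_sum_le_sum_abs _ _).trans (Finset.sum_le_sum fun i _ => ?_)
    have h1 := hd'.abs_le (G^[i] x)
    have h2 := h.one_le_min (G^[i] x)
    have h4 := hd.abs_coboundary_le (G^[i] x)
    have h3 : min (τ (G^[i] x) : ℝ) k ≤ t (G^[i] x) := by
      simp only [ht]; nlinarith only [h2]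
    rw [abs_mul]
    calc |χ (G^[i] x)| * |V' (G^[i] x)| ≤ C * (C * t (G^[i] x)) := by
          refine mul_le_mul h4 (h1.trans ?_) (abs_nonneg _) (by linarith)
          exact mul_le_mul_of_nonneg_left h3 (by linarith)
      _ = _ := by ring
  -- M bounds the martingale transform. The boundary product and the diagonal sum are bounded
  -- without any cancellation, using min(τ, k) ≤ min(τ, k)^2; each contributes at most C ^ 2 * Q.
  have hiter : ∀ n ≤ k, ∀ x, |iterSum G V V' (k - n) (G^[n] x)| ≤ M x + 2 * C ^ 2 * Q x := by
    intro n hn x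
    rw [iterSum_eq_revSum G V χ]
    have h1 := abs_iterate_le_revMax G (revSum G m (birkhoffSum G V')) (k - n) n x
    rw [show k - n + n = k by omega] at h1
    have h2 := hd.abs_coboundary_le (G^[n] x)
    have h3 := hV't (k - n) (G^[n] x)
    have h4 := hχV't (k - n) (G^[n] x)
    have h5 := hsum_mono n hn x
    have h6 : |χ (G^[n] x) * birkhoffSum G V' (k - n) (G^[n] x)|
        ≤ C * (C * birkhoffSum G t (k - n) (G^[n] x)) := by
      rw [abs_mul]; exact mul_le_mul h2 h3 (abs_nonneg _) (by linarith)
    have h7 := mul_le_mul_of_nonneg_left h5 (by positivity : 0 ≤ C ^ 2)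
    refine (abs_add_le _ _).trans ((add_le_add (abs_sub _ _) le_rfl).trans ?_)
    have h1' : |revSum G (fun x => V x + χ x - χ (G x)) (birkhoffSum G V') (k - n) (G^[n] x)| ≤ M x := h1
    linarith only [h1', h4, h6, h7]
  refine ⟨H, hHb, hH0, ?_, fun N hN x => ⟨?_, ?_, ?_⟩, fun x => ?_⟩
  · have e2 : ∀ f : X → ℝ, (∀ x, 0 ≤ f x) → ∀ x, (f x ^ 2) ^ q = f x ^ (2 * q) := fun f hf x => by
      rw [← Real.rpow_two, ← Real.rpow_mul (hf x)]
    have hpt : ∀ x, H x ^ q ≤ 2 ^ q * (2 ^ q * (2 ^ q * (Φ x ^ (2 * q) + Φ' x ^ (2 * q))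
        + 2 ^ q * M x ^ q) + B ^ q * Q x ^ q) := by
      intro x
      have hM0x := hM0 x
      have hQ0x := hQ0 x
      have a1 := add_rpow_le_two_rpow_mul (s := q) (by linarith) (sq_nonneg (Φ x)) (sq_nonneg (Φ' x))
      have a2 := add_rpow_le_two_rpow_mul (s := q) (a := Φ x ^ 2 + Φ' x ^ 2) (b := 2 * M x) (by linarith)
        (by positivity) (by positivity)
      have a3 := add_rpow_le_two_rpow_mul (s := q) (a := (Φ x ^ 2 + Φ' x ^ 2) + 2 * M x) (b := B * Q x)
        (by linarith) (by positivity) (by positivity)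
      rw [e2 Φ hΦ0, e2 Φ' hΦ0'] at a1
      rw [Real.mul_rpow (by norm_num) hM0x] at a2
      rw [Real.mul_rpow hB0 hQ0x] at a3
      have h2 : (0 : ℝ) < 2 ^ q := by positivity
      refine a3.trans (mul_le_mul_of_nonneg_left (add_le_add (a2.trans ?_) le_rfl) h2.le)
      exact mul_le_mul_of_nonneg_left (add_le_add a1 le_rfl) h2.le
    have b1 : BddMeas fun x => Φ x ^ (2 * q) := hΦb.rpow hΦ0 (by linarith)
    have b2 : BddMeas fun x => Φ' x ^ (2 * q) := hΦb'.rpow hΦ0' (by linarith)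
    have b3 : BddMeas fun x => 2 ^ q * M x ^ q := (hMb.rpow hM0 (by linarith)).const_mul _
    have b4 : BddMeas fun x => B ^ q * Q x ^ q := (hQb.rpow hQ0 (by linarith)).const_mul _
    have b12 := (b1.add b2).const_mul (2 ^ q)
    have b123 := (b12.add b3).const_mul (2 ^ q)
    have hi := integral_mono ((hHb.rpow hH0 (by linarith : 0 ≤ q)).integrable lam)
      (((b123.add b4).const_mul (2 ^ q)).integrable lam) hpt
    rw [integral_const_mul, integral_add (b123.integrable lam) (b4.integrable lam), integral_const_mul,
      integral_add (b12.integrable lam) (b3.integrable lam), integral_const_mul, integral_const_mul,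
      integral_const_mul, integral_add (b1.integrable lam) (b2.integrable lam)] at hi
    refine hi.trans ?_
    have h2 : (0 : ℝ) ≤ 2 ^ q := by positivity
    have hBq : (0 : ℝ) ≤ B ^ q := by positivity
    calc _ ≤ 2 ^ q * (2 ^ q * (2 ^ q * (CΦ * (k : ℝ) ^ q + CΦ * (k : ℝ) ^ q)
          + 2 ^ q * ((1 + E) * (k : ℝ) ^ q)) + B ^ q * (CQ * (k : ℝ) ^ q)) := by gcongr
      _ = _ := by ring
  · have h1 := hΦ N hN x
    have h2 := hM0 x; have h3 := hQ0 x
    have : birkhoffSum G V N x ^ 2 ≤ Φ x ^ 2 := sq_le_sq' (neg_le_of_abs_le h1) (le_of_abs_le h1)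
    simp only [hH]; linarith only [this, h2, sq_nonneg (Φ' x), mul_nonneg hB0 h3]
  · have h1 := hΦ' N hN x
    have h2 := hM0 x; have h3 := hQ0 x
    have : birkhoffSum G V' N x ^ 2 ≤ Φ' x ^ 2 := sq_le_sq' (neg_le_of_abs_le h1) (le_of_abs_le h1)
    simp only [hH]; linarith only [this, h2, sq_nonneg (Φ x), mul_nonneg hB0 h3]
  -- Chen's relation recovers iterated sums from time 0 from two sums ending at time k. The cross
  -- term is at most 2 * Φ * Φ', hence at most Φ^2 + Φ'^2.
  · have e := iterSum_add G V V' N (k - N) x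
    rw [show N + (k - N) = k by omega] at e
    have e' : iterSum G V V' N x = iterSum G V V' k x - iterSum G V V' (k - N) (G^[N] x)
        - birkhoffSum G V N x * birkhoffSum G V' (k - N) (G^[N] x) := by rw [e]; ring
    have h0 := hiter 0 (by omega) x
    simp only [Nat.sub_zero, Function.iterate_zero, id] at h0
    have h1 := hiter N hN x
    have f1 := hΦ N hN x
    have f2 : |birkhoffSum G V' (k - N) (G^[N] x)| ≤ 2 * Φ' x := by
      have g := birkhoffSum_add G V' N (k - N) x
      rw [show N + (k - N) = k by omega] at g
      have g' : birkhoffSum G V' (k - N) (G^[N] x) = birkhoffSum G V' k x - birkhoffSum G V' N x := by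
        rw [g]; ring
      rw [g']
      have := hΦ' k le_rfl x
      have := hΦ' N hN x
      exact (abs_sub _ _).trans (by linarith)
    have f3 : |birkhoffSum G V N x * birkhoffSum G V' (k - N) (G^[N] x)| ≤ Φ x * (2 * Φ' x) := by
      rw [abs_mul]; exact mul_le_mul f1 f2 (abs_nonneg _) (hΦ0 x)
    rw [e']
    refine (abs_sub _ _).trans ((add_le_add (abs_sub _ _) le_rfl).trans ?_)
    simp only [hH, hB]
    nlinarith only [h0, h1, f3, sq_nonneg (Φ x - Φ' x)]
  · have h2 := hM0 x; have h3 := hQ0 x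
    have : Q x ≤ B * Q x := by simp only [hB]; nlinarith only [hCC, h3]
    show Q x ≤ H x
    simp only [hH]; linarith only [this, h2, sq_nonneg (Φ x), sq_nonneg (Φ' x)]

end MartingaleCoboundary

end Moments

/-! ### The left branch of the intermittent map and its inverse -/

/-- The left branch `x ↦ x (1 + |2x|^γ)`, extended to the real line. -/
noncomputable def leftBranch (γ x : ℝ) : ℝ := x * (1 + |2 * x| ^ γ)

/-- The inverse of the left branch. -/
noncomputable def leftInv (γ : ℝ) : ℝ → ℝ := Function.invFun (leftBranch γ)

section LeftBranch

variable {γ : ℝ}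

theorem leftBranch_of_nonneg {x : ℝ} (hx : 0 ≤ x) : leftBranch γ x = x * (1 + (2 * x) ^ γ) := by
  rw [leftBranch, abs_of_nonneg (by linarith)]

theorem leftBranch_neg (x : ℝ) : leftBranch γ (-x) = -leftBranch γ x := by
  simp [leftBranch]

theorem continuous_leftBranch (hγ : 0 < γ) : Continuous (leftBranch γ) := by
  unfold leftBranch
  refine continuous_id.mul (continuous_const.add ?_)
  exact (continuous_const.mul continuous_id).abs.rpow_const fun _ => Or.inr hγ.le

theorem sub_le_leftBranch_sub (hγ : 0 < γ) {x y : ℝ} (hx : 0 ≤ x) (hxy : x ≤ y) :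
    y - x ≤ leftBranch γ y - leftBranch γ x := by
  rw [leftBranch_of_nonneg hx, leftBranch_of_nonneg (hx.trans hxy)]
  have h1 : (2 * x) ^ γ ≤ (2 * y) ^ γ := Real.rpow_le_rpow (by linarith) (by linarith) hγ.le
  have h2 : 0 ≤ (2 * x) ^ γ := by positivity
  nlinarith [mul_le_mul hxy h1 h2 (hx.trans hxy)]

theorem leftBranch_strictMono (hγ : 0 < γ) : StrictMono (leftBranch γ) := by
  have hpos : ∀ x y, 0 ≤ x → x < y → leftBranch γ x < leftBranch γ y := fun x y hx hxy => by
    linarith [sub_le_leftBranch_sub hγ hx hxy.le]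
  have h0 : leftBranch γ 0 = 0 := by simp [leftBranch]
  intro x y hxy
  rcases le_or_gt 0 x with hx | hx
  · exact hpos x y hx hxy
  · have hx' : leftBranch γ x < 0 := by
      have := hpos 0 (-x) le_rfl (by linarith)
      rw [leftBranch_neg, h0] at this; linarith
    rcases le_or_gt 0 y with hy | hy
    · rcases hy.eq_or_lt with rfl | hy
      · rwa [h0]
      · have := hpos 0 y le_rfl hy
        rw [h0] at this; linarith
    · have := hpos (-y) (-x) (by linarith) (by linarith)
      rw [leftBranch_neg, leftBranch_neg] at this; linarith

theorem self_le_leftBranch {x : ℝ} (hx : 0 ≤ x) : x ≤ leftBranch γ x := by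
  rw [leftBranch_of_nonneg hx]
  have h2 : 0 ≤ (2 * x) ^ γ := by positivity
  nlinarith

theorem leftBranch_zero : leftBranch γ 0 = 0 := by simp [leftBranch]

theorem leftBranch_half : leftBranch γ (1 / 2) = 1 := by
  rw [leftBranch_of_nonneg (by norm_num)]; norm_num

/-- The odd extension to the real line is made for this: together with strict monotonicity,
`leftInv` becomes a two-sided inverse with no range conditions to carry along. -/
theorem leftBranch_surjective (hγ : 0 < γ) : Function.Surjective (leftBranch γ) := by
  have hpos : ∀ y, 0 ≤ y → ∃ x, leftBranch γ x = y := fun y hy => by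
    have := intermediate_value_Icc hy (continuous_leftBranch hγ).continuousOn
    obtain ⟨x, -, hx⟩ := this ⟨by rw [leftBranch_zero]; exact hy, self_le_leftBranch hy⟩
    exact ⟨x, hx⟩
  intro y
  rcases le_total 0 y with hy | hy
  · exact hpos y hy
  · obtain ⟨x, hx⟩ := hpos (-y) (by linarith)
    exact ⟨-x, by rw [leftBranch_neg, hx, neg_neg]⟩

theorem leftBranch_leftInv (hγ : 0 < γ) (y : ℝ) : leftBranch γ (leftInv γ y) = y :=
  Function.rightInverse_invFun (leftBranch_surjective hγ) y

theorem leftInv_leftBranch (hγ : 0 < γ) (x : ℝ) : leftInv γ (leftBranch γ x) = x :=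
  Function.leftInverse_invFun (leftBranch_strictMono hγ).injective x

theorem leftInv_strictMono (hγ : 0 < γ) : StrictMono (leftInv γ) := fun x y hxy => by
  rw [← (leftBranch_strictMono hγ).lt_iff_lt, leftBranch_leftInv hγ, leftBranch_leftInv hγ]
  exact hxy

theorem leftInv_zero (hγ : 0 < γ) : leftInv γ 0 = 0 := by
  conv_lhs => rw [← leftBranch_zero (γ := γ)]
  exact leftInv_leftBranch hγ 0

theorem leftInv_one (hγ : 0 < γ) : leftInv γ 1 = 1 / 2 := by
  conv_lhs => rw [← leftBranch_half (γ := γ)]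
  exact leftInv_leftBranch hγ _

theorem leftInv_nonneg (hγ : 0 < γ) {y : ℝ} (hy : 0 ≤ y) : 0 ≤ leftInv γ y := by
  rw [← leftInv_zero hγ]; exact (leftInv_strictMono hγ).monotone hy

theorem leftInv_pos (hγ : 0 < γ) {y : ℝ} (hy : 0 < y) : 0 < leftInv γ y := by
  rw [← leftInv_zero hγ]; exact leftInv_strictMono hγ hy

theorem leftInv_le_half (hγ : 0 < γ) {y : ℝ} (hy : y ≤ 1) : leftInv γ y ≤ 1 / 2 := by
  rw [← leftInv_one hγ]; exact (leftInv_strictMono hγ).monotone hy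

theorem leftInv_lt_half (hγ : 0 < γ) {y : ℝ} (hy : y < 1) : leftInv γ y < 1 / 2 := by
  rw [← leftInv_one hγ]; exact leftInv_strictMono hγ hy

/-- On [0, 1/2] the branch at most doubles its argument. Hence the two end points of a tile are
comparable, uniformly in γ. -/
theorem half_le_leftInv (hγ : 0 < γ) {y : ℝ} (hy : 0 ≤ y) (hy1 : y ≤ 1) : y / 2 ≤ leftInv γ y := by
  have h0 := leftInv_nonneg hγ hy
  have h1 := leftInv_le_half hγ hy1
  have h := leftBranch_leftInv hγ y
  rw [leftBranch_of_nonneg h0] at h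
  have h2 : (2 * leftInv γ y) ^ γ ≤ 1 := Real.rpow_le_one (by linarith) (by linarith) hγ.le
  nlinarith

theorem leftInv_sub_le (hγ : 0 < γ) {x y : ℝ} (hx : 0 ≤ x) (hxy : x ≤ y) :
    leftInv γ y - leftInv γ x ≤ y - x := by
  have := sub_le_leftBranch_sub hγ (leftInv_nonneg hγ hx) ((leftInv_strictMono hγ).monotone hxy)
  rwa [leftBranch_leftInv hγ, leftBranch_leftInv hγ] at this

theorem iterate_leftInv_mono (hγ : 0 < γ) (a : ℕ) : StrictMono (leftInv γ)^[a] :=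
  (leftInv_strictMono hγ).iterate a

theorem iterate_leftInv_pos (hγ : 0 < γ) (a : ℕ) {y : ℝ} (hy : 0 < y) : 0 < (leftInv γ)^[a] y := by
  induction a with
  | zero => exact hy
  | succ a ih => rw [Function.iterate_succ_apply']; exact leftInv_pos hγ ih

theorem iterate_leftInv_le_one (hγ : 0 < γ) (a : ℕ) {y : ℝ} (hy : y ≤ 1) : (leftInv γ)^[a] y ≤ 1 := by
  induction a with
  | zero => exact hy
  | succ a ih =>
    rw [Function.iterate_succ_apply']
    exact (leftInv_le_half hγ ih).trans (by norm_num)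

theorem iterate_leftInv_lt_one (hγ : 0 < γ) (a : ℕ) {y : ℝ} (hy : y < 1) : (leftInv γ)^[a] y < 1 := by
  cases a with
  | zero => exact hy
  | succ a =>
    rw [Function.iterate_succ_apply']
    exact (leftInv_le_half hγ (iterate_leftInv_le_one hγ a hy.le)).trans_lt (by norm_num)

theorem iterate_leftInv_sub_le (hγ : 0 < γ) (a : ℕ) {x y : ℝ} (hx : 0 < x) (hxy : x ≤ y) :
    (leftInv γ)^[a] y - (leftInv γ)^[a] x ≤ y - x := by
  induction a with
  | zero => exact le_rfl
  | succ a ih =>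
    rw [Function.iterate_succ_apply', Function.iterate_succ_apply']
    exact (leftInv_sub_le hγ (iterate_leftInv_pos hγ a hx).le
      ((iterate_leftInv_mono hγ a).monotone hxy)).trans ih

/-- The derivative of the left branch. -/
noncomputable def leftDeriv (γ x : ℝ) : ℝ := 1 + (1 + γ) * (2 * x) ^ γ

theorem one_le_leftDeriv (hγ : 0 < γ) {x : ℝ} (hx : 0 ≤ x) : 1 ≤ leftDeriv γ x := by
  have : 0 ≤ (1 + γ) * (2 * x) ^ γ := by positivity
  rw [leftDeriv]; linarith

theorem hasDerivAt_leftBranch {x : ℝ} (hx : 0 < x) :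
    HasDerivAt (leftBranch γ) (leftDeriv γ x) x := by
  have h1 : HasDerivAt (fun y : ℝ => 2 * y) 2 x := by simpa using (hasDerivAt_id x).const_mul 2
  have h2 := h1.rpow_const (p := γ) (Or.inl (by positivity))
  have h3 := (hasDerivAt_id x).mul (h2.const_add 1)
  refine (h3.congr_of_eventuallyEq ?_).congr_deriv ?_
  · filter_upwards [lt_mem_nhds hx] with y hy
    rw [leftBranch_of_nonneg hy.le]; rfl
  · simp only [id, leftDeriv]
    have e : (2 * x) ^ γ = (2 * x) ^ (γ - 1) * (2 * x) := by
      rw [← Real.rpow_add_one (by positivity)]; congr 1; ring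
    rw [e]; ring

theorem continuousAt_leftInv (hγ : 0 < γ) {y : ℝ} (hy : 0 < y) : ContinuousAt (leftInv γ) y := by
  rw [Metric.continuousAt_iff]
  intro ε hε
  refine ⟨min ε y, lt_min hε hy, fun {x} hx => ?_⟩
  rw [Real.dist_eq] at hx ⊢
  have hx1 := hx.trans_le (min_le_left _ _)
  have hx2 := hx.trans_le (min_le_right _ _)
  have hx0 : 0 ≤ x := by linarith [(abs_lt.1 hx2).1]
  rw [abs_lt] at hx1 ⊢
  rcases le_total x y with h | h
  · have := leftInv_sub_le hγ hx0 h
    have := (leftInv_strictMono hγ).monotone h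
    constructor <;> linarith
  · have := leftInv_sub_le hγ hy.le h
    have := (leftInv_strictMono hγ).monotone h
    constructor <;> linarith

theorem hasDerivAt_leftInv (hγ : 0 < γ) {y : ℝ} (hy : 0 < y) :
    HasDerivAt (leftInv γ) (leftDeriv γ (leftInv γ y))⁻¹ y := by
  have h0 := leftInv_pos hγ hy
  exact (hasDerivAt_leftBranch h0).of_local_left_inverse (continuousAt_leftInv hγ hy)
    (by have := one_le_leftDeriv hγ h0.le; positivity)
    (Eventually.of_forall fun z => leftBranch_leftInv hγ z)

/-- The derivative of the `a`-th iterate of the inverse left branch. -/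
noncomputable def iterDeriv (γ : ℝ) (a : ℕ) (y : ℝ) : ℝ :=
  ∏ j ∈ Finset.range a, (leftDeriv γ ((leftInv γ)^[j + 1] y))⁻¹

theorem iterDeriv_pos (hγ : 0 < γ) (a : ℕ) {y : ℝ} (hy : 0 < y) : 0 < iterDeriv γ a y :=
  Finset.prod_pos fun j _ => by
    have := one_le_leftDeriv hγ (iterate_leftInv_pos hγ (j + 1) hy).le
    positivity

theorem hasDerivAt_iterate_leftInv (hγ : 0 < γ) (a : ℕ) {y : ℝ} (hy : 0 < y) :
    HasDerivAt (leftInv γ)^[a] (iterDeriv γ a y) y := by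
  induction a with
  | zero => simpa [iterDeriv] using hasDerivAt_id y
  | succ a ih =>
    rw [Function.iterate_succ']
    have := (hasDerivAt_leftInv hγ (iterate_leftInv_pos hγ a hy)).comp y ih
    refine this.congr_deriv ?_
    rw [iterDeriv, iterDeriv, Finset.prod_range_succ, Function.iterate_succ_apply', mul_comm]

/-- Concavity: the power lies below its tangent at x. The points may come in either order, so the
same inequality also bounds an increment from below. -/
theorem rpow_sub_le_mul_sub (hγ : 0 < γ) (hγ1 : γ ≤ 1) {x y : ℝ} (hx : 0 < x) (hy : 0 < y) :
    y ^ γ - x ^ γ ≤ γ * x ^ (γ - 1) * (y - x) := by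
  have h := rpow_one_add_le_one_add_mul_self (s := y / x - 1)
    (by have : 0 < y / x := by positivity
        linarith) hγ.le hγ1
  rw [show 1 + (y / x - 1) = y / x by ring, Real.div_rpow hy.le hx.le, div_le_iff₀ (by positivity)] at h
  have e : x ^ γ = x ^ (γ - 1) * x := by
    rw [← Real.rpow_add_one hx.ne']; congr 1; ring
  have e2 : (1 + γ * (y / x - 1)) * x ^ γ = x ^ γ + γ * x ^ (γ - 1) * (y - x) := by
    rw [e]; field_simp
  linarith

/-- The telescoping sum over the tiles `[g^(j+1) 1, g^j 1]`. -/
theorem sum_tiles_le (hγ : 0 < γ) (a : ℕ) :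
    ∑ j ∈ Finset.range a, (((leftInv γ)^[j + 1] 1) ^ γ - ((leftInv γ)^[j + 1] (1 / 2)) ^ γ) ≤ 1 := by
  -- Since 1/2 is the image of 1 under `leftInv`, consecutive tiles share an end point.
  have e : ∀ j, (leftInv γ)^[j + 1] (1 / 2) = (leftInv γ)^[j + 1 + 1] 1 := fun j => by
    rw [Function.iterate_succ_apply _ (j + 1), leftInv_one hγ]
  simp only [e]
  rw [Finset.sum_range_sub' (fun j => ((leftInv γ)^[j + 1] 1) ^ γ)]
  have h1 : ((leftInv γ)^[0 + 1] 1) ^ γ ≤ 1 :=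
    Real.rpow_le_one (iterate_leftInv_pos hγ _ one_pos).le (iterate_leftInv_le_one hγ _ le_rfl) hγ.le
  have h2 : 0 ≤ ((leftInv γ)^[a + 1] 1) ^ γ :=
    Real.rpow_nonneg (iterate_leftInv_pos hγ _ one_pos).le _
  linarith

/-- The left branch is convex on the positive axis, so its inverse and all iterates of the inverse
are concave there. -/
theorem iterDeriv_anti (hγ : 0 < γ) (a : ℕ) {x y : ℝ} (hx : 0 < x) (hxy : x ≤ y) :
    iterDeriv γ a y ≤ iterDeriv γ a x := by
  refine Finset.prod_le_prod (fun j _ => ?_) fun j _ => ?_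
  · have := one_le_leftDeriv hγ (iterate_leftInv_pos hγ (j + 1) (hx.trans_le hxy)).le
    positivity
  · have h0 := iterate_leftInv_pos hγ (j + 1) hx
    have h1 := one_le_leftDeriv hγ h0.le
    have h2 := (iterate_leftInv_mono hγ (j + 1)).monotone hxy
    refine inv_anti₀ (by linarith) ?_
    rw [leftDeriv, leftDeriv]
    have : (2 * (leftInv γ)^[j + 1] x) ^ γ ≤ (2 * (leftInv γ)^[j + 1] y) ^ γ :=
      Real.rpow_le_rpow (by positivity) (by linarith) hγ.le
    nlinarith

/-- The derivative of the branch is an affine function of the γ-th power with slope (1 + γ) * 2 ^ γ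
≤ 4, and is at least 1. Each factor of the chain rule thus changes by at most the exponential of 4
times the difference of γ-th powers. This avoids second derivatives, which blow up at 0. -/
theorem iterDeriv_le_exp_sum (hγ : 0 < γ) (hγ1 : γ ≤ 1) (a : ℕ) {x y : ℝ} (hx : 0 < x) (hxy : x ≤ y) :
    iterDeriv γ a x ≤ Real.exp (4 * ∑ j ∈ Finset.range a,
      (((leftInv γ)^[j + 1] y) ^ γ - ((leftInv γ)^[j + 1] x) ^ γ)) * iterDeriv γ a y := by
  rw [Finset.mul_sum, Real.exp_sum, iterDeriv, iterDeriv, ← Finset.prod_mul_distrib]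
  refine Finset.prod_le_prod (fun j _ => ?_) fun j _ => ?_
  · have := one_le_leftDeriv hγ (iterate_leftInv_pos hγ (j + 1) hx).le
    positivity
  · have h0 := iterate_leftInv_pos hγ (j + 1) hx
    have h2 := (iterate_leftInv_mono hγ (j + 1)).monotone hxy
    set u := (leftInv γ)^[j + 1] x
    set w := (leftInv γ)^[j + 1] y
    have hu := one_le_leftDeriv hγ h0.le
    have hw := one_le_leftDeriv hγ (h0.le.trans h2)
    rw [← div_eq_mul_inv, le_div_iff₀ (by linarith), inv_mul_le_iff₀ (by linarith)]
    have huw : u ^ γ ≤ w ^ γ := Real.rpow_le_rpow h0.le h2 hγ.le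
    have h4 : (1 + γ) * 2 ^ γ ≤ 4 := by
      have : (2 : ℝ) ^ γ ≤ 2 := by
        conv_rhs => rw [← Real.rpow_one 2]
        exact Real.rpow_le_rpow_of_exponent_le (by norm_num) hγ1
      have : (0 : ℝ) < 2 ^ γ := by positivity
      nlinarith
    have e : leftDeriv γ w - leftDeriv γ u = (1 + γ) * 2 ^ γ * (w ^ γ - u ^ γ) := by
      rw [leftDeriv, leftDeriv, Real.mul_rpow (by norm_num) h0.le,
        Real.mul_rpow (by norm_num) (h0.le.trans h2)]; ring
    have h5 : leftDeriv γ w ≤ leftDeriv γ u + 4 * (w ^ γ - u ^ γ) := by nlinarith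
    have h6 := Real.add_one_le_exp (4 * (w ^ γ - u ^ γ))
    nlinarith

/-- Crude distortion: the differences for x and y are at most those of whole tiles, and these
telescope to at most 1. -/
theorem iterDeriv_le_exp_four (hγ : 0 < γ) (hγ1 : γ ≤ 1) (a : ℕ) {x y : ℝ} (hx : 1 / 2 ≤ x)
    (hxy : x ≤ y) (hy : y ≤ 1) : iterDeriv γ a x ≤ Real.exp 4 * iterDeriv γ a y := by
  have hx0 : 0 < x := by linarith
  refine (iterDeriv_le_exp_sum hγ hγ1 a hx0 hxy).trans ?_
  have h1 := iterDeriv_pos hγ a (hx0.trans_le hxy)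
  refine mul_le_mul_of_nonneg_right (Real.exp_le_exp.2 ?_) h1.le
  conv_rhs => rw [← mul_one 4]
  refine mul_le_mul_of_nonneg_left ((Finset.sum_le_sum fun j _ => ?_).trans (sum_tiles_le hγ a))
    (by norm_num)
  refine sub_le_sub (Real.rpow_le_rpow (iterate_leftInv_pos hγ _ (by linarith)).le ?_ hγ.le)
    (Real.rpow_le_rpow (iterate_leftInv_pos hγ _ (by norm_num)).le ?_ hγ.le)
  · exact (iterate_leftInv_mono hγ _).monotone hy
  · exact (iterate_leftInv_mono hγ _).monotone hx

/-- By crude distortion and the mean value theorem, an iterate preserves proportions within the tile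
[1/2, 1] up to the factor exp 4. The factor 2 is the inverse length of that tile. -/
theorem iterate_leftInv_sub_le_tile (hγ : 0 < γ) (hγ1 : γ ≤ 1) (a : ℕ) {x y : ℝ} (hx : 1 / 2 ≤ x)
    (hxy : x ≤ y) (hy : y ≤ 1) :
    (leftInv γ)^[a] y - (leftInv γ)^[a] x
      ≤ 2 * Real.exp 4 * (y - x) * ((leftInv γ)^[a] 1 - (leftInv γ)^[a] (1 / 2)) := by
  have mvt : ∀ u w : ℝ, 0 < u → u < w → ∃ ξ ∈ Set.Icc u w,
      (leftInv γ)^[a] w - (leftInv γ)^[a] u = iterDeriv γ a ξ * (w - u) := by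
    intro u w hu huw
    obtain ⟨ξ, hξ, h⟩ := exists_hasDerivAt_eq_slope (leftInv γ)^[a] (iterDeriv γ a) huw
      (fun z hz => (hasDerivAt_iterate_leftInv hγ a (hu.trans_le hz.1)).continuousAt.continuousWithinAt)
      (fun z hz => hasDerivAt_iterate_leftInv hγ a (hu.trans hz.1))
    refine ⟨ξ, ⟨hξ.1.le, hξ.2.le⟩, ?_⟩
    rw [h, div_mul_cancel₀ _ (by linarith)]
  rcases hxy.eq_or_lt with rfl | hlt
  · simp
  obtain ⟨ξ, hξ, e1⟩ := mvt x y (by linarith) hlt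
  obtain ⟨ζ, hζ, e2⟩ := mvt (1 / 2) 1 (by norm_num) (by norm_num)
  rw [e1, e2]
  have h : iterDeriv γ a ξ ≤ Real.exp 4 * iterDeriv γ a ζ := by
    rcases le_total ξ ζ with h | h
    · exact iterDeriv_le_exp_four hγ hγ1 a (hx.trans hξ.1) h hζ.2
    · have h1 := iterDeriv_anti hγ a (by linarith [hζ.1]) h
      have h2 := iterDeriv_pos hγ a (by linarith [hζ.1] : 0 < ζ)
      have h3 := Real.one_le_exp (show (0 : ℝ) ≤ 4 by norm_num)
      nlinarith
  have := mul_le_mul_of_nonneg_right h (by linarith : 0 ≤ y - x)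
  linarith

/-- Bounded distortion of the iterates of the inverse left branch. -/
theorem iterDeriv_le_exp_mul (hγ : 0 < γ) (hγ1 : γ ≤ 1) (a : ℕ) {x y : ℝ} (hx : 1 / 2 ≤ x)
    (hxy : x ≤ y) (hy : y ≤ 1) :
    iterDeriv γ a x ≤ Real.exp (16 * Real.exp 4 * (y - x)) * iterDeriv γ a y := by
  have hx0 : 0 < x := by linarith
  refine (iterDeriv_le_exp_sum hγ hγ1 a hx0 hxy).trans ?_
  have h1 := iterDeriv_pos hγ a (hx0.trans_le hxy)
  refine mul_le_mul_of_nonneg_right (Real.exp_le_exp.2 ?_) h1.le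
  have hE : 0 < Real.exp 4 := Real.exp_pos _
  -- Bootstrap: each summand is now compared with the increment over its whole tile times a multiple
  -- of y - x, and the whole tiles still telescope. This makes the distortion proportional to the
  -- distance.
  suffices h : ∑ j ∈ Finset.range a, (((leftInv γ)^[j + 1] y) ^ γ - ((leftInv γ)^[j + 1] x) ^ γ)
      ≤ 4 * Real.exp 4 * (y - x) * 1 by linarith
  have hc : 0 ≤ 4 * Real.exp 4 * (y - x) := by
    have : 0 ≤ y - x := by linarith
    positivity
  refine le_trans ?_ (mul_le_mul_of_nonneg_left (sum_tiles_le hγ a) hc)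
  rw [Finset.mul_sum]
  refine Finset.sum_le_sum fun j _ => ?_
  have hxm := (iterate_leftInv_mono hγ (j + 1)).monotone hx
  have hxym := (iterate_leftInv_mono hγ (j + 1)).monotone hxy
  have htile := iterate_leftInv_sub_le_tile hγ hγ1 (j + 1) hx hxy hy
  have hb : (leftInv γ)^[j + 1] 1 / 2 ≤ (leftInv γ)^[j + 1] (1 / 2) := by
    have e : (leftInv γ)^[j + 1] (1 / 2) = leftInv γ ((leftInv γ)^[j + 1] 1) := by
      rw [← Function.iterate_succ_apply' (leftInv γ), Function.iterate_succ_apply _ (j + 1),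
        leftInv_one hγ]
    rw [e]
    exact half_le_leftInv hγ (iterate_leftInv_pos hγ _ one_pos).le (iterate_leftInv_le_one hγ _ le_rfl)
  have hB0 := iterate_leftInv_pos hγ (j + 1) one_pos
  have hx0' := iterate_leftInv_pos hγ (j + 1) hx0
  have hy0' := iterate_leftInv_pos hγ (j + 1) (hx0.trans_le hxy)
  have hb0' := iterate_leftInv_pos hγ (j + 1) (show (0 : ℝ) < 1 / 2 by norm_num)
  set X := (leftInv γ)^[j + 1] x
  set Y := (leftInv γ)^[j + 1] y
  set B := (leftInv γ)^[j + 1] 1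
  set b := (leftInv γ)^[j + 1] (1 / 2)
  have k1 := rpow_sub_le_mul_sub hγ hγ1 hx0' hy0'
  have k2 := rpow_sub_le_mul_sub hγ hγ1 hB0 hb0'
  -- The two end points of a tile are within a factor 2, so the derivative of the γ-th power is
  -- nearly constant on it.
  have k3 : X ^ (γ - 1) ≤ 2 * B ^ (γ - 1) := by
    have h3 : X ^ (γ - 1) ≤ (B / 2) ^ (γ - 1) :=
      Real.rpow_le_rpow_of_nonpos (by positivity) (hb.trans hxm) (by linarith)
    have h5 : (B / 2) ^ (γ - 1) = B ^ (γ - 1) * 2 ^ (1 - γ) := by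
      rw [Real.div_rpow hB0.le (by norm_num), div_eq_mul_inv, ← Real.rpow_neg (by norm_num)]
      congr 2; ring
    have h6 : (2 : ℝ) ^ (1 - γ) ≤ 2 := by
      conv_rhs => rw [← Real.rpow_one 2]
      exact Real.rpow_le_rpow_of_exponent_le (by norm_num) (by linarith)
    have h7 : 0 < B ^ (γ - 1) := by positivity
    rw [h5] at h3
    nlinarith
  have hP : 0 < B ^ (γ - 1) := by positivity
  calc Y ^ γ - X ^ γ ≤ γ * X ^ (γ - 1) * (Y - X) := k1
    _ ≤ γ * (2 * B ^ (γ - 1)) * (2 * Real.exp 4 * (y - x) * (B - b)) := by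
      have : 0 ≤ Y - X := by linarith
      gcongr
    _ = 4 * Real.exp 4 * (y - x) * (γ * B ^ (γ - 1) * (B - b)) := by ring
    _ ≤ 4 * Real.exp 4 * (y - x) * (B ^ γ - b ^ γ) := by
      refine mul_le_mul_of_nonneg_left ?_ hc
      linarith

end LeftBranch

/-! ### Full branch maps -/

/-- A full branch map `G` of the unit interval with inverse branches `ψ a`, weights `ρ a` (the
Jacobians of the inverse branches) and a return time equal to `a + 1` on the `a`-th branch. -/
structure FullBranchMap (p D K : ℝ) (G : I → I) (τ : I → ℕ) (ψ : ℕ → I → I) (ρ : ℕ → I → ℝ) :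
    Prop where
  measurable_map : Measurable G
  measurable_time : Measurable τ
  one_le_time : ∀ x, 1 ≤ τ x
  contracting : ∀ a x y, dist (ψ a x) (ψ a y) ≤ dist x y / 2
  weight_pos : ∀ a z, 0 < ρ a z
  distortion : ∀ a x y, ρ a x ≤ Real.exp (D * dist x y) * ρ a y
  time_branch : ∀ a (z : I), (z : ℝ) < 1 → τ (ψ a z) = a + 1
  duality : ∀ φ F : I → ℝ≥0∞, Measurable φ → Measurable F →
    ∫⁻ x, φ (G x) * F x = ∫⁻ z, φ z * ∑' a, ENNReal.ofReal (ρ a z) * F (ψ a z)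
  moment : ∫⁻ x : I, ENNReal.ofReal ((τ x : ℝ) ^ p) ≤ ENNReal.ofReal K

/-! ### First passage times and the jump transformation -/

/-- One plus the first time at which the orbit of `x` is in `[1/2, 1]`. -/
noncomputable def excursionTime (T : I → I) (x : I) : ℕ :=
  sInf {j : ℕ | 1 / 2 ≤ (T^[j] x : ℝ)} + 1

/-- The jump transformation associated with `[1/2, 1]`. -/
noncomputable def jumpMap (T : I → I) (x : I) : I := T^[excursionTime T x] x

theorem lintegral_unitInterval (f : ℝ → ℝ≥0∞) :
    ∫⁻ x : I, f x = ∫⁻ x in Set.Icc (0 : ℝ) 1, f x :=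
  lintegral_subtype_comap measurableSet_Icc f

theorem ae_mem_Ioo_unitInterval : ∀ᵐ x : I, 0 < (x : ℝ) ∧ (x : ℝ) < 1 := by
  have h0 : ∀ᵐ x : I, x ≠ 0 := by
    rw [ae_iff]; simp
  have h1 : ∀ᵐ x : I, x ≠ 1 := by
    rw [ae_iff]; simp
  filter_upwards [h0, h1] with x hx0 hx1
  exact ⟨unitInterval.pos_iff_ne_zero.2 hx0, unitInterval.lt_one_iff_ne_one.2 hx1⟩

theorem measurable_iterate_time {T : I → I} (hT : Measurable T) {n : I → ℕ} (hn : Measurable n) :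
    Measurable fun x => T^[n x] x := by
  have h : Measurable fun q : ℕ × I => T^[q.1] q.2 :=
    measurable_from_prod_countable_right fun m => hT.iterate m
  exact h.comp (hn.prodMk measurable_id)

theorem measurable_excursionTime {T : I → I} (hT : Measurable T) : Measurable (excursionTime T) := by
  refine Measurable.add_const (measurable_to_countable' fun n => ?_) 1
  have hm : ∀ j : ℕ, MeasurableSet {x : I | 1 / 2 ≤ (T^[j] x : ℝ)} := fun j =>
    measurableSet_le measurable_const (measurable_subtype_coe.comp (hT.iterate j))
  have hn : MeasurableSet {x : I | ∀ j : ℕ, ¬ 1 / 2 ≤ (T^[j] x : ℝ)} := by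
    rw [Set.ofPred_forall]; exact MeasurableSet.iInter fun j => (hm j).compl
  have hn' : MeasurableSet {x : I | ∀ j < n, ¬ 1 / 2 ≤ (T^[j] x : ℝ)} := by
    have : {x : I | ∀ j < n, ¬ 1 / 2 ≤ (T^[j] x : ℝ)} = ⋂ j < n, {x : I | 1 / 2 ≤ (T^[j] x : ℝ)}ᶜ := by
      ext; simp
    rw [this]
    exact MeasurableSet.iInter fun j => MeasurableSet.iInter fun _ => (hm j).compl
  -- The infimum of the empty set is 0, so points that never reach [1/2, 1] belong to the fibre over
  -- n = 0.
  have key : (fun x : I => sInf {j : ℕ | 1 / 2 ≤ (T^[j] x : ℝ)}) ⁻¹' {n}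
      = ({x : I | ∀ j < n, ¬ 1 / 2 ≤ (T^[j] x : ℝ)} ∩ {x : I | 1 / 2 ≤ (T^[n] x : ℝ)})
        ∪ ({x : I | ∀ j : ℕ, ¬ 1 / 2 ≤ (T^[j] x : ℝ)} ∩ {_x : I | n = 0}) := by
    ext x
    simp only [Set.mem_preimage, Set.mem_singleton_iff, Set.mem_union, Set.mem_inter_iff, Set.mem_ofPred_eq]
    constructor
    · intro h
      by_cases hne : {j : ℕ | 1 / 2 ≤ (T^[j] x : ℝ)}.Nonempty
      · left
        refine ⟨fun j hj hj' => ?_, ?_⟩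
        · have := Nat.sInf_le (s := {j : ℕ | 1 / 2 ≤ (T^[j] x : ℝ)}) hj'
          omega
        · rw [← h]; exact Nat.sInf_mem hne
      · right
        rw [Set.not_nonempty_iff_eq_empty] at hne
        rw [hne, Nat.sInf_empty] at h
        exact ⟨fun j hj => by have : j ∈ (∅ : Set ℕ) := hne ▸ hj
                              exact this, h.symm⟩
    · rintro (⟨h1, h2⟩ | ⟨h1, rfl⟩)
      · refine le_antisymm (Nat.sInf_le h2) ?_
        by_contra hlt
        exact h1 _ (not_le.1 hlt) (Nat.sInf_mem (s := {j : ℕ | 1 / 2 ≤ (T^[j] x : ℝ)}) ⟨n, h2⟩)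
      · have : {j : ℕ | 1 / 2 ≤ (T^[j] x : ℝ)} = ∅ := Set.eq_empty_of_forall_notMem h1
        rw [this, Nat.sInf_empty]
  rw [key]
  exact (hn'.inter (hm n)).union (hn.inter (MeasurableSet.const _))

theorem measurable_jumpMap {T : I → I} (hT : Measurable T) : Measurable (jumpMap T) :=
  measurable_iterate_time hT (measurable_excursionTime hT)

theorem lt_half_of_lt_excursionTime {T : I → I} {x : I} {j : ℕ} (hj : j + 1 < excursionTime T x) :
    (T^[j] x : ℝ) < 1 / 2 := by
  by_contra h
  have := Nat.sInf_le (s := {j : ℕ | 1 / 2 ≤ (T^[j] x : ℝ)}) (not_lt.1 h)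
  unfold excursionTime at hj
  omega

theorem excursionTime_eq {T : I → I} {x : I} {n : ℕ} (h1 : ∀ j < n, (T^[j] x : ℝ) < 1 / 2)
    (h2 : 1 / 2 ≤ (T^[n] x : ℝ)) : excursionTime T x = n + 1 := by
  unfold excursionTime
  congr 1
  refine le_antisymm (Nat.sInf_le h2) ?_
  by_contra hlt
  have h3 : 1 / 2 ≤ (T^[sInf {j : ℕ | 1 / 2 ≤ (T^[j] x : ℝ)}] x : ℝ) :=
    Nat.sInf_mem (s := {j : ℕ | 1 / 2 ≤ (T^[j] x : ℝ)}) ⟨n, h2⟩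
  have h4 := h1 _ (not_le.1 hlt)
  linarith

/-! ### Branches and excursion times of the intermittent map -/

section LSV

variable {γ : ℝ}

theorem lsvMap_left (hγ : 0 < γ) {x : I} (hx : (x : ℝ) < 1 / 2) : (lsvMap γ hγ x : ℝ) = leftBranch γ x := by
  rw [lsvMap, dif_pos hx, leftBranch_of_nonneg x.2.1, Real.mul_rpow (by norm_num) x.2.1]

theorem lsvMap_right (hγ : 0 < γ) {x : I} (hx : 1 / 2 ≤ (x : ℝ)) : (lsvMap γ hγ x : ℝ) = 2 * x - 1 := by
  rw [lsvMap, dif_neg (not_lt.2 hx)]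

theorem measurable_lsvMap (hγ : 0 < γ) : Measurable (lsvMap γ hγ) := by
  rw [← (MeasurableEmbedding.subtype_coe measurableSet_Icc).measurable_comp_iff]
  have : (Subtype.val ∘ lsvMap γ hγ) = fun x : I =>
      if (x : ℝ) < 1 / 2 then leftBranch γ x else 2 * (x : ℝ) - 1 := by
    ext x
    simp only [Function.comp_apply]
    split_ifs with h
    · exact lsvMap_left hγ h
    · exact lsvMap_right hγ (not_lt.1 h)
  rw [this]
  exact Measurable.ite (measurableSet_lt measurable_subtype_coe measurable_const)
    ((continuous_leftBranch hγ).measurable.comp measurable_subtype_coe)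
    ((measurable_subtype_coe.const_mul 2).sub_const 1)

theorem inverseBranch_mem (hγ : 0 < γ) (a : ℕ) (z : I) :
    (leftInv γ)^[a] ((1 + (z : ℝ)) / 2) ∈ Set.Icc (0 : ℝ) 1 := by
  have h0 := z.2.1
  have h1 := z.2.2
  exact ⟨(iterate_leftInv_pos hγ a (by linarith)).le, iterate_leftInv_le_one hγ a (by linarith)⟩

/-- The inverse branches of the jump transformation of the intermittent map. -/
noncomputable def inverseBranch (hγ : 0 < γ) (a : ℕ) (z : I) : I :=
  ⟨(leftInv γ)^[a] ((1 + (z : ℝ)) / 2), inverseBranch_mem hγ a z⟩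

/-- The Jacobians of the inverse branches. -/
noncomputable def branchWeight (γ : ℝ) (a : ℕ) (z : I) : ℝ := iterDeriv γ a ((1 + (z : ℝ)) / 2) / 2

/-- The point z = 1 must be excluded: its preimages pass through 1/2, where the map already uses the
right branch. -/
theorem iterate_lsvMap_inverseBranch (hγ : 0 < γ) {a j : ℕ} (hj : j ≤ a) {z : I} (hz : (z : ℝ) < 1) :
    ((lsvMap γ hγ)^[j] (inverseBranch hγ a z) : ℝ) = (leftInv γ)^[a - j] ((1 + (z : ℝ)) / 2) := by
  induction j with
  | zero => rfl
  | succ j ih =>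
    have h := ih (by omega)
    have e : (leftInv γ)^[a - j] ((1 + (z : ℝ)) / 2)
        = leftInv γ ((leftInv γ)^[a - (j + 1)] ((1 + (z : ℝ)) / 2)) := by
      rw [← Function.iterate_succ_apply' (leftInv γ)]; congr 2; omega
    rw [e] at h
    have hlt := leftInv_lt_half hγ (iterate_leftInv_lt_one hγ (a - (j + 1))
      (show (1 + (z : ℝ)) / 2 < 1 by linarith))
    rw [Function.iterate_succ_apply', lsvMap_left hγ (by rw [h]; exact hlt), h, leftBranch_leftInv hγ]

theorem excursionTime_inverseBranch (hγ : 0 < γ) (a : ℕ) {z : I} (hz : (z : ℝ) < 1) :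
    excursionTime (lsvMap γ hγ) (inverseBranch hγ a z) = a + 1 := by
  have hz0 := z.2.1
  refine excursionTime_eq (fun j hj => ?_) ?_
  · rw [iterate_lsvMap_inverseBranch hγ hj.le hz, show a - j = (a - j - 1) + 1 by omega,
      Function.iterate_succ_apply']
    exact leftInv_lt_half hγ (iterate_leftInv_lt_one hγ _ (by linarith))
  · rw [iterate_lsvMap_inverseBranch hγ le_rfl hz, Nat.sub_self, Function.iterate_zero, id]
    linarith

theorem jumpMap_inverseBranch (hγ : 0 < γ) (a : ℕ) {z : I} (hz : (z : ℝ) < 1) :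
    jumpMap (lsvMap γ hγ) (inverseBranch hγ a z) = z := by
  have hz0 := z.2.1
  have h := iterate_lsvMap_inverseBranch hγ (le_refl a) hz
  rw [Nat.sub_self, Function.iterate_zero, id] at h
  rw [jumpMap, excursionTime_inverseBranch hγ a hz, Function.iterate_succ_apply']
  ext
  rw [lsvMap_right hγ (by rw [h]; linarith), h]
  ring

/-- Points that have not reached `[1/2, 1]` within `n` steps are close to `0`. -/
theorem mul_le_rpow_of_forall_lt_half (hγ : 0 < γ) {g : ℝ} (hg : γ ≤ g) (hg1 : g ≤ 1) (n : ℕ) {x : I}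
    (hx : 0 < (x : ℝ)) (h : ∀ j < n, ((lsvMap γ hγ)^[j] x : ℝ) < 1 / 2) :
    n * (g / 3) ≤ (x : ℝ) ^ (-g) := by
  have hg0 : 0 < g := hγ.trans_le hg
  -- In the coordinate (2 y)^(-g) the map near the neutral point is almost a translation: every step
  -- decreases it by at least g / 3. Replacing γ by the larger g only weakens the drift, as 2 y ≤ 1,
  -- and makes the estimate uniform in γ.
  have step : ∀ y : ℝ, 0 < y → y < 1 / 2 → y ≤ leftBranch γ y ∧
      (2 * leftBranch γ y) ^ (-g) ≤ (2 * y) ^ (-g) - g / 3 := by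
    intro y hy hy2
    refine ⟨self_le_leftBranch hy.le, ?_⟩
    set s := (2 * y) ^ g with hs
    have hs0 : 0 < s := by positivity
    have hs1 : s ≤ 1 := Real.rpow_le_one (by linarith) (by linarith) hg0.le
    have h1 : y * (1 + s) ≤ leftBranch γ y := by
      rw [leftBranch_of_nonneg hy.le]
      have : s ≤ (2 * y) ^ γ :=
        Real.rpow_le_rpow_of_exponent_ge (by linarith) (by linarith) hg
      gcongr
    have h2 : (2 * leftBranch γ y) ^ (-g) ≤ (2 * y * (1 + s)) ^ (-g) :=
      Real.rpow_le_rpow_of_nonpos (by positivity) (by linarith) (by linarith)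
    have h3 : (2 * y * (1 + s)) ^ (-g) = s⁻¹ * ((1 + s) ^ g)⁻¹ := by
      rw [Real.mul_rpow (by positivity) (by positivity), Real.rpow_neg (by positivity),
        Real.rpow_neg (by positivity)]
    -- From log (1 + s) ≥ s / (1 + s) ≥ s / 2 for 0 < s ≤ 1.
    have h4 : 1 + g * s / 2 ≤ (1 + s) ^ g := by
      rw [Real.rpow_def_of_pos (by positivity)]
      have l1 := Real.one_sub_inv_le_log_of_pos (show 0 < 1 + s by positivity)
      have l2 : s / 2 ≤ 1 - (1 + s)⁻¹ := by
        have : 1 - (1 + s)⁻¹ = s / (1 + s) := by field_simp; ring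
        rw [this]
        exact div_le_div_of_nonneg_left hs0.le (by positivity) (by linarith)
      have l3 := Real.add_one_le_exp (Real.log (1 + s) * g)
      nlinarith
    have h5 : ((1 + s) ^ g)⁻¹ ≤ (1 + g * s / 2)⁻¹ := inv_anti₀ (by positivity) h4
    have h6 : s⁻¹ * (1 + g * s / 2)⁻¹ = s⁻¹ - (g / 2) * (1 + g * s / 2)⁻¹ := by
      field_simp; ring
    have h7 : (3 / 2 : ℝ)⁻¹ ≤ (1 + g * s / 2)⁻¹ := inv_anti₀ (by positivity) (by nlinarith)
    rw [Real.rpow_neg (show 0 ≤ 2 * y by positivity), ← hs]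
    have h8 : s⁻¹ * ((1 + s) ^ g)⁻¹ ≤ s⁻¹ * (1 + g * s / 2)⁻¹ := by gcongr
    rw [h3] at h2
    have h9 : g / 2 * (3 / 2 : ℝ)⁻¹ ≤ g / 2 * (1 + g * s / 2)⁻¹ := by gcongr
    have h10 : g / 2 * (3 / 2 : ℝ)⁻¹ = g / 3 := by ring
    linarith
  have main : ∀ m ≤ n, 0 < ((lsvMap γ hγ)^[m] x : ℝ) ∧
      (2 * ((lsvMap γ hγ)^[m] x : ℝ)) ^ (-g) ≤ (2 * (x : ℝ)) ^ (-g) - m * (g / 3) := by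
    intro m
    induction m with
    | zero => intro _; simpa using hx
    | succ m ih =>
      intro hm
      obtain ⟨i1, i2⟩ := ih (by omega)
      have hlt := h m (by omega)
      obtain ⟨s1, s2⟩ := step _ i1 hlt
      rw [Function.iterate_succ_apply', lsvMap_left hγ hlt]
      refine ⟨i1.trans_le s1, ?_⟩
      push_cast
      linarith
  obtain ⟨h1, h2⟩ := main n le_rfl
  have h3 : 0 ≤ (2 * ((lsvMap γ hγ)^[n] x : ℝ)) ^ (-g) := by positivity
  have h4 : (2 * (x : ℝ)) ^ (-g) ≤ (x : ℝ) ^ (-g) :=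
    Real.rpow_le_rpow_of_nonpos hx (by linarith) (by linarith)
  linarith

/-- The extra unit in the definition of the time is absorbed because x^(-g) ≥ 1. -/
theorem excursionTime_le_rpow (hγ : 0 < γ) {g : ℝ} (hg : γ ≤ g) (hg1 : g ≤ 1) {x : I} (hx : 0 < (x : ℝ)) :
    (excursionTime (lsvMap γ hγ) x : ℝ) ≤ (3 / g + 1) * (x : ℝ) ^ (-g) := by
  have hg0 : 0 < g := hγ.trans_le hg
  obtain ⟨n, hn⟩ : ∃ n, excursionTime (lsvMap γ hγ) x = n + 1 := ⟨_, rfl⟩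
  have h := mul_le_rpow_of_forall_lt_half hγ hg hg1 n hx fun j hj =>
    lt_half_of_lt_excursionTime (by omega)
  have h1 : 1 ≤ (x : ℝ) ^ (-g) := Real.one_le_rpow_of_pos_of_le_one_of_nonpos hx x.2.2 (by linarith)
  rw [hn]
  push_cast
  have : (n : ℝ) ≤ 3 / g * (x : ℝ) ^ (-g) := by
    rw [div_mul_eq_mul_div, le_div_iff₀ hg0]; linarith
  linarith

theorem exists_half_le_iterate (hγ : 0 < γ) {x : I} (hγ1 : γ ≤ 1) (hx : 0 < (x : ℝ)) :
    ∃ n, (∀ j < n, ((lsvMap γ hγ)^[j] x : ℝ) < 1 / 2) ∧ 1 / 2 ≤ ((lsvMap γ hγ)^[n] x : ℝ) := by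
  classical
  have hex : ∃ n, 1 / 2 ≤ ((lsvMap γ hγ)^[n] x : ℝ) := by
    by_contra! hcon
    obtain ⟨n, hn⟩ := exists_nat_gt ((x : ℝ) ^ (-γ) / (γ / 3))
    have := mul_le_rpow_of_forall_lt_half hγ le_rfl hγ1 n hx fun j _ => hcon j
    rw [div_lt_iff₀ (by positivity)] at hn
    linarith
  exact ⟨Nat.find hex, fun j hj => not_le.1 (Nat.find_min hex hj), Nat.find_spec hex⟩

/-- Follow x until it first reaches [1/2, 1], apply the right branch, and retrace the orbit with
`leftInv`. The point stays below 1 because the left branch maps (0, 1/2) into (0, 1). -/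
theorem exists_eq_inverseBranch (hγ : 0 < γ) (hγ1 : γ ≤ 1) {x : I} (hx : 0 < (x : ℝ)) (hx1 : (x : ℝ) < 1) :
    ∃ a, ∃ z : I, (z : ℝ) < 1 ∧ x = inverseBranch hγ a z := by
  obtain ⟨n, h1, h2⟩ := exists_half_le_iterate hγ hγ1 hx
  have hlt : ((lsvMap γ hγ)^[n] x : ℝ) < 1 := by
    cases n with
    | zero => exact hx1
    | succ n =>
      rw [Function.iterate_succ_apply', lsvMap_left hγ (h1 n (by omega)), ← leftBranch_half (γ := γ)]
      exact leftBranch_strictMono hγ (h1 n (by omega))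
  have hback : ∀ m ≤ n, (leftInv γ)^[m] ((lsvMap γ hγ)^[m] x : ℝ) = x := by
    intro m
    induction m with
    | zero => intro _; rfl
    | succ m ih =>
      intro hm
      rw [Function.iterate_succ_apply, Function.iterate_succ_apply', lsvMap_left hγ (h1 m (by omega)),
        leftInv_leftBranch hγ]
      exact ih (by omega)
  refine ⟨n, ⟨2 * ((lsvMap γ hγ)^[n] x : ℝ) - 1, by linarith, by linarith⟩, by simp only; linarith, ?_⟩
  ext
  simp only [inverseBranch]
  rw [show (1 + (2 * ((lsvMap γ hγ)^[n] x : ℝ) - 1)) / 2 = ((lsvMap γ hγ)^[n] x : ℝ) by ring]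
  exact (hback n le_rfl).symm

theorem continuous_inverseBranch (hγ : 0 < γ) (a : ℕ) : Continuous (inverseBranch hγ a) := by
  refine Continuous.subtype_mk (continuous_iff_continuousAt.2 fun z => ?_) _
  have h0 := z.2.1
  have h1 : ContinuousAt (leftInv γ)^[a] ((1 + (z : ℝ)) / 2) :=
    (hasDerivAt_iterate_leftInv hγ a (by linarith)).continuousAt
  have h2 : ContinuousAt (fun z : I => (1 + (z : ℝ)) / 2) z := by fun_prop
  exact ContinuousAt.comp (f := fun z : I => (1 + (z : ℝ)) / 2) h1 h2

theorem branchWeight_le_exp_mul (hγ : 0 < γ) (hγ1 : γ ≤ 1) (a : ℕ) (x y : I) :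
    branchWeight γ a x ≤ Real.exp (16 * Real.exp 4 * dist x y) * branchWeight γ a y := by
  have hx0 := x.2.1
  have hx1 := x.2.2
  have hy0 := y.2.1
  have hy1 := y.2.2
  have hd : dist x y = |(x : ℝ) - y| := rfl
  have hE : 0 < Real.exp 4 := Real.exp_pos _
  rw [branchWeight, branchWeight, hd, ← mul_div_assoc]
  refine div_le_div_of_nonneg_right ?_ (by norm_num)
  have hp := iterDeriv_pos hγ a (show 0 < (1 + (y : ℝ)) / 2 by linarith)
  rcases le_total (x : ℝ) y with h | h
  · refine (iterDeriv_le_exp_mul hγ hγ1 a (by linarith)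
      (show (1 + (x : ℝ)) / 2 ≤ (1 + (y : ℝ)) / 2 by linarith) (by linarith)).trans ?_
    refine mul_le_mul_of_nonneg_right (Real.exp_le_exp.2 ?_) hp.le
    refine mul_le_mul_of_nonneg_left ?_ (by positivity)
    rw [abs_sub_comm]
    exact le_trans (by linarith) (le_abs_self _)
  · refine (iterDeriv_anti hγ a (by linarith)
      (show (1 + (y : ℝ)) / 2 ≤ (1 + (x : ℝ)) / 2 by linarith)).trans ?_
    have := Real.one_le_exp (show 0 ≤ 16 * Real.exp 4 * |(x : ℝ) - y| by positivity)
    nlinarith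

theorem branchWeight_pos (hγ : 0 < γ) (a : ℕ) (z : I) : 0 < branchWeight γ a z := by
  have h0 := z.2.1
  have := iterDeriv_pos hγ a (show 0 < (1 + (z : ℝ)) / 2 by linarith)
  rw [branchWeight]; positivity

/-- The factor 1/2 comes entirely from the inverse of the right branch; iterates of the left inverse
are merely nonexpanding. -/
theorem dist_iterate_leftInv_le (hγ : 0 < γ) (a : ℕ) (x y : I) :
    |(leftInv γ)^[a] ((1 + (x : ℝ)) / 2) - (leftInv γ)^[a] ((1 + (y : ℝ)) / 2)| ≤ dist x y / 2 := by
  have hx0 := x.2.1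
  have hy0 := y.2.1
  have hd : dist x y = |(x : ℝ) - y| := rfl
  rw [hd]
  wlog h : (x : ℝ) ≤ y generalizing x y
  · rw [abs_sub_comm, abs_sub_comm (x : ℝ)]
    exact this y x hy0 hx0 rfl (not_le.1 h).le
  · have h1 := iterate_leftInv_sub_le hγ a (by linarith)
      (show (1 + (x : ℝ)) / 2 ≤ (1 + (y : ℝ)) / 2 by linarith)
    have h2 := (iterate_leftInv_mono hγ a).monotone
      (show (1 + (x : ℝ)) / 2 ≤ (1 + (y : ℝ)) / 2 by linarith)
    rw [abs_sub_comm, abs_sub_comm (x : ℝ), abs_of_nonneg (by linarith), abs_of_nonneg (by linarith)]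
    linarith

end LSV

/-! ### Change of variables along the branches -/

section LSV

variable {γ : ℝ}

theorem continuous_branchWeight (hγ : 0 < γ) (hγ1 : γ ≤ 1) (a : ℕ) :
    Continuous (branchWeight γ a) := by
  have hE : 0 < Real.exp 4 := Real.exp_pos _
  set D := 16 * Real.exp 4 with hD
  have hD0 : 0 < D := by positivity
  have hdist : ∀ x y : I, dist x y ≤ 1 := fun x y => by
    have : dist x y = |(x : ℝ) - y| := rfl
    rw [this, abs_le]
    constructor <;> linarith [x.2.1, x.2.2, y.2.1, y.2.2]
  refine continuous_iff_continuousAt.2 fun x => ?_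
  have h1 : Tendsto (fun y : I => Real.exp (D * dist y x) * branchWeight γ a x) (𝓝 x)
      (𝓝 (branchWeight γ a x)) := by
    have : Continuous fun y : I => Real.exp (D * dist y x) * branchWeight γ a x := by fun_prop
    simpa using this.tendsto x
  have h2 : Tendsto (fun y : I => Real.exp (-(D * dist y x)) * branchWeight γ a x) (𝓝 x)
      (𝓝 (branchWeight γ a x)) := by
    have : Continuous fun y : I => Real.exp (-(D * dist y x)) * branchWeight γ a x := by fun_prop
    simpa using this.tendsto x
  refine tendsto_of_tendsto_of_tendsto_of_le_of_le h2 h1 (fun y => ?_) fun y =>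
    branchWeight_le_exp_mul hγ hγ1 a y x
  have := branchWeight_le_exp_mul hγ hγ1 a x y
  rw [dist_comm] at this
  dsimp only
  rw [Real.exp_neg, inv_mul_le_iff₀ (Real.exp_pos _)]
  exact this

theorem setLIntegral_branch (hγ : 0 < γ) (hγ1 : γ ≤ 1) (a : ℕ) (H : I → ℝ≥0∞) :
    ∫⁻ x in {x : I | (0 < (x : ℝ) ∧ (x : ℝ) < 1) ∧ excursionTime (lsvMap γ hγ) x = a + 1}, H x
      = ∫⁻ z : I, ENNReal.ofReal (branchWeight γ a z) * H (inverseBranch hγ a z) := by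
  set B : Set I := {x : I | (0 < (x : ℝ) ∧ (x : ℝ) < 1) ∧ excursionTime (lsvMap γ hγ) x = a + 1}
    with hB
  have hBm : MeasurableSet B := by
    refine MeasurableSet.inter (MeasurableSet.inter ?_ ?_) ?_
    · exact measurableSet_lt measurable_const measurable_subtype_coe
    · exact measurableSet_lt measurable_subtype_coe measurable_const
    · exact measurable_excursionTime (measurable_lsvMap hγ) (measurableSet_singleton _)
  have hcBm : MeasurableSet ((↑) '' B : Set ℝ) :=
    (MeasurableEmbedding.subtype_coe measurableSet_Icc).measurableSet_image.2 hBm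
  -- H is extended to the line so that the change of variables theorem on ℝ applies.
  set f : ℝ → ℝ≥0∞ := fun x => H (Set.projIcc 0 1 zero_le_one x) with hf
  have hfH : ∀ x : I, f x = H x := fun x => by rw [hf]; simp only; rw [Set.projIcc_val]
  have e1 : ∫⁻ x in B, H x = ∫⁻ x in ((↑) '' B : Set ℝ), f x := by
    rw [← lintegral_indicator hBm]
    have : ∀ x : I, B.indicator H x = ((↑) '' B : Set ℝ).indicator f x := fun x => by
      by_cases hx : x ∈ B
      · rw [Set.indicator_of_mem hx, Set.indicator_of_mem (Set.mem_image_of_mem _ hx), hfH]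
      · rw [Set.indicator_of_notMem hx, Set.indicator_of_notMem]
        rwa [Subtype.val_injective.mem_set_image]
    simp only [this]
    rw [lintegral_unitInterval, setLIntegral_indicator hcBm, Set.inter_eq_left.2]
    rintro _ ⟨x, -, rfl⟩
    exact x.2
  set Ψ : ℝ → ℝ := fun z => (leftInv γ)^[a] ((1 + z) / 2) with hΨ
  -- The set of points with a given excursion time is exactly the image of [0, 1) under one
  -- injective smooth branch.
  have e2 : ((↑) '' B : Set ℝ) = Ψ '' Set.Ico 0 1 := by
    ext x
    constructor
    · rintro ⟨x, ⟨⟨hx0, hx1⟩, hxa⟩, rfl⟩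
      obtain ⟨b, z, hz, rfl⟩ := exists_eq_inverseBranch hγ hγ1 hx0 hx1
      rw [excursionTime_inverseBranch hγ b hz] at hxa
      obtain rfl : b = a := by omega
      exact ⟨z, ⟨z.2.1, hz⟩, rfl⟩
    · rintro ⟨z, hz, rfl⟩
      refine ⟨inverseBranch hγ a ⟨z, hz.1, hz.2.le⟩, ⟨⟨?_, ?_⟩, ?_⟩, rfl⟩
      · exact iterate_leftInv_pos hγ a (by linarith [hz.1])
      · exact iterate_leftInv_lt_one hγ a (by linarith [hz.2])
      · exact excursionTime_inverseBranch hγ a hz.2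
  have hderiv : ∀ z ∈ Set.Ico (0 : ℝ) 1,
      HasDerivWithinAt Ψ (iterDeriv γ a ((1 + z) / 2) / 2) (Set.Ico 0 1) z := by
    intro z hz
    have h1 : HasDerivAt (fun z : ℝ => (1 + z) / 2) (1 / 2) z :=
      ((hasDerivAt_id z).const_add 1).div_const 2
    have h2 := (hasDerivAt_iterate_leftInv hγ a (show 0 < (1 + z) / 2 by linarith [hz.1])).comp z h1
    exact (h2.congr_deriv (by ring)).hasDerivWithinAt
  have hinj : Set.InjOn Ψ (Set.Ico 0 1) := fun x _ y _ hxy => by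
    have := (iterate_leftInv_mono hγ a).injective hxy
    linarith
  rw [e1, e2, lintegral_image_eq_lintegral_abs_deriv_mul measurableSet_Ico hderiv hinj]
  have e3 : ∀ z : I, ENNReal.ofReal (branchWeight γ a z) * H (inverseBranch hγ a z)
      = ENNReal.ofReal |iterDeriv γ a ((1 + (z : ℝ)) / 2) / 2| * f (Ψ z) := fun z => by
    have h := branchWeight_pos hγ a z
    have h2 : f (Ψ z) = H (inverseBranch hγ a z) := hfH (inverseBranch hγ a z)
    rw [h2]
    unfold branchWeight at h ⊢
    rw [abs_of_pos h]
  simp only [e3]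
  rw [lintegral_unitInterval (fun z => ENNReal.ofReal |iterDeriv γ a ((1 + z) / 2) / 2| * f (Ψ z))]
  exact setLIntegral_congr Ico_ae_eq_Icc

/-- The level sets of the excursion time partition (0, 1). On each of them the change of variables
turns φ ∘ G into φ, because G undoes its inverse branches. -/
theorem lintegral_jumpMap_duality (hγ : 0 < γ) (hγ1 : γ ≤ 1) {φ F : I → ℝ≥0∞} (hφ : Measurable φ)
    (hF : Measurable F) :
    ∫⁻ x, φ (jumpMap (lsvMap γ hγ) x) * F x
      = ∫⁻ z, φ z * ∑' a, ENNReal.ofReal (branchWeight γ a z) * F (inverseBranch hγ a z) := by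
  set G := jumpMap (lsvMap γ hγ) with hG
  set H : I → ℝ≥0∞ := fun x => φ (G x) * F x with hH
  have hGm : Measurable G := measurable_jumpMap (measurable_lsvMap hγ)
  set B : ℕ → Set I := fun a =>
    {x : I | (0 < (x : ℝ) ∧ (x : ℝ) < 1) ∧ excursionTime (lsvMap γ hγ) x = a + 1} with hB
  have hBm : ∀ a, MeasurableSet (B a) := fun a => by
    refine MeasurableSet.inter (MeasurableSet.inter ?_ ?_) ?_
    · exact measurableSet_lt measurable_const measurable_subtype_coe
    · exact measurableSet_lt measurable_subtype_coe measurable_const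
    · exact measurable_excursionTime (measurable_lsvMap hγ) (measurableSet_singleton _)
  have hdisj : Pairwise (Function.onFun Disjoint B) := fun a b hab =>
    Set.disjoint_left.2 fun x hxa hxb => hab (by
      have h1 := hxa.2
      have h2 := hxb.2
      omega)
  have hU : (⋃ a, B a) =ᵐ[volume] (Set.univ : Set I) := by
    rw [eventuallyEq_univ]
    filter_upwards [ae_mem_Ioo_unitInterval] with x hx
    exact Set.mem_iUnion.2 ⟨excursionTime (lsvMap γ hγ) x - 1, hx, by
      unfold excursionTime; omega⟩
  calc ∫⁻ x, H x = ∫⁻ x in ⋃ a, B a, H x := by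
        rw [setLIntegral_congr hU, setLIntegral_univ]
    _ = ∑' a, ∫⁻ x in B a, H x := lintegral_iUnion hBm hdisj H
    _ = ∑' a, ∫⁻ z : I, ENNReal.ofReal (branchWeight γ a z) * (φ z * F (inverseBranch hγ a z)) := by
        refine tsum_congr fun a => ?_
        rw [setLIntegral_branch hγ hγ1 a H]
        refine lintegral_congr_ae ?_
        filter_upwards [ae_mem_Ioo_unitInterval] with z hz
        simp only [hH, hG, jumpMap_inverseBranch hγ a hz.2]
    _ = ∫⁻ z, ∑' a, ENNReal.ofReal (branchWeight γ a z) * (φ z * F (inverseBranch hγ a z)) := by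
        refine (lintegral_tsum fun a => ?_).symm
        exact ((continuous_branchWeight hγ hγ1 a).measurable.ennreal_ofReal.mul
          (hφ.mul (hF.comp (continuous_inverseBranch hγ a).measurable))).aemeasurable
    _ = _ := by
        refine lintegral_congr fun z => ?_
        rw [← ENNReal.tsum_mul_left]
        exact tsum_congr fun a => by ring

/-- The time is at most a multiple of x^(-g), whose p-th power is integrable as g * p < 1. The bound
involves g and not γ. -/
theorem lintegral_excursionTime_rpow_le (hγ : 0 < γ) {g p : ℝ} (hg : γ ≤ g) (hp : 1 ≤ p)
    (hgp : g * p < 1) :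
    ∫⁻ x : I, ENNReal.ofReal ((excursionTime (lsvMap γ hγ) x : ℝ) ^ p)
      ≤ ENNReal.ofReal ((3 / g + 1) ^ p / (1 - g * p)) := by
  have hg0 : 0 < g := hγ.trans_le hg
  have hg1 : g ≤ 1 := by nlinarith
  have hint : IntervalIntegrable (fun x : ℝ => (3 / g + 1) ^ p * x ^ (-(g * p))) volume 0 1 :=
    (intervalIntegral.intervalIntegrable_rpow' (by linarith)).const_mul _
  have hval : ∫ x in (0 : ℝ)..1, (3 / g + 1) ^ p * x ^ (-(g * p)) = (3 / g + 1) ^ p / (1 - g * p) := by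
    rw [intervalIntegral.integral_const_mul, integral_rpow (Or.inl (by linarith))]
    rw [Real.one_rpow, Real.zero_rpow (by linarith), show -(g * p) + 1 = 1 - g * p by ring]
    ring
  calc ∫⁻ x : I, ENNReal.ofReal ((excursionTime (lsvMap γ hγ) x : ℝ) ^ p)
      ≤ ∫⁻ x : I, ENNReal.ofReal ((3 / g + 1) ^ p * (x : ℝ) ^ (-(g * p))) := by
        refine lintegral_mono_ae ?_
        filter_upwards [ae_mem_Ioo_unitInterval] with x hx
        refine ENNReal.ofReal_le_ofReal ?_
        refine (Real.rpow_le_rpow (by positivity) (excursionTime_le_rpow hγ hg hg1 hx.1)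
          (by linarith)).trans_eq ?_
        rw [Real.mul_rpow (by positivity) (by have := hx.1; positivity), ← Real.rpow_mul hx.1.le, neg_mul]
    _ = ∫⁻ x in Set.Icc (0 : ℝ) 1, ENNReal.ofReal ((3 / g + 1) ^ p * x ^ (-(g * p))) :=
        lintegral_unitInterval fun x => ENNReal.ofReal ((3 / g + 1) ^ p * x ^ (-(g * p)))
    _ = ∫⁻ x in Set.Ioc (0 : ℝ) 1, ENNReal.ofReal ((3 / g + 1) ^ p * x ^ (-(g * p))) :=
        setLIntegral_congr Ioc_ae_eq_Icc.symm
    _ = _ := by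
        rw [← hval, intervalIntegral.integral_of_le zero_le_one,
          ofReal_integral_eq_lintegral_ofReal
            ((intervalIntegrable_iff_integrableOn_Ioc_of_le zero_le_one).1 hint)]
        refine (ae_restrict_iff' measurableSet_Ioc).2 (ae_of_all _ fun x hx => ?_)
        have := hx.1
        simp only [Pi.zero_apply]
        positivity

/-- The jump transformation of the intermittent map is a full branch map, with constants that are
uniform in the parameter. -/
theorem fullBranchMap_lsvMap (hγ : 0 < γ) {g p : ℝ} (hg : γ ≤ g) (hp : 1 ≤ p) (hgp : g * p < 1) :
    FullBranchMap p (16 * Real.exp 4) ((3 / g + 1) ^ p / (1 - g * p)) (jumpMap (lsvMap γ hγ))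
      (excursionTime (lsvMap γ hγ)) (inverseBranch hγ) (branchWeight γ) := by
  have hγ1 : γ ≤ 1 := by nlinarith
  exact {
    measurable_map := measurable_jumpMap (measurable_lsvMap hγ)
    measurable_time := measurable_excursionTime (measurable_lsvMap hγ)
    one_le_time := fun x => Nat.le_add_left _ _
    contracting := fun a x y => dist_iterate_leftInv_le hγ a x y
    weight_pos := branchWeight_pos hγ
    distortion := branchWeight_le_exp_mul hγ hγ1
    time_branch := fun a z hz => excursionTime_inverseBranch hγ a hz
    duality := fun φ F hφ hF => lintegral_jumpMap_duality hγ hγ1 hφ hF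
    moment := lintegral_excursionTime_rpow_le hγ hg hp hgp }

end LSV

/-! ### Log-Hölder functions -/

/-- Nonnegative functions whose logarithm is Hölder continuous with constant `A`. -/
def LogHolder (η A : ℝ) (g : I → ℝ) : Prop :=
  (∀ x, 0 ≤ g x) ∧ ∀ x y, g x ≤ Real.exp (A * dist x y ^ η) * g y

theorem unitInterval_dist_le_one (x y : I) : dist x y ≤ 1 := by
  have : dist x y = |(x : ℝ) - y| := rfl
  rw [this, abs_le]
  constructor <;> linarith [x.2.1, x.2.2, y.2.1, y.2.2]

theorem unitInterval_dist_rpow_le_one {η : ℝ} (hη : 0 < η) (x y : I) : dist x y ^ η ≤ 1 :=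
  Real.rpow_le_one dist_nonneg (unitInterval_dist_le_one x y) hη.le

theorem unitInterval_dist_le_rpow {η : ℝ} (hη : 0 < η) (hη1 : η ≤ 1) (x y : I) :
    dist x y ≤ dist x y ^ η := by
  rcases (dist_nonneg (x := x) (y := y)).eq_or_lt with h | h
  · rw [← h, Real.zero_rpow hη.ne']
  · conv_lhs => rw [← Real.rpow_one (dist x y)]
    exact Real.rpow_le_rpow_of_exponent_ge h (unitInterval_dist_le_one x y) hη1

namespace LogHolder

variable {η A : ℝ} {g : I → ℝ}

theorem mono (hg : LogHolder η A g) {A' : ℝ} (h : A ≤ A') : LogHolder η A' g := by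
  refine ⟨hg.1, fun x y => (hg.2 x y).trans ?_⟩
  have := hg.1 y
  have : 0 ≤ dist x y ^ η := by positivity
  gcongr

theorem le_exp_mul (hg : LogHolder η A g) (hη : 0 < η) (hA : 0 ≤ A) (x y : I) :
    g x ≤ Real.exp A * g y := by
  refine (hg.2 x y).trans (mul_le_mul_of_nonneg_right (Real.exp_le_exp.2 ?_) (hg.1 y))
  have := unitInterval_dist_rpow_le_one hη x y
  nlinarith

theorem continuous (hg : LogHolder η A g) (hη : 0 < η) : Continuous g := by
  refine continuous_iff_continuousAt.2 fun x => ?_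
  have hd : Continuous fun y : I => dist y x ^ η :=
    (continuous_id.dist continuous_const).rpow_const fun _ => Or.inr hη.le
  have h1 : Tendsto (fun y : I => Real.exp (A * dist y x ^ η) * g x) (𝓝 x) (𝓝 (g x)) := by
    have : Continuous fun y : I => Real.exp (A * dist y x ^ η) * g x := by fun_prop
    simpa [Real.zero_rpow hη.ne'] using this.tendsto x
  have h2 : Tendsto (fun y : I => Real.exp (-(A * dist y x ^ η)) * g x) (𝓝 x) (𝓝 (g x)) := by
    have : Continuous fun y : I => Real.exp (-(A * dist y x ^ η)) * g x := by fun_prop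
    simpa [Real.zero_rpow hη.ne'] using this.tendsto x
  refine tendsto_of_tendsto_of_tendsto_of_le_of_le h2 h1 (fun y => ?_) fun y => hg.2 y x
  have := hg.2 x y
  rw [dist_comm] at this
  dsimp only
  rw [Real.exp_neg, inv_mul_le_iff₀ (Real.exp_pos _)]
  exact this

theorem bddMeas (hg : LogHolder η A g) (hη : 0 < η) (hA : 0 ≤ A) : BddMeas g :=
  ⟨(hg.continuous hη).measurable, Real.exp A * g 0, fun x => by
    rw [abs_of_nonneg (hg.1 x)]; exact hg.le_exp_mul hη hA x 0⟩

theorem le_exp_mul_integral (hg : LogHolder η A g) (hη : 0 < η) (hA : 0 ≤ A) (x : I) :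
    g x ≤ Real.exp A * ∫ y, g y := by
  have hb := (hg.bddMeas hη hA)
  have := integral_mono ((BddMeas.const (g x)).integrable (volume : Measure I))
    ((hb.const_mul (Real.exp A)).integrable volume) (fun y => hg.le_exp_mul hη hA x y)
  rw [integral_const, integral_const_mul] at this
  simpa using this

theorem integral_le_exp_mul (hg : LogHolder η A g) (hη : 0 < η) (hA : 0 ≤ A) (x : I) :
    ∫ y, g y ≤ Real.exp A * g x := by
  have hb := (hg.bddMeas hη hA)
  have := integral_mono (hb.integrable (volume : Measure I))
    ((BddMeas.const (Real.exp A * g x)).integrable volume) (fun y => hg.le_exp_mul hη hA y x)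
  rw [integral_const] at this
  simpa using this

theorem const (hA : 0 ≤ A) {c : ℝ} (hc : 0 ≤ c) : LogHolder η A fun _ => c :=
  ⟨fun _ => hc, fun x y => le_mul_of_one_le_left hc (Real.one_le_exp (by positivity))⟩

/-- Subtracting a small constant from a function in a cone stays in a slightly larger cone. -/
theorem sub_const (hη : 0 < η) {A' c : ℝ} (hA : 0 ≤ A) (hAA' : A < A') (hg : LogHolder η A g)
    (hcg : ∀ y, c ≤ (A' - A) / (A' * Real.exp A') * g y) :
    LogHolder η A' fun x => g x - c := by
  have hA'0 : 0 < A' := by linarith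
  have hE : 1 ≤ Real.exp A' := Real.one_le_exp hA'0.le
  refine ⟨fun x => ?_, fun x y => ?_⟩
  · have h1 := hcg x
    have h2 := hg.1 x
    have : (A' - A) / (A' * Real.exp A') ≤ 1 := by
      rw [div_le_one (by positivity)]
      nlinarith
    nlinarith
  · set t := dist x y ^ η
    have ht0 : 0 ≤ t := by positivity
    have ht1 : t ≤ 1 := unitInterval_dist_rpow_le_one hη x y
    have h1 := hg.2 x y
    have hgy := hg.1 y
    -- The claim reduces to c (exp (A' t) - 1) ≤ (exp (A' t) - exp (A t)) g(y). Both differences are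
    -- compared with multiples of t, which explains the ratio assumed in `hcg`.
    have e1 : Real.exp (A' * t) - 1 ≤ A' * t * Real.exp A' := by
      have l1 := Real.add_one_le_exp (-(A' * t))
      have l2 : Real.exp (A' * t) ≤ Real.exp A' := Real.exp_le_exp.2 (by nlinarith)
      have l3 : Real.exp (A' * t) * Real.exp (-(A' * t)) = 1 := by rw [← Real.exp_add]; simp
      have l4 := Real.exp_pos (A' * t)
      have l5 : 0 ≤ A' * t := by positivity
      nlinarith
    have e2 : (A' - A) * t ≤ Real.exp (A' * t) - Real.exp (A * t) := by
      have l1 := Real.add_one_le_exp ((A' - A) * t)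
      have l2 : Real.exp (A' * t) = Real.exp (A * t) * Real.exp ((A' - A) * t) := by
        rw [← Real.exp_add]; congr 1; ring
      have l3 : 1 ≤ Real.exp (A * t) := Real.one_le_exp (by positivity)
      have l4 : 0 ≤ (A' - A) * t := mul_nonneg (by linarith) ht0
      rw [l2]; nlinarith
    have e3 : c * (Real.exp (A' * t) - 1) ≤ (A' - A) * t * g y := by
      have hq : 0 ≤ (A' - A) / (A' * Real.exp A') := div_nonneg (by linarith) (by positivity)
      have hX : 0 ≤ Real.exp (A' * t) - 1 := by
        have := Real.one_le_exp (show 0 ≤ A' * t by positivity); linarith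
      calc c * (Real.exp (A' * t) - 1)
          ≤ ((A' - A) / (A' * Real.exp A') * g y) * (A' * t * Real.exp A') :=
            mul_le_mul (hcg y) e1 hX (by positivity)
        _ = (A' - A) * t * g y := by field_simp
    have e4 := mul_le_mul_of_nonneg_right e2 hgy
    nlinarith

end LogHolder

/-! ### The transfer operator of a full branch map -/

/-- The sum `∑ a, ρ a z * c a z` over the branches. -/
noncomputable def branchSum (ρ : ℕ → I → ℝ) (c : ℕ → I → ℝ) (z : I) : ℝ := ∑' a, ρ a z * c a z

/-- The transfer operator with respect to Lebesgue measure. -/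
noncomputable def transfer (ρ : ℕ → I → ℝ) (ψ : ℕ → I → I) (g : I → ℝ) : I → ℝ :=
  branchSum ρ fun a z => g (ψ a z)

namespace FullBranchMap

variable {p D K : ℝ} {G : I → I} {τ : I → ℕ} {ψ : ℕ → I → I} {ρ : ℕ → I → ℝ}

theorem logHolder_weight (h : FullBranchMap p D K G τ ψ ρ) (a : ℕ) : LogHolder 1 D (ρ a) :=
  ⟨fun z => (h.weight_pos a z).le, fun x y => by rw [Real.rpow_one]; exact h.distortion a x y⟩

theorem measurable_weight (h : FullBranchMap p D K G τ ψ ρ) (a : ℕ) : Measurable (ρ a) :=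
  ((h.logHolder_weight a).continuous one_pos).measurable

theorem measurable_time_rpow (h : FullBranchMap p D K G τ ψ ρ) (s : ℝ) :
    Measurable fun x => (τ x : ℝ) ^ s :=
  (measurable_from_top.comp h.measurable_time).pow_const s

/-- Duality against the constant 1 identifies the integral of this series with the p-th moment of τ.
Distortion compares the series at z with its value at any w, and averaging over w makes the bound
pointwise. -/
theorem tsum_weight_le (h : FullBranchMap p D K G τ ψ ρ) (hD : 0 ≤ D) (z : I) :
    ∑' a, ENNReal.ofReal (ρ a z * ((a : ℝ) + 1) ^ p) ≤ ENNReal.ofReal (Real.exp D * K) := by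
  have hdual := h.duality (fun _ => 1) (fun x => ENNReal.ofReal ((τ x : ℝ) ^ p)) measurable_const
    (h.measurable_time_rpow p).ennreal_ofReal
  simp only [one_mul] at hdual
  have hbr : ∫⁻ w : I, ∑' a, ENNReal.ofReal (ρ a w * ((a : ℝ) + 1) ^ p) ≤ ENNReal.ofReal K := by
    refine le_trans (le_of_eq ?_) h.moment
    rw [hdual]
    refine lintegral_congr_ae ?_
    filter_upwards [ae_mem_Ioo_unitInterval] with w hw
    refine tsum_congr fun a => ?_
    rw [h.time_branch a w hw.2, ENNReal.ofReal_mul (h.weight_pos a w).le]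
    push_cast
    rfl
  have hpt : ∀ w : I, ∑' a, ENNReal.ofReal (ρ a z * ((a : ℝ) + 1) ^ p)
      ≤ ENNReal.ofReal (Real.exp D) * ∑' a, ENNReal.ofReal (ρ a w * ((a : ℝ) + 1) ^ p) := by
    intro w
    rw [← ENNReal.tsum_mul_left]
    refine ENNReal.tsum_le_tsum fun a => ?_
    rw [← ENNReal.ofReal_mul (Real.exp_pos _).le, ← mul_assoc]
    refine ENNReal.ofReal_le_ofReal (mul_le_mul_of_nonneg_right ?_ (by positivity))
    exact (h.logHolder_weight a).le_exp_mul one_pos hD z w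
  calc ∑' a, ENNReal.ofReal (ρ a z * ((a : ℝ) + 1) ^ p)
      = ∫⁻ _w : I, ∑' a, ENNReal.ofReal (ρ a z * ((a : ℝ) + 1) ^ p) := by simp
    _ ≤ ∫⁻ w : I, ENNReal.ofReal (Real.exp D) * ∑' a, ENNReal.ofReal (ρ a w * ((a : ℝ) + 1) ^ p) :=
        lintegral_mono hpt
    _ = ENNReal.ofReal (Real.exp D) * ∫⁻ w : I, ∑' a, ENNReal.ofReal (ρ a w * ((a : ℝ) + 1) ^ p) := by
        refine lintegral_const_mul _ (Measurable.tsum fun a => ?_)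
        exact ((h.measurable_weight a).mul_const _).ennreal_ofReal
    _ ≤ ENNReal.ofReal (Real.exp D) * ENNReal.ofReal K := by gcongr
    _ = _ := (ENNReal.ofReal_mul (Real.exp_pos _).le).symm

theorem one_le_moment (h : FullBranchMap p D K G τ ψ ρ) (hp : 0 ≤ p) : 1 ≤ K := by
  have h1 : (1 : ℝ≥0∞) ≤ ENNReal.ofReal K := by
    refine le_trans ?_ h.moment
    calc (1 : ℝ≥0∞) = ∫⁻ _x : I, 1 := by simp
      _ ≤ _ := lintegral_mono fun x => by
        rw [ENNReal.one_le_ofReal]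
        exact Real.one_le_rpow (by exact_mod_cast h.one_le_time x) hp
  exact ENNReal.one_le_ofReal.1 h1

theorem summable_weight (h : FullBranchMap p D K G τ ψ ρ) (hp : 1 ≤ p) (hD : 0 ≤ D) (z : I) :
    Summable (fun a => ρ a z * ((a : ℝ) + 1)) ∧
      ∑' a, ρ a z * ((a : ℝ) + 1) ≤ Real.exp D * K := by
  have hK := h.one_le_moment (by linarith)
  have h0 : ∀ a : ℕ, 0 ≤ ρ a z * ((a : ℝ) + 1) := fun a => by have := h.weight_pos a z; positivity
  have h1 : ∑' a, ENNReal.ofReal (ρ a z * ((a : ℝ) + 1)) ≤ ENNReal.ofReal (Real.exp D * K) := by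
    refine le_trans (ENNReal.tsum_le_tsum fun a => ENNReal.ofReal_le_ofReal ?_) (h.tsum_weight_le hD z)
    refine mul_le_mul_of_nonneg_left ?_ (h.weight_pos a z).le
    conv_lhs => rw [← Real.rpow_one ((a : ℝ) + 1)]
    exact Real.rpow_le_rpow_of_exponent_le (by linarith [Nat.cast_nonneg (α := ℝ) a]) hp
  have hs : Summable (fun a => ρ a z * ((a : ℝ) + 1)) := by
    have := ENNReal.summable_toReal (h1.trans_lt ENNReal.ofReal_lt_top).ne
    refine this.congr fun a => ENNReal.toReal_ofReal (h0 a)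
  refine ⟨hs, ?_⟩
  rw [← ENNReal.ofReal_tsum_of_nonneg h0 hs, ENNReal.ofReal_le_ofReal_iff (by positivity)] at h1
  exact h1

theorem summable_branch (h : FullBranchMap p D K G τ ψ ρ) (hp : 1 ≤ p) (hD : 0 ≤ D) {c : ℕ → I → ℝ}
    {M : ℝ} (z : I) (hc : ∀ a, |c a z| ≤ M * ((a : ℝ) + 1)) : Summable fun a => ρ a z * c a z := by
  refine Summable.of_norm_bounded ((h.summable_weight hp hD z).1.mul_left M) fun a => ?_
  have := h.weight_pos a z
  rw [Real.norm_eq_abs, abs_mul, abs_of_pos this]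
  nlinarith [mul_le_mul_of_nonneg_left (hc a) this.le]

theorem abs_branchSum_le (h : FullBranchMap p D K G τ ψ ρ) (hp : 1 ≤ p) (hD : 0 ≤ D) {c : ℕ → I → ℝ}
    {M : ℝ} (hM : 0 ≤ M) (z : I) (hc : ∀ a, |c a z| ≤ M * ((a : ℝ) + 1)) :
    |branchSum ρ c z| ≤ M * (Real.exp D * K) := by
  have hs := (h.summable_weight hp hD z).1.mul_left M
  have hb : ∀ a, ‖ρ a z * c a z‖ ≤ M * (ρ a z * ((a : ℝ) + 1)) := fun a => by
    have := h.weight_pos a z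
    rw [Real.norm_eq_abs, abs_mul, abs_of_pos this]
    nlinarith [mul_le_mul_of_nonneg_left (hc a) this.le]
  have := tsum_of_norm_bounded hs.hasSum hb
  rw [tsum_mul_left] at this
  exact this.trans (mul_le_mul_of_nonneg_left (h.summable_weight hp hD z).2 hM)

theorem abs_le_mul_add_one {g : I → ℝ} {C : ℝ} (hg : ∀ x, |g x| ≤ C) (a : ℕ) (x : I) :
    |g x| ≤ C * ((a : ℝ) + 1) := by
  have h0 := (abs_nonneg _).trans (hg x)
  have := hg x
  have : (0 : ℝ) ≤ a := a.cast_nonneg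
  nlinarith

/-- Logarithmic constants add under products and are preserved by sums of nonnegative terms. The
linear growth allowed in a is what excursion sums require. -/
theorem logHolder_branchSum (h : FullBranchMap p D K G τ ψ ρ) (hp : 1 ≤ p) (hD : 0 ≤ D) {η A : ℝ}
    (hη : 0 < η) (hη1 : η ≤ 1) {c : ℕ → I → ℝ} {M : ℝ} (hc : ∀ a, LogHolder η A (c a))
    (hM : ∀ a z, |c a z| ≤ M * ((a : ℝ) + 1)) : LogHolder η (D + A) (branchSum ρ c) := by
  refine ⟨fun z => tsum_nonneg fun a => mul_nonneg (h.weight_pos a z).le ((hc a).1 z), fun x y => ?_⟩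
  have hsx := h.summable_branch hp hD x (hM · x)
  have hsy := h.summable_branch hp hD y (hM · y)
  rw [branchSum, branchSum, ← tsum_mul_left]
  refine hsx.tsum_le_tsum (fun a => ?_) (hsy.mul_left _)
  have h1 := h.distortion a x y
  have h2 := (hc a).2 x y
  have h3 : Real.exp (D * dist x y) ≤ Real.exp (D * dist x y ^ η) :=
    Real.exp_le_exp.2 (mul_le_mul_of_nonneg_left (unitInterval_dist_le_rpow hη hη1 x y) hD)
  have h4 := h.weight_pos a y
  have h5 := (hc a).1 y
  calc ρ a x * c a x
      ≤ (Real.exp (D * dist x y ^ η) * ρ a y) * (Real.exp (A * dist x y ^ η) * c a y) := by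
        refine mul_le_mul (h1.trans (by gcongr)) h2 ((hc a).1 x) (by positivity)
    _ = Real.exp ((D + A) * dist x y ^ η) * (ρ a y * c a y) := by
        rw [add_mul, Real.exp_add]; ring

theorem logHolder_comp_branch (h : FullBranchMap p D K G τ ψ ρ) {η A : ℝ} (hη : 0 < η) (hA : 0 ≤ A)
    {g : I → ℝ} (hg : LogHolder η A g) (a : ℕ) :
    LogHolder η ((1 / 2) ^ η * A) (fun z => g (ψ a z)) := by
  refine ⟨fun z => hg.1 _, fun x y => (hg.2 (ψ a x) (ψ a y)).trans ?_⟩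
  refine mul_le_mul_of_nonneg_right (Real.exp_le_exp.2 ?_) (hg.1 _)
  have : dist (ψ a x) (ψ a y) ^ η ≤ (1 / 2) ^ η * dist x y ^ η := by
    rw [← Real.mul_rpow (by norm_num) dist_nonneg]
    refine Real.rpow_le_rpow dist_nonneg ?_ hη.le
    have := h.contracting a x y
    linarith
  nlinarith

/-- A Lasota–Yorke inequality for cones: contraction of the branches shrinks A, and distortion of
the weights adds D. -/
theorem logHolder_transfer (h : FullBranchMap p D K G τ ψ ρ) (hp : 1 ≤ p) (hD : 0 ≤ D) {η A : ℝ}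
    (hη : 0 < η) (hη1 : η ≤ 1) (hA : 0 ≤ A) {g : I → ℝ} (hg : LogHolder η A g) :
    LogHolder η (D + (1 / 2) ^ η * A) (transfer ρ ψ g) := by
  obtain ⟨C, hC⟩ := (hg.bddMeas hη hA).2
  exact h.logHolder_branchSum hp hD hη hη1 (fun a => h.logHolder_comp_branch hη hA hg a)
    (fun a z => abs_le_mul_add_one hC a _)

theorem integrable_time (h : FullBranchMap p D K G τ ψ ρ) (hp : 1 ≤ p) :
    Integrable (fun x => (τ x : ℝ)) := by
  have hm : Measurable fun x => (τ x : ℝ) := measurable_from_top.comp h.measurable_time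
  refine ⟨hm.aestronglyMeasurable, ?_⟩
  rw [hasFiniteIntegral_iff_ofReal (ae_of_all _ fun x => Nat.cast_nonneg _)]
  refine lt_of_le_of_lt (lintegral_mono fun x => ENNReal.ofReal_le_ofReal ?_)
    (h.moment.trans_lt ENNReal.ofReal_lt_top)
  conv_lhs => rw [← Real.rpow_one (τ x : ℝ)]
  exact Real.rpow_le_rpow_of_exponent_le (by exact_mod_cast h.one_le_time x) hp

theorem integral_time_le (h : FullBranchMap p D K G τ ψ ρ) (hp : 1 ≤ p) :
    ∫ x, (τ x : ℝ) ≤ K := by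
  have hK := h.one_le_moment (by linarith)
  rw [← ENNReal.ofReal_le_ofReal_iff (by linarith),
    ofReal_integral_eq_lintegral_ofReal (h.integrable_time hp) (ae_of_all _ fun x => Nat.cast_nonneg _)]
  refine le_trans (lintegral_mono fun x => ENNReal.ofReal_le_ofReal ?_) h.moment
  conv_lhs => rw [← Real.rpow_one (τ x : ℝ)]
  exact Real.rpow_le_rpow_of_exponent_le (by exact_mod_cast h.one_le_time x) hp

/-- Duality for nonnegative F that may grow like τ and is known on the branches only away from the
end point. For nonnegative φ it is the `duality` field; a signed φ is shifted by a constant. -/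
theorem integral_mul_branchSum (h : FullBranchMap p D K G τ ψ ρ) (hp : 1 ≤ p) (hD : 0 ≤ D)
    {c : ℕ → I → ℝ} {F : I → ℝ} {M : ℝ} (hc0 : ∀ a z, 0 ≤ c a z)
    (hcM : ∀ a z, c a z ≤ M * ((a : ℝ) + 1)) (hcm : BddMeas (branchSum ρ c))
    (hFm : Measurable F) (hF0 : ∀ x, 0 ≤ F x) (hFM : ∀ x, F x ≤ M * τ x)
    (hFc : ∀ a (z : I), (z : ℝ) < 1 → F (ψ a z) = c a z) {φ : I → ℝ} (hφ : BddMeas φ) :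
    ∫ x, φ (G x) * F x = ∫ z, φ z * branchSum ρ c z := by
  have hFi : Integrable F := by
    refine ((h.integrable_time hp).const_mul M).mono' hFm.aestronglyMeasurable (ae_of_all _ fun x => ?_)
    rw [Real.norm_eq_abs, abs_of_nonneg (hF0 x)]
    exact hFM x
  have hfi : ∀ φ : I → ℝ, BddMeas φ → Integrable fun x => φ (G x) * F x := fun φ hφ => by
    obtain ⟨C, hC⟩ := hφ.2
    exact hFi.bdd_mul (hφ.1.comp h.measurable_map).aestronglyMeasurable (ae_of_all _ fun x => hC (G x))
  have hgi : ∀ φ : I → ℝ, BddMeas φ → Integrable fun z => φ z * branchSum ρ c z := fun φ hφ =>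
    (hφ.mul hcm).integrable volume
  have pos : ∀ φ : I → ℝ, BddMeas φ → (∀ x, 0 ≤ φ x) →
      ∫ x, φ (G x) * F x = ∫ z, φ z * branchSum ρ c z := by
    intro φ hφ hφ0
    have hb0 : ∀ z, 0 ≤ branchSum ρ c z := fun z =>
      tsum_nonneg fun a => mul_nonneg (h.weight_pos a z).le (hc0 a z)
    rw [integral_eq_lintegral_of_nonneg_ae (ae_of_all _ fun x => mul_nonneg (hφ0 _) (hF0 x))
        (hfi φ hφ).aestronglyMeasurable,
      integral_eq_lintegral_of_nonneg_ae (ae_of_all _ fun x => mul_nonneg (hφ0 _) (hb0 x))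
        (hgi φ hφ).aestronglyMeasurable]
    congr 1
    have e1 : ∀ x, ENNReal.ofReal (φ (G x) * F x)
        = ENNReal.ofReal (φ (G x)) * ENNReal.ofReal (F x) := fun x => ENNReal.ofReal_mul (hφ0 _)
    simp only [e1]
    rw [h.duality (fun x => ENNReal.ofReal (φ x)) _ hφ.1.ennreal_ofReal hFm.ennreal_ofReal]
    refine lintegral_congr_ae ?_
    filter_upwards [ae_mem_Ioo_unitInterval] with z hz
    rw [ENNReal.ofReal_mul (hφ0 z), branchSum, ENNReal.ofReal_tsum_of_nonneg
      (fun a => mul_nonneg (h.weight_pos a z).le (hc0 a z))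
      (h.summable_branch (M := M) hp hD z fun a => by rw [abs_of_nonneg (hc0 a z)]; exact hcM a z)]
    congr 1
    refine tsum_congr fun a => ?_
    rw [ENNReal.ofReal_mul (h.weight_pos a z).le, hFc a z hz.2]
  obtain ⟨C, hC⟩ := hφ.2
  have h1 := pos (fun x => φ x + C) (hφ.add (BddMeas.const C))
    (fun x => by have := neg_le_of_abs_le (hC x); linarith)
  have h2 := pos (fun _ => C) (BddMeas.const C) (fun x => (abs_nonneg _).trans (hC x))
  simp only [add_mul] at h1
  rw [integral_add (hfi φ hφ) (hfi _ (BddMeas.const C)),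
    integral_add (hgi φ hφ) (hgi _ (BddMeas.const C)), h2] at h1
  linarith

theorem integral_mul_transfer (h : FullBranchMap p D K G τ ψ ρ) (hp : 1 ≤ p) (hD : 0 ≤ D) {η A : ℝ}
    (hη : 0 < η) (hη1 : η ≤ 1) (hA : 0 ≤ A) {g : I → ℝ} (hg : LogHolder η A g) {φ : I → ℝ}
    (hφ : BddMeas φ) : ∫ x, φ (G x) * g x = ∫ z, φ z * transfer ρ ψ g z := by
  obtain ⟨C, hC⟩ := (hg.bddMeas hη hA).2
  have hle : ∀ (a : ℕ) x, g x ≤ C * ((a : ℝ) + 1) := fun a x =>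
    (le_abs_self _).trans (abs_le_mul_add_one hC a x)
  refine h.integral_mul_branchSum hp hD (M := C) (fun a z => hg.1 _) (fun a z => hle a _)
    ((h.logHolder_transfer hp hD hη hη1 hA hg).bddMeas hη (by positivity)) (hg.continuous hη).measurable
    hg.1 (fun x => ?_) (fun a z _ => rfl) hφ
  have h1 : (1 : ℝ) ≤ τ x := by exact_mod_cast h.one_le_time x
  have h2 := (le_abs_self _).trans (hC x)
  have h3 := (abs_nonneg _).trans (hC x)
  nlinarith

theorem integral_transfer (h : FullBranchMap p D K G τ ψ ρ) (hp : 1 ≤ p) (hD : 0 ≤ D) {η A : ℝ}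
    (hη : 0 < η) (hη1 : η ≤ 1) (hA : 0 ≤ A) {g : I → ℝ} (hg : LogHolder η A g) :
    ∫ z, transfer ρ ψ g z = ∫ x, g x := by
  have := h.integral_mul_transfer hp hD hη hη1 hA hg (BddMeas.const 1)
  simpa using this.symm

theorem exists_bound_iterate_transfer (h : FullBranchMap p D K G τ ψ ρ) (hp : 1 ≤ p) (hD : 0 ≤ D)
    {g : I → ℝ} (hg : ∃ C, ∀ x, |g x| ≤ C) (n : ℕ) : ∃ C, ∀ x, |(transfer ρ ψ)^[n] g x| ≤ C := by
  induction n with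
  | zero => exact hg
  | succ n ih =>
    obtain ⟨C, hC⟩ := ih
    rw [Function.iterate_succ_apply']
    exact ⟨C * (Real.exp D * K), fun z => h.abs_branchSum_le hp hD
      ((abs_nonneg _).trans (hC 0)) z fun a => abs_le_mul_add_one hC a _⟩

/-- Boundedness is needed for additivity, since the operator is defined by an unconditional sum that
defaults to 0 when divergent. -/
theorem iterate_transfer_add (h : FullBranchMap p D K G τ ψ ρ) (hp : 1 ≤ p) (hD : 0 ≤ D)
    {f g : I → ℝ} (hf : ∃ C, ∀ x, |f x| ≤ C) (hg : ∃ C, ∀ x, |g x| ≤ C) (n : ℕ) :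
    (transfer ρ ψ)^[n] (fun x => f x + g x)
      = fun x => (transfer ρ ψ)^[n] f x + (transfer ρ ψ)^[n] g x := by
  induction n with
  | zero => rfl
  | succ n ih =>
    rw [Function.iterate_succ_apply', ih]
    simp only [Function.iterate_succ_apply']
    obtain ⟨C, hC⟩ := h.exists_bound_iterate_transfer hp hD hf n
    obtain ⟨C', hC'⟩ := h.exists_bound_iterate_transfer hp hD hg n
    funext z
    simp only [transfer, branchSum]
    have s1 := h.summable_branch (c := fun a z => (transfer ρ ψ)^[n] f (ψ a z)) hp hD z
      fun a => abs_le_mul_add_one hC a (ψ a z)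
    have s2 := h.summable_branch (c := fun a z => (transfer ρ ψ)^[n] g (ψ a z)) hp hD z
      fun a => abs_le_mul_add_one hC' a (ψ a z)
    rw [← s1.tsum_add s2]
    exact tsum_congr fun a => mul_add _ _ _

theorem transfer_const_mul (c : ℝ) (g : I → ℝ) :
    transfer ρ ψ (fun x => c * g x) = fun x => c * transfer ρ ψ g x := by
  funext z
  simp only [transfer, branchSum]
  rw [← tsum_mul_left]
  exact tsum_congr fun a => by ring

theorem iterate_transfer_const_mul (c : ℝ) (g : I → ℝ) (n : ℕ) :
    (transfer ρ ψ)^[n] (fun x => c * g x) = fun x => c * (transfer ρ ψ)^[n] g x := by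
  induction n with
  | zero => rfl
  | succ n ih => rw [Function.iterate_succ_apply', ih, transfer_const_mul]; simp only [Function.iterate_succ_apply']

end FullBranchMap

/-! ### Cone contraction and the invariant density -/

/-- The size of the invariant cone of log-Hölder functions. -/
noncomputable def coneConst (D η : ℝ) : ℝ := (D + 1) / (1 - (1 / 2) ^ η)

/-- The rate of contraction on the invariant cone. -/
noncomputable def coneRate (D η : ℝ) : ℝ :=
  1 - 1 / (coneConst D η * Real.exp (coneConst D η)) * Real.exp (-coneConst D η)

section Cone

variable {D η : ℝ}

theorem half_rpow_lt_one (hη : 0 < η) : (1 / 2 : ℝ) ^ η < 1 :=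
  Real.rpow_lt_one (by norm_num) (by norm_num) hη

/-- The transfer operator maps the cone into one smaller by exactly 1. This unit of slack allows a
constant to be subtracted, and later leaves room for the Hölder variation of an observable. -/
theorem coneConst_eq (hη : 0 < η) : D + (1 / 2) ^ η * coneConst D η = coneConst D η - 1 := by
  have := half_rpow_lt_one hη
  have h : 1 - (1 / 2 : ℝ) ^ η ≠ 0 := by linarith
  have : coneConst D η * (1 - (1 / 2 : ℝ) ^ η) = D + 1 := div_mul_cancel₀ _ h
  linarith

theorem one_le_coneConst (hη : 0 < η) (hD : 0 ≤ D) : 1 ≤ coneConst D η := by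
  have := half_rpow_lt_one hη
  have h0 : (0 : ℝ) < (1 / 2) ^ η := by positivity
  rw [coneConst, le_div_iff₀ (by linarith)]
  linarith

theorem coneRate_nonneg (hη : 0 < η) (hD : 0 ≤ D) : 0 ≤ coneRate D η := by
  have h1 := one_le_coneConst hη hD
  have h2 := Real.one_le_exp (show 0 ≤ coneConst D η by linarith)
  have h3 : 1 / (coneConst D η * Real.exp (coneConst D η)) ≤ 1 := by
    rw [div_le_one (by positivity)]; nlinarith
  have h4 : Real.exp (-coneConst D η) ≤ 1 := Real.exp_le_one_iff.2 (by linarith)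
  have h5 := Real.exp_pos (-coneConst D η)
  rw [coneRate]
  nlinarith

theorem coneRate_lt_one (hη : 0 < η) (hD : 0 ≤ D) : coneRate D η < 1 := by
  have h1 := one_le_coneConst hη hD
  have : 0 < 1 / (coneConst D η * Real.exp (coneConst D η)) * Real.exp (-coneConst D η) := by positivity
  rw [coneRate]; linarith

end Cone

theorem tendsto_integral_mul_of_bounded {f : ℕ → I → ℝ} {g w : I → ℝ} {C : ℝ}
    (hf : ∀ n, Measurable (f n)) (hC : ∀ n x, |f n x| ≤ C) (hg : ∀ x, Tendsto (f · x) atTop (𝓝 (g x)))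
    (hw : BddMeas w) :
    Tendsto (fun n => ∫ x, w x * f n x) atTop (𝓝 (∫ x, w x * g x)) := by
  obtain ⟨B, hB⟩ := hw.2
  refine tendsto_integral_of_dominated_convergence (fun _ => B * C)
    (fun n => (hw.1.mul (hf n)).aestronglyMeasurable) (integrable_const _)
    (fun n => ae_of_all _ fun x => ?_) (ae_of_all _ fun x => (hg x).const_mul _)
  rw [Real.norm_eq_abs, abs_mul]
  exact mul_le_mul (hB x) (hC n x) (abs_nonneg _) ((abs_nonneg _).trans (hB x))

theorem LogHolder.of_tendsto {η A : ℝ} {f : ℕ → I → ℝ} {g : I → ℝ} (hf : ∀ n, LogHolder η A (f n))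
    (hg : ∀ x, Tendsto (f · x) atTop (𝓝 (g x))) : LogHolder η A g :=
  ⟨fun x => ge_of_tendsto' (hg x) fun n => (hf n).1 x,
    fun x y => le_of_tendsto_of_tendsto' (hg x) ((hg y).const_mul _) fun n => (hf n).2 x y⟩

namespace FullBranchMap

variable {p D K : ℝ} {G : I → I} {τ : I → ℕ} {ψ : ℕ → I → I} {ρ : ℕ → I → ℝ} {η : ℝ}

theorem logHolder_transfer_cone (h : FullBranchMap p D K G τ ψ ρ) (hp : 1 ≤ p) (hD : 0 ≤ D)
    (hη : 0 < η) (hη1 : η ≤ 1) {g : I → ℝ} (hg : LogHolder η (coneConst D η) g) :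
    LogHolder η (coneConst D η - 1) (transfer ρ ψ g) := by
  have := h.logHolder_transfer hp hD hη hη1 (by linarith [one_le_coneConst hη hD]) hg
  rwa [coneConst_eq hη] at this

theorem logHolder_iterate_transfer (h : FullBranchMap p D K G τ ψ ρ) (hp : 1 ≤ p) (hD : 0 ≤ D)
    (hη : 0 < η) (hη1 : η ≤ 1) {g : I → ℝ} (hg : LogHolder η (coneConst D η) g) (n : ℕ) :
    LogHolder η (coneConst D η) ((transfer ρ ψ)^[n] g) := by
  induction n with
  | zero => exact hg
  | succ n ih =>
    rw [Function.iterate_succ_apply']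
    exact (h.logHolder_transfer_cone hp hD hη hη1 ih).mono (by linarith)

theorem integral_iterate_mul (h : FullBranchMap p D K G τ ψ ρ) (hp : 1 ≤ p) (hD : 0 ≤ D)
    (hη : 0 < η) (hη1 : η ≤ 1) {g : I → ℝ} (hg : LogHolder η (coneConst D η) g) {φ : I → ℝ}
    (hφ : BddMeas φ) (n : ℕ) :
    ∫ x, φ (G^[n] x) * g x = ∫ z, φ z * (transfer ρ ψ)^[n] g z := by
  induction n generalizing g with
  | zero => rfl
  | succ n ih =>
    simp only [Function.iterate_succ_apply]
    rw [← ih ((h.logHolder_transfer_cone hp hD hη hη1 hg).mono (by linarith))]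
    exact h.integral_mul_transfer hp hD hη hη1 (by linarith [one_le_coneConst hη hD]) hg
      (hφ.comp (h.measurable_map.iterate n))

/-- Exponential contraction of the transfer operator on the cone. -/
theorem abs_iterate_transfer_sub_le (h : FullBranchMap p D K G τ ψ ρ) (hp : 1 ≤ p) (hD : 0 ≤ D)
    (hη : 0 < η) (hη1 : η ≤ 1) (n : ℕ) {g₁ g₂ : I → ℝ} {M : ℝ}
    (hg₁ : LogHolder η (coneConst D η) g₁) (hg₂ : LogHolder η (coneConst D η) g₂)
    (h₁ : ∫ x, g₁ x = M) (h₂ : ∫ x, g₂ x = M) (z : I) :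
    |(transfer ρ ψ)^[n] g₁ z - (transfer ρ ψ)^[n] g₂ z|
      ≤ coneRate D η ^ n * (Real.exp (coneConst D η) * M) := by
  have hA1 := one_le_coneConst hη hD
  set A := coneConst D η with hA
  have hA0 : 0 ≤ A := by linarith
  set ε : ℝ := 1 / (A * Real.exp A) * Real.exp (-A) with hε
  have hrate : coneRate D η = 1 - ε := rfl
  have hε0 : 0 < ε := by positivity
  induction n generalizing g₁ g₂ M with
  | zero =>
    have a1 := hg₁.le_exp_mul_integral hη hA0 z
    have a2 := hg₂.le_exp_mul_integral hη hA0 z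
    have a3 := hg₁.1 z
    have a4 := hg₂.1 z
    rw [h₁] at a1
    rw [h₂] at a2
    simp only [Function.iterate_zero, id, pow_zero, one_mul]
    rw [abs_le]
    constructor <;> linarith
  | succ n ih =>
    -- A coupling argument: after one application of the operator the same constant ε * M is removed
    -- from both functions. The remainders stay in the cone with mass multiplied by 1 - ε, and the
    -- constants cancel in the difference.
    have key : ∀ g : I → ℝ, LogHolder η A g → ∫ x, g x = M →
        LogHolder η A (fun x => transfer ρ ψ g x - ε * M) ∧
        ∫ x, (transfer ρ ψ g x - ε * M) = coneRate D η * M ∧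
        (transfer ρ ψ)^[n + 1] g = fun x => (transfer ρ ψ)^[n] (fun x => transfer ρ ψ g x - ε * M) x
          + (transfer ρ ψ)^[n] (fun _ => ε * M) x := by
      intro g hg hgM
      have hT := h.logHolder_transfer_cone hp hD hη hη1 hg
      have hTA : LogHolder η A (transfer ρ ψ g) := hT.mono (by linarith)
      have hTi := h.integral_transfer hp hD hη hη1 hA0 hg
      rw [hgM] at hTi
      have hcone : LogHolder η A (fun x => transfer ρ ψ g x - ε * M) := by
        refine hT.sub_const hη (by linarith) (by linarith) fun y => ?_
        have h3 := hTA.integral_le_exp_mul hη hA0 y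
        rw [hTi] at h3
        rw [← hA, show A - (A - 1) = 1 by ring, hε, mul_assoc]
        refine mul_le_mul_of_nonneg_left ?_ (by positivity)
        rw [Real.exp_neg, inv_mul_le_iff₀ (Real.exp_pos _)]
        exact h3
      refine ⟨hcone, ?_, ?_⟩
      · rw [integral_sub ((hTA.bddMeas hη hA0).integrable volume)
          ((BddMeas.const _).integrable volume), hTi, integral_const, hrate]
        simp; ring
      · rw [← h.iterate_transfer_add hp hD (hcone.bddMeas hη hA0).2 (BddMeas.const _).2,
          Function.iterate_succ_apply]
        simp
    obtain ⟨c1, i1, e1⟩ := key g₁ hg₁ h₁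
    obtain ⟨c2, i2, e2⟩ := key g₂ hg₂ h₂
    rw [e1, e2, add_sub_add_right_eq_sub]
    refine (ih (hg₁ := c1) (hg₂ := c2) i1 i2).trans (le_of_eq ?_)
    rw [pow_succ]; ring

/-- The invariant density of a full branch map, with exponential convergence to it. -/
theorem exists_invariant_density (h : FullBranchMap p D K G τ ψ ρ) (hp : 1 ≤ p) (hD : 0 ≤ D)
    (hη : 0 < η) (hη1 : η ≤ 1) : ∃ f : I → ℝ, LogHolder η (coneConst D η) f ∧ ∫ x, f x = 1 ∧
      (∀ φ : I → ℝ, BddMeas φ → ∫ x, φ (G x) * f x = ∫ x, φ x * f x) ∧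
      ∀ x, Tendsto (fun n => (transfer ρ ψ)^[n] (fun _ => 1) x) atTop (𝓝 (f x)) := by
  have hA1 := one_le_coneConst hη hD
  set A := coneConst D η with hA
  have hA0 : 0 ≤ A := by linarith
  have hθ1 := coneRate_lt_one hη hD
  have h1 : LogHolder η A (fun _ => (1 : ℝ)) := LogHolder.const hA0 zero_le_one
  have hn := h.logHolder_iterate_transfer hp hD hη hη1 h1
  have hi1 : ∫ _x : I, (1 : ℝ) = 1 := by simp
  have hi2 : ∫ x : I, transfer ρ ψ (fun _ => (1 : ℝ)) x = 1 := by
    rw [h.integral_transfer hp hD hη hη1 hA0 h1, hi1]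
  have hin : ∀ n, ∫ x : I, (transfer ρ ψ)^[n] (fun _ => (1 : ℝ)) x = 1 := fun n => by
    have := h.integral_iterate_mul hp hD hη hη1 h1 (BddMeas.const 1) n
    simpa using this.symm
  -- Consecutive iterates are the n-th iterates of 1 and of its image, which both lie in the cone
  -- and have mass 1.
  have hcauchy : ∀ x, CauchySeq fun n => (transfer ρ ψ)^[n] (fun _ => (1 : ℝ)) x := fun x => by
    refine cauchySeq_of_le_geometric (coneRate D η) (Real.exp A * 1) hθ1 fun n => ?_
    have := h.abs_iterate_transfer_sub_le hp hD hη hη1 n h1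
      ((h.logHolder_transfer_cone hp hD hη hη1 h1).mono (by linarith)) hi1 hi2 x
    rw [Real.dist_eq, Function.iterate_succ_apply, mul_comm]
    exact this
  choose f hf using fun x => cauchySeq_tendsto_of_complete (hcauchy x)
  have hbd : ∀ n x, |(transfer ρ ψ)^[n] (fun _ => (1 : ℝ)) x| ≤ Real.exp A := fun n x => by
    rw [abs_of_nonneg ((hn n).1 x)]
    have := (hn n).le_exp_mul_integral hη hA0 x
    rwa [hin n, mul_one] at this
  have hm := fun n => ((hn n).continuous hη).measurable
  refine ⟨f, LogHolder.of_tendsto hn hf, ?_, fun φ hφ => ?_, hf⟩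
  · have := tendsto_integral_mul_of_bounded hm hbd hf (BddMeas.const 1)
    simp only [one_mul, hin] at this
    exact tendsto_nhds_unique this tendsto_const_nhds
  · have t1 := tendsto_integral_mul_of_bounded hm hbd hf (hφ.comp h.measurable_map)
    have t2 := (tendsto_integral_mul_of_bounded hm hbd hf hφ).comp (tendsto_add_atTop_nat 1)
    refine tendsto_nhds_unique t1 (t2.congr fun n => ?_)
    simp only [Function.comp_apply]
    rw [Function.iterate_succ_apply', h.integral_mul_transfer hp hD hη hη1 hA0 (hn n) hφ]

/-- The martingale-coboundary decomposition for a full branch map. -/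
theorem exists_coboundary (h : FullBranchMap p D K G τ ψ ρ) (hp : 1 ≤ p) (hD : 0 ≤ D)
    (hη : 0 < η) (hη1 : η ≤ 1) {f : I → ℝ} (hf : LogHolder η (coneConst D η) f)
    (hf1 : ∫ x, f x = 1)
    (hfG : ∀ φ : I → ℝ, BddMeas φ → ∫ x, φ (G x) * f x = ∫ x, φ x * f x)
    {V : I → ℝ} {c : ℕ → I → ℝ} {B : ℝ} (hB : 0 ≤ B) (hV : BddMeas V) (hVτ : ∀ x, |V x| ≤ B * τ x)
    (hc : ∀ a z, |c a z| ≤ B * ((a : ℝ) + 1))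
    (hcη : ∀ a x y, c a x - c a y ≤ B * ((a : ℝ) + 1) * dist x y ^ η)
    (hVc : ∀ a (z : I), (z : ℝ) < 1 → V (ψ a z) = c a z) (hV0 : ∫ x, V x * f x = 0) :
    ∃ χ : I → ℝ, BddMeas χ ∧
      (∀ x, |χ x| ≤ 2 * B * K * Real.exp (3 * coneConst D η) / (1 - coneRate D η)) ∧
      ∀ w : I → ℝ, BddMeas w → ∫ x, (V x + χ x - χ (G x)) * w (G x) * f x = 0 := by
  have hA1 := one_le_coneConst hη hD
  set A := coneConst D η with hA
  have hA0 : 0 ≤ A := by linarith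
  have hθ1 := coneRate_lt_one hη hD
  have hθ0 := coneRate_nonneg hη hD
  set θ := coneRate D η with hθ
  have hK := h.one_le_moment (by linarith : 0 ≤ p)
  have hfle : ∀ x, f x ≤ Real.exp A := fun x => by
    have := hf.le_exp_mul_integral hη hA0 x; rwa [hf1, mul_one] at this
  have hfge : ∀ x, Real.exp (-A) ≤ f x := fun x => by
    have := hf.integral_le_exp_mul hη hA0 x
    rw [hf1] at this
    rw [Real.exp_neg, ← one_div, div_le_iff₀ (Real.exp_pos _)]; linarith
  have hfpos : ∀ x, 0 < f x := fun x => (Real.exp_pos _).trans_le (hfge x)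
  have hfb := hf.bddMeas hη hA0
  have hτm : Measurable fun x => (τ x : ℝ) := measurable_from_top.comp h.measurable_time
  -- A signed V is outside the cone, so it is written as (V + 2 B τ) - 2 B τ. On the branch a the
  -- first part lies between B (a + 1) and 3 B (a + 1), in proportion to its Hölder constant, so its
  -- logarithm is Hölder with constant 1.
  set c₁ : ℕ → I → ℝ := fun a z => (c a z + 2 * B * ((a : ℝ) + 1)) * f (ψ a z) with hc₁
  set c₂ : ℕ → I → ℝ := fun a z => (2 * B * ((a : ℝ) + 1)) * f (ψ a z) with hc₂
  set F₁ : I → ℝ := fun x => (V x + 2 * B * τ x) * f x with hF₁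
  set F₂ : I → ℝ := fun x => (2 * B * τ x) * f x with hF₂
  have ha1 : ∀ a : ℕ, 0 ≤ B * ((a : ℝ) + 1) := fun a => by positivity
  have hlow : ∀ (a : ℕ) z, B * ((a : ℝ) + 1) ≤ c a z + 2 * B * ((a : ℝ) + 1) := fun a z => by
    have := neg_le_of_abs_le (hc a z); linarith
  have hhigh : ∀ (a : ℕ) z, c a z + 2 * B * ((a : ℝ) + 1) ≤ 3 * (B * ((a : ℝ) + 1)) := fun a z => by
    have := le_of_abs_le (hc a z); linarith
  have hc₁0 : ∀ a z, 0 ≤ c₁ a z := fun a z => mul_nonneg ((ha1 a).trans (hlow a z)) (hf.1 _)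
  have hc₂0 : ∀ a z, 0 ≤ c₂ a z := fun a z => mul_nonneg (by linarith [ha1 a]) (hf.1 _)
  set M : ℝ := 3 * B * Real.exp A with hM
  have hc₁M : ∀ a z, c₁ a z ≤ M * ((a : ℝ) + 1) := fun a z => by
    calc c₁ a z ≤ 3 * (B * ((a : ℝ) + 1)) * Real.exp A :=
          mul_le_mul (hhigh a z) (hfle _) (hf.1 _) (by linarith [ha1 a])
      _ = _ := by rw [hM]; ring
  have hc₂M : ∀ a z, c₂ a z ≤ M * ((a : ℝ) + 1) := fun a z => by
    calc c₂ a z ≤ 3 * (B * ((a : ℝ) + 1)) * Real.exp A :=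
          mul_le_mul (by linarith [ha1 a]) (hfle _) (hf.1 _) (by linarith [ha1 a])
      _ = _ := by rw [hM]; ring
  have hcomp := h.logHolder_comp_branch hη hA0 hf
  have hc₁L : ∀ a, LogHolder η ((1 / 2) ^ η * A + 1) (c₁ a) := fun a => by
    refine ⟨hc₁0 a, fun x y => ?_⟩
    set t := dist x y ^ η
    have ht : 0 ≤ t := by positivity
    have e1 : c a x + 2 * B * ((a : ℝ) + 1) ≤ Real.exp t * (c a y + 2 * B * ((a : ℝ) + 1)) := by
      have l1 := hcη a x y
      have l2 := hlow a y
      have l3 := Real.add_one_le_exp t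
      have l4 := ha1 a
      nlinarith [mul_le_mul_of_nonneg_left l2 ht]
    calc c₁ a x ≤ (Real.exp t * (c a y + 2 * B * ((a : ℝ) + 1)))
          * (Real.exp ((1 / 2) ^ η * A * t) * f (ψ a y)) :=
          mul_le_mul e1 ((hcomp a).2 x y) (hf.1 _)
            (mul_nonneg (Real.exp_pos _).le ((ha1 a).trans (hlow a y)))
      _ = Real.exp (((1 / 2) ^ η * A + 1) * t) * c₁ a y := by
          rw [add_mul, one_mul, Real.exp_add]; ring
  have hc₂L : ∀ a, LogHolder η ((1 / 2) ^ η * A + 1) (c₂ a) := fun a => by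
    refine LogHolder.mono ⟨hc₂0 a, fun x y => ?_⟩ (by linarith : (1 / 2 : ℝ) ^ η * A ≤ _)
    have := mul_le_mul_of_nonneg_left ((hcomp a).2 x y) (by linarith [ha1 a] : 0 ≤ 2 * B * ((a : ℝ) + 1))
    refine this.trans (le_of_eq ?_)
    simp only [hc₂]; ring
  set g₁ := branchSum ρ c₁ with hg₁
  set g₂ := branchSum ρ c₂ with hg₂
  -- The unit gap of the cone is used up by the Hölder variation of V.
  have hAeq : D + ((1 / 2) ^ η * A + 1) = A := by
    have := coneConst_eq (D := D) hη
    rw [← hA] at this; linarith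
  have hg₁L : LogHolder η A g₁ := by
    have := h.logHolder_branchSum hp hD hη hη1 hc₁L
      (fun a z => by rw [abs_of_nonneg (hc₁0 a z)]; exact hc₁M a z)
    rwa [hAeq] at this
  have hg₂L : LogHolder η A g₂ := by
    have := h.logHolder_branchSum hp hD hη hη1 hc₂L
      (fun a z => by rw [abs_of_nonneg (hc₂0 a z)]; exact hc₂M a z)
    rwa [hAeq] at this
  have hτ1 : ∀ x, (1 : ℝ) ≤ τ x := fun x => by exact_mod_cast h.one_le_time x
  have hd1 : ∀ φ : I → ℝ, BddMeas φ → ∫ x, φ (G x) * F₁ x = ∫ z, φ z * g₁ z := fun φ hφ => by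
    refine h.integral_mul_branchSum hp hD (M := M) (F := F₁) hc₁0 hc₁M (hg₁L.bddMeas hη hA0)
      ((hV.1.add (hτm.const_mul _)).mul hfb.1) (fun x => ?_) (fun x => ?_) (fun a z hz => ?_) hφ
    · have := neg_le_of_abs_le (hVτ x)
      have := hτ1 x
      exact mul_nonneg (by nlinarith) (hf.1 x)
    · have h1 := le_of_abs_le (hVτ x)
      have h3 : 0 ≤ B * (τ x : ℝ) := by positivity
      calc F₁ x ≤ (3 * (B * τ x)) * Real.exp A :=
            mul_le_mul (by linarith) (hfle x) (hf.1 x) (by linarith)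
        _ = M * τ x := by rw [hM]; ring
    · simp only [hF₁, hc₁]
      rw [hVc a z hz, h.time_branch a z hz]; push_cast; ring
  have hd2 : ∀ φ : I → ℝ, BddMeas φ → ∫ x, φ (G x) * F₂ x = ∫ z, φ z * g₂ z := fun φ hφ => by
    refine h.integral_mul_branchSum hp hD (M := M) (F := F₂) hc₂0 hc₂M (hg₂L.bddMeas hη hA0)
      ((hτm.const_mul _).mul hfb.1) (fun x => ?_) (fun x => ?_) (fun a z hz => ?_) hφ
    · exact mul_nonneg (by positivity) (hf.1 x)
    · have h3 : 0 ≤ B * (τ x : ℝ) := by positivity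
      calc F₂ x ≤ (3 * (B * τ x)) * Real.exp A :=
            mul_le_mul (by linarith) (hfle x) (hf.1 x) (by linarith)
        _ = M * τ x := by rw [hM]; ring
    · simp only [hF₂, hc₂]
      rw [h.time_branch a z hz]; push_cast; ring
  have hF₂i : Integrable F₂ := by
    have := ((h.integrable_time hp).const_mul (2 * B)).bdd_mul (g := fun x => 2 * B * (τ x : ℝ))
      (f := f) hfb.1.aestronglyMeasurable (ae_of_all _ fun x => by
        rw [Real.norm_eq_abs, abs_of_nonneg (hf.1 x)]; exact hfle x)
    exact this.congr (ae_of_all _ fun x => by simp only [hF₂]; ring)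
  have hVf : BddMeas fun x => V x * f x := hV.mul hfb
  have hFF : ∀ φ : I → ℝ, BddMeas φ →
      ∫ x, φ (G x) * F₁ x = (∫ x, φ (G x) * (V x * f x)) + ∫ x, φ (G x) * F₂ x := fun φ hφ => by
    obtain ⟨Cφ, hCφ⟩ := hφ.2
    rw [← integral_add (((hφ.comp h.measurable_map).mul hVf).integrable volume)
      (hF₂i.bdd_mul (hφ.comp h.measurable_map).1.aestronglyMeasurable (ae_of_all _ fun x => hCφ (G x)))]
    exact integral_congr_ae (ae_of_all _ fun x => by simp only [hF₁, hF₂]; ring)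
  set E : ℝ := 2 * B * K * Real.exp A with hE
  have hmass2 : ∫ z, g₂ z ≤ E := by
    have e := hd2 _ (BddMeas.const 1)
    simp only [one_mul] at e
    rw [← e]
    calc ∫ x, F₂ x ≤ ∫ x, (2 * B * Real.exp A) * (τ x : ℝ) := by
          refine integral_mono hF₂i ((h.integrable_time hp).const_mul _) fun x => ?_
          have h3 : 0 ≤ 2 * B * (τ x : ℝ) := by positivity
          calc F₂ x ≤ (2 * B * (τ x : ℝ)) * Real.exp A := mul_le_mul_of_nonneg_left (hfle x) h3
            _ = _ := by ring
      _ = (2 * B * Real.exp A) * ∫ x, (τ x : ℝ) := integral_const_mul _ _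
      _ ≤ (2 * B * Real.exp A) * K := by
          have := h.integral_time_le hp
          gcongr
      _ = E := by rw [hE]; ring
  -- Equality of masses is the centring of V; it makes the cone contraction applicable to the pair.
  have hmass : ∫ z, g₁ z = ∫ z, g₂ z := by
    have e1 := hd1 _ (BddMeas.const 1)
    have e2 := hd2 _ (BddMeas.const 1)
    have e3 := hFF _ (BddMeas.const 1)
    simp only [one_mul] at e1 e2 e3
    rw [← e1, ← e2, e3, hV0, zero_add]
  set e : ℕ → I → ℝ := fun n z => (transfer ρ ψ)^[n] g₁ z - (transfer ρ ψ)^[n] g₂ z with he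
  have hL1 := h.logHolder_iterate_transfer hp hD hη hη1 hg₁L
  have hL2 := h.logHolder_iterate_transfer hp hD hη hη1 hg₂L
  have heb : ∀ n, BddMeas (e n) := fun n =>
    ((hL1 n).bddMeas hη hA0).sub ((hL2 n).bddMeas hη hA0)
  have hele : ∀ n z, |e n z| ≤ Real.exp A * E * θ ^ n := fun n z => by
    refine (h.abs_iterate_transfer_sub_le hp hD hη hη1 n hg₁L hg₂L hmass rfl z).trans ?_
    rw [← hA, ← hθ, mul_comm]
    gcongr
  have hgs : HasSum (fun n : ℕ => Real.exp A * E * θ ^ n) (Real.exp A * E * (1 - θ)⁻¹) :=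
    (hasSum_geometric_of_lt_one hθ0 hθ1).mul_left _
  have hsum : ∀ z, Summable fun n => e n z := fun z =>
    Summable.of_norm_bounded hgs.summable fun n => hele n z
  -- Since e n is the (n + 1)-st iterate of the transfer operator on V f, U is the Poisson-type
  -- series over all iterates from 1 on; χ is U / f.
  set U : I → ℝ := fun z => ∑' n, e n z with hU
  set S : ℕ → I → ℝ := fun N z => ∑ n ∈ Finset.range N, e n z with hS
  have hSb : ∀ N, BddMeas (S N) := fun N => BddMeas.sum _ fun i _ => heb i
  have hSU : ∀ z, Tendsto (S · z) atTop (𝓝 (U z)) := fun z => (hsum z).hasSum.tendsto_sum_nat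
  set Q : ℝ := Real.exp A * E * (1 - θ)⁻¹ with hQ
  have hE0 : 0 ≤ E := by positivity
  have hSQ : ∀ N z, |S N z| ≤ Q := fun N z => by
    refine (Finset.abs_sum_le_sum_abs _ _).trans ((Finset.sum_le_sum fun i _ => hele i z).trans ?_)
    exact sum_le_hasSum _ (fun i _ => by positivity) hgs
  have hUQ : ∀ z, |U z| ≤ Q := fun z => le_of_tendsto' (hSU z).abs fun N => hSQ N z
  have hUm : Measurable U := measurable_of_tendsto_metrizable (fun N => (hSb N).1) (tendsto_pi_nhds.2 hSU)
  have hUb : BddMeas U := ⟨hUm, Q, hUQ⟩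
  have hχle : ∀ x, |U x / f x| ≤ 2 * B * K * Real.exp (3 * A) / (1 - θ) := fun x => by
    rw [abs_div, abs_of_pos (hfpos x), div_le_iff₀ (hfpos x)]
    refine (hUQ x).trans ?_
    have e1 : 2 * B * K * Real.exp (3 * A) / (1 - θ) = Q * Real.exp A := by
      rw [hQ, hE, show 3 * A = A + A + A by ring, Real.exp_add, Real.exp_add]; field_simp
    have hQ0 : 0 ≤ Q := (abs_nonneg _).trans (hUQ x)
    have e2 : 1 ≤ Real.exp A * f x := by
      have := mul_le_mul_of_nonneg_left (hfge x) (Real.exp_pos A).le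
      rwa [← Real.exp_add, add_neg_cancel, Real.exp_zero] at this
    rw [e1]; nlinarith
  have hχb : BddMeas fun x => U x / f x := ⟨hUm.div hfb.1, _, hχle⟩
  refine ⟨fun x => U x / f x, hχb, hχle, fun w hw => ?_⟩
  have hwG := hw.comp h.measurable_map
  have hI1 : ∫ x, w (G x) * (V x * f x) = ∫ z, w z * e 0 z := by
    have a1 := hFF w hw
    rw [hd1 w hw, hd2 w hw] at a1
    have a2 : ∫ z, w z * e 0 z = (∫ z, w z * g₁ z) - ∫ z, w z * g₂ z := by
      rw [← integral_sub ((hw.mul (hg₁L.bddMeas hη hA0)).integrable volume)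
        ((hw.mul (hg₂L.bddMeas hη hA0)).integrable volume)]
      exact integral_congr_ae (ae_of_all _ fun z => by simp only [he, Function.iterate_zero, id]; ring)
    rw [a2, a1]; ring
  have hstep : ∀ n, ∫ x, w (G x) * e n x = ∫ z, w z * e (n + 1) z := fun n => by
    have a1 := h.integral_mul_transfer hp hD hη hη1 hA0 (hL1 n) hw
    have a2 := h.integral_mul_transfer hp hD hη hη1 hA0 (hL2 n) hw
    have b1 : ∫ x, w (G x) * e n x
        = (∫ x, w (G x) * (transfer ρ ψ)^[n] g₁ x) - ∫ x, w (G x) * (transfer ρ ψ)^[n] g₂ x := by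
      rw [← integral_sub ((hwG.mul ((hL1 n).bddMeas hη hA0)).integrable volume)
        ((hwG.mul ((hL2 n).bddMeas hη hA0)).integrable volume)]
      exact integral_congr_ae (ae_of_all _ fun z => by simp only [he]; ring)
    have b2 : ∫ z, w z * e (n + 1) z = (∫ z, w z * (transfer ρ ψ)^[n + 1] g₁ z)
        - ∫ z, w z * (transfer ρ ψ)^[n + 1] g₂ z := by
      rw [← integral_sub ((hw.mul ((hL1 (n + 1)).bddMeas hη hA0)).integrable volume)
        ((hw.mul ((hL2 (n + 1)).bddMeas hη hA0)).integrable volume)]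
      exact integral_congr_ae (ae_of_all _ fun z => by simp only [he]; ring)
    rw [b1, b2, a1, a2]
    simp only [Function.iterate_succ_apply']
  -- Composition with G shifts the series by one index and thus loses its first term. That term
  -- cancels against V, while invariance of f converts χ ∘ G into the full series.
  have hI2 : ∫ x, w (G x) * U x = (∫ z, w z * U z) - ∫ z, w z * e 0 z := by
    have t1 := tendsto_integral_mul_of_bounded (fun N => (hSb N).1) hSQ hSU hwG
    have t2 := ((tendsto_integral_mul_of_bounded (fun N => (hSb N).1) hSQ hSU hw).comp
      (tendsto_add_atTop_nat 1)).sub_const (∫ z, w z * e 0 z)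
    refine tendsto_nhds_unique t1 (t2.congr fun N => ?_)
    have c1 : ∫ x, w (G x) * S N x = ∑ n ∈ Finset.range N, ∫ x, w (G x) * e n x := by
      rw [← integral_finsetSum _ fun n _ => (hwG.mul (heb n)).integrable volume]
      exact integral_congr_ae (ae_of_all _ fun x => by simp only [hS, Finset.mul_sum])
    have c2 : ∫ x, w x * S (N + 1) x = ∑ n ∈ Finset.range (N + 1), ∫ x, w x * e n x := by
      rw [← integral_finsetSum _ fun n _ => (hw.mul (heb n)).integrable volume]
      exact integral_congr_ae (ae_of_all _ fun x => by simp only [hS, Finset.mul_sum])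
    simp only [Function.comp_apply]
    rw [c1, c2, Finset.sum_range_succ', add_sub_cancel_right]
    exact Finset.sum_congr rfl fun n _ => (hstep n).symm
  have hI3 : ∫ x, (U (G x) / f (G x) * w (G x)) * f x = ∫ z, w z * U z := by
    rw [hfG (fun x => U x / f x * w x) (hχb.mul hw)]
    exact integral_congr_ae (ae_of_all _ fun z => by
      have := (hfpos z).ne'
      simp only; field_simp)
  have hfin : ∫ x, (V x + U x / f x - U (G x) / f (G x)) * w (G x) * f x
      = (∫ x, w (G x) * (V x * f x)) + (∫ x, w (G x) * U x)
        - ∫ x, (U (G x) / f (G x) * w (G x)) * f x := by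
    rw [← integral_add ((hwG.mul hVf).integrable volume) ((hwG.mul hUb).integrable volume),
      ← integral_sub (((hwG.mul hVf).add (hwG.mul hUb)).integrable volume)
        ((((hχb.comp h.measurable_map).mul hwG).mul hfb).integrable volume)]
    exact integral_congr_ae (ae_of_all _ fun x => by
      have := (hfpos x).ne'
      simp only; field_simp)
  rw [hfin, hI1, hI2, hI3]; ring

end FullBranchMap

/-! ### Mixing and uniqueness of the invariant measure -/

/-- Approximate first by a bounded continuous function and then, by Weierstrass, by a polynomial.
This connects an arbitrary invariant density to the cone. -/
theorem exists_lipschitz_integral_sub_le {r : I → ℝ} (hr : Integrable r) {δ : ℝ} (hδ : 0 < δ) :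
    ∃ (q : I → ℝ) (L : ℝ), 0 ≤ L ∧ (∀ x y, |q x - q y| ≤ L * dist x y) ∧ BddMeas q ∧
      ∫ x, |r x - q x| ≤ δ := by
  obtain ⟨g, hg, hgi⟩ := hr.exists_boundedContinuous_integral_sub_le (half_pos hδ)
  obtain ⟨q, hq⟩ := exists_polynomial_near_continuousMap 0 1 g.toContinuousMap (δ / 2) (half_pos hδ)
  have hqg : ∀ x : I, |q.eval (x : ℝ) - g x| ≤ δ / 2 := fun x =>
    ((ContinuousMap.norm_coe_le_norm (q.toContinuousMapOn _ - g.toContinuousMap) x).trans hq.le)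
  obtain ⟨L, hL⟩ := (isCompact_Icc (a := (0 : ℝ)) (b := 1)).exists_bound_of_continuousOn
    (q.derivative.continuous.continuousOn)
  have hL0 : 0 ≤ L := (norm_nonneg _).trans (hL 0 (by simp))
  have hqc : Continuous fun x : I => q.eval (x : ℝ) := q.continuous.comp continuous_subtype_val
  have hqb : BddMeas fun x : I => q.eval (x : ℝ) := by
    refine ⟨hqc.measurable, ?_⟩
    obtain ⟨C, hC⟩ := (isCompact_univ (X := I)).exists_bound_of_continuousOn hqc.continuousOn
    exact ⟨C, fun x => hC x trivial⟩
  refine ⟨fun x => q.eval (x : ℝ), L, hL0, fun x y => ?_, hqb, ?_⟩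
  · have := (convex_Icc (0 : ℝ) 1).norm_image_sub_le_of_norm_deriv_le (f := fun t => q.eval t)
      (fun t _ => q.differentiable.differentiableAt) (C := L)
      (fun t ht => by simpa using hL t ht) y.2 x.2
    exact this
  · have hi := hqb.integrable (volume : Measure I)
    calc ∫ x, |r x - q.eval (x : ℝ)| ≤ ∫ x, (‖r x - g x‖ + δ / 2) := by
          refine integral_mono (hr.sub hi).abs ((hr.sub hgi).norm.add (integrable_const _)) fun x => ?_
          have h1 := hqg x
          have h2 := abs_add_le (r x - g x) (g x - q.eval (x : ℝ))
          rw [sub_add_sub_cancel, abs_sub_comm (g x)] at h2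
          simp only [Real.norm_eq_abs]
          linarith
      _ = (∫ x, ‖r x - g x‖) + δ / 2 := by
          have := integral_add (hr.sub hgi).norm (integrable_const (δ / 2))
          simp only [Pi.sub_apply] at this
          rw [this]; simp
      _ ≤ δ := by linarith

namespace FullBranchMap

variable {p D K : ℝ} {G : I → I} {τ : I → ℕ} {ψ : ℕ → I → I} {ρ : ℕ → I → ℝ} {η : ℝ}

/-- Mixing for cone functions: the iterates of g approach those of the constant with the same mass,
which converge to a multiple of f. -/
theorem tendsto_integral_iterate_mul (h : FullBranchMap p D K G τ ψ ρ) (hp : 1 ≤ p) (hD : 0 ≤ D)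
    (hη : 0 < η) (hη1 : η ≤ 1) {f : I → ℝ}
    (hf : ∀ x, Tendsto (fun n => (transfer ρ ψ)^[n] (fun _ => 1) x) atTop (𝓝 (f x)))
    {g : I → ℝ} (hg : LogHolder η (coneConst D η) g) {φ : I → ℝ} (hφ : BddMeas φ) :
    Tendsto (fun n => ∫ x, φ (G^[n] x) * g x) atTop (𝓝 ((∫ x, g x) * ∫ x, φ x * f x)) := by
  have hA1 := one_le_coneConst hη hD
  set A := coneConst D η with hA
  have hA0 : 0 ≤ A := by linarith
  have hθ1 := coneRate_lt_one hη hD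
  have hθ0 := coneRate_nonneg hη hD
  set M := ∫ x, g x with hM
  have hM0 : 0 ≤ M := integral_nonneg hg.1
  have hc : LogHolder η A fun _ => M * 1 := LogHolder.const hA0 (by linarith)
  have hb : ∀ {g : I → ℝ}, LogHolder η A g → ∫ x, g x = M → ∀ n x,
      |(transfer ρ ψ)^[n] g x| ≤ Real.exp A * M := fun {g} hg hgM n x => by
    have hn := h.logHolder_iterate_transfer hp hD hη hη1 hg n
    rw [abs_of_nonneg (hn.1 x)]
    have := hn.le_exp_mul_integral hη hA0 x
    have e := h.integral_iterate_mul hp hD hη hη1 hg (BddMeas.const 1) n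
    simp only [one_mul] at e
    rwa [← e, hgM] at this
  have hlim : ∀ x, Tendsto (fun n => (transfer ρ ψ)^[n] g x) atTop (𝓝 (M * f x)) := fun x => by
    have t1 : Tendsto (fun n => (transfer ρ ψ)^[n] (fun _ => M * 1) x) atTop (𝓝 (M * f x)) := by
      simp only [iterate_transfer_const_mul]
      exact (hf x).const_mul M
    have t2 : Tendsto (fun n => (transfer ρ ψ)^[n] g x - (transfer ρ ψ)^[n] (fun _ => M * 1) x)
        atTop (𝓝 0) := by
      refine squeeze_zero_norm (fun n => h.abs_iterate_transfer_sub_le hp hD hη hη1 n hg hc rfl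
        (by simp [hM]) x) ?_
      simpa using (tendsto_pow_atTop_nhds_zero_of_lt_one hθ0 hθ1).mul_const (Real.exp A * M)
    simpa using t2.add t1
  have t := tendsto_integral_mul_of_bounded
    (fun n => ((h.logHolder_iterate_transfer hp hD hη hη1 hg n).continuous hη).measurable)
    (hb hg rfl) hlim hφ
  have e : ∫ x, φ x * (M * f x) = M * ∫ x, φ x * f x := by
    rw [← integral_const_mul]; exact integral_congr_ae (ae_of_all _ fun x => by ring)
  rw [e] at t
  exact t.congr fun n => (h.integral_iterate_mul hp hD hη hη1 hg hφ n).symm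

/-- Absolutely continuous invariant measures of a full branch map are unique up to scaling. -/
theorem integral_eq_of_invariant (h : FullBranchMap p D K G τ ψ ρ) (hp : 1 ≤ p) (hD : 0 ≤ D)
    (hη : 0 < η) (hη1 : η ≤ 1) {f : I → ℝ} (hfL : LogHolder η (coneConst D η) f) (hf1 : ∫ x, f x = 1)
    (hf : ∀ x, Tendsto (fun n => (transfer ρ ψ)^[n] (fun _ => 1) x) atTop (𝓝 (f x)))
    {lam : Measure I} [IsFiniteMeasure lam] (hG : MeasurePreserving G lam lam)
    (hac : lam ≪ volume) {φ : I → ℝ} (hφ : BddMeas φ) :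
    ∫ x, φ x ∂lam = lam.real Set.univ * ∫ x, φ x * f x := by
  have hA1 := one_le_coneConst hη hD
  set A := coneConst D η with hA
  have hA0 : 0 ≤ A := by linarith
  obtain ⟨B, hB⟩ := hφ.2
  have hB0 : 0 ≤ B := (abs_nonneg _).trans (hB 0)
  set r : I → ℝ := fun x => (lam.rnDeriv volume x).toReal with hr
  have hri : Integrable r := Measure.integrable_toReal_rnDeriv
  have hrφ : ∀ g : I → ℝ, ∫ x, g x * r x = ∫ x, g x ∂lam := fun g => by
    rw [← integral_rnDeriv_smul hac]
    exact integral_congr_ae (ae_of_all _ fun x => by simp [hr, mul_comm])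
  set J := ∫ x, φ x * f x with hJ
  have hfb := hfL.bddMeas hη hA0
  have hJB : |J| ≤ B := by
    calc |J| ≤ ∫ x, |φ x * f x| := abs_integral_le_integral_abs
      _ ≤ ∫ x, B * f x := by
          refine integral_mono ((hφ.mul hfb).abs.integrable _) ((hfb.const_mul B).integrable _) fun x => ?_
          simp only [abs_mul, abs_of_nonneg (hfL.1 x)]
          exact mul_le_mul_of_nonneg_right (hB x) (hfL.1 x)
      _ = B := by rw [integral_const_mul, hf1, mul_one]
  have hm : ∫ x, r x = lam.real Set.univ := by
    have := hrφ fun _ => 1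
    simpa using this
  -- By invariance φ may be replaced by φ ∘ G^n. The density is replaced by q with L¹ error δ, and
  -- mixing evaluates the limit in n. A second error of the same size comes from the mass of q.
  have key : ∀ δ : ℝ, 0 < δ → |∫ x, φ x ∂lam - lam.real Set.univ * J| ≤ 2 * B * δ := fun δ hδ => by
    obtain ⟨q, L, hL0, hqL, hqb, hqr⟩ := exists_lipschitz_integral_sub_le hri hδ
    obtain ⟨Q, hQ⟩ := hqb.2
    -- Then q + c ≥ L, so the logarithm of q + c is Lipschitz with constant 1, and the function is
    -- in the cone.
    set c := L + Q with hc
    have hQ0 : 0 ≤ Q := (abs_nonneg _).trans (hQ 0)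
    have hqc : LogHolder η A fun x => q x + c := by
      refine ⟨fun x => by have := neg_le_of_abs_le (hQ x); linarith, fun x y => ?_⟩
      have h1 := le_of_abs_le (hqL x y)
      have h2 := unitInterval_dist_le_rpow hη hη1 x y
      have h3 : L ≤ q y + c := by have := neg_le_of_abs_le (hQ y); linarith
      have h4 := Real.add_one_le_exp (A * dist x y ^ η)
      have h5 : 0 ≤ dist x y ^ η := by positivity
      have h6 : L * dist x y ≤ (q y + c) * (A * dist x y ^ η) :=
        mul_le_mul h3 (h2.trans (le_mul_of_one_le_left h5 hA1)) dist_nonneg (hL0.trans h3)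
      nlinarith [mul_le_mul_of_nonneg_right h4 (hL0.trans h3)]
    have t1 := h.tendsto_integral_iterate_mul hp hD hη hη1 hf hqc hφ
    have t2 := (h.tendsto_integral_iterate_mul hp hD hη hη1 hf
      (LogHolder.const hA0 (by linarith : 0 ≤ c)) hφ)
    have hqi := hqb.integrable (volume : Measure I)
    have hlimeq : (∫ x, q x + c) * J - (∫ _x : I, c) * J = (∫ x, q x) * J := by
      rw [integral_add hqi (integrable_const _)]; ring
    have t3 := t1.sub t2
    rw [hlimeq] at t3
    have hGn : ∀ n, BddMeas fun x => φ (G^[n] x) := fun n => hφ.comp (h.measurable_map.iterate n)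
    have hstep : ∀ n, |∫ x, φ x ∂lam - ((∫ x, φ (G^[n] x) * (q x + c)) - ∫ x, φ (G^[n] x) * c)|
        ≤ B * δ := fun n => by
      have e1 : ∫ x, φ x ∂lam = ∫ x, φ (G^[n] x) * r x := by
        rw [hrφ, integral_comp_of_measurePreserving (hG.iterate n) hφ.1]
      have i1 : Integrable fun x => φ (G^[n] x) * r x :=
        hri.bdd_mul (hGn n).1.aestronglyMeasurable (ae_of_all _ fun x => hB _)
      have e2 : ∫ x, φ x ∂lam - ((∫ x, φ (G^[n] x) * (q x + c)) - ∫ x, φ (G^[n] x) * c)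
          = ∫ x, φ (G^[n] x) * (r x - q x) := by
        have i2 := ((hGn n).mul (hqb.add (BddMeas.const c))).integrable (volume : Measure I)
        have i3 := ((hGn n).mul (BddMeas.const c)).integrable (volume : Measure I)
        have i4 := ((hGn n).mul hqb).integrable (volume : Measure I)
        rw [e1, ← integral_sub i2 i3, ← integral_sub i1 (f := fun x => φ (G^[n] x) * r x)
          (g := fun x => φ (G^[n] x) * (q x + c) - φ (G^[n] x) * c) (i2.sub i3)]
        exact integral_congr_ae (ae_of_all _ fun x => by ring)
      rw [e2]
      calc |∫ x, φ (G^[n] x) * (r x - q x)| ≤ ∫ x, |φ (G^[n] x) * (r x - q x)| :=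
            abs_integral_le_integral_abs
        _ ≤ ∫ x, B * |r x - q x| := by
            refine integral_mono (((hri.sub hqi).bdd_mul (hGn n).1.aestronglyMeasurable
              (ae_of_all _ fun x => hB _)).abs) ((hri.sub hqi).abs.const_mul B) fun x => ?_
            simp only [abs_mul]
            exact mul_le_mul_of_nonneg_right (hB _) (abs_nonneg _)
        _ = B * ∫ x, |r x - q x| := integral_const_mul _ _
        _ ≤ B * δ := mul_le_mul_of_nonneg_left hqr hB0
    have hl : |∫ x, φ x ∂lam - (∫ x, q x) * J| ≤ B * δ :=
      le_of_tendsto' ((tendsto_const_nhds.sub t3).abs) hstep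
    have hmq : |(∫ x, q x) - lam.real Set.univ| ≤ δ := by
      rw [abs_sub_comm, ← hm, ← integral_sub hri hqi]
      exact abs_integral_le_integral_abs.trans hqr
    have e3 : ∫ x, φ x ∂lam - lam.real Set.univ * J
        = (∫ x, φ x ∂lam - (∫ x, q x) * J) + ((∫ x, q x) - lam.real Set.univ) * J := by ring
    rw [e3]
    refine (abs_add_le _ _).trans ?_
    rw [abs_mul]
    have := mul_le_mul hmq hJB (abs_nonneg _) hδ.le
    linarith
  have : |∫ x, φ x ∂lam - lam.real Set.univ * J| ≤ 0 := by
    refine le_of_forall_pos_le_add fun ε hε => ?_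
    refine (key (ε / (2 * B + 1)) (by positivity)).trans ?_
    rw [zero_add, ← mul_div_assoc, div_le_iff₀ (by positivity)]
    nlinarith
  exact sub_eq_zero.1 (abs_eq_zero.1 (le_antisymm this (abs_nonneg _)))

/-- The invariant probability measure of a full branch map and its properties. -/
theorem exists_invariant_measure (h : FullBranchMap p D K G τ ψ ρ) (hp : 1 ≤ p) (hD : 0 ≤ D)
    (hη : 0 < η) (hη1 : η ≤ 1) : ∃ lam : Measure I, IsProbabilityMeasure lam ∧
      MeasurePreserving G lam lam ∧
      volume ≤ ENNReal.ofReal (Real.exp (coneConst D η)) • lam ∧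
      (∀ w : I → ℝ≥0∞, Measurable w →
        ∫⁻ x, ENNReal.ofReal ((τ x : ℝ) ^ p) * w (G x) ∂lam
          ≤ ENNReal.ofReal (Real.exp (2 * coneConst D η + D) * K) * ∫⁻ x, w x ∂lam) ∧
      (∀ nu : Measure I, IsFiniteMeasure nu → MeasurePreserving G nu nu → nu ≪ volume →
        nu = nu Set.univ • lam) ∧
      ∀ (V : I → ℝ) (c : ℕ → I → ℝ) (B : ℝ), 0 ≤ B → BddMeas V → (∀ x, |V x| ≤ B * τ x) →
        (∀ a z, |c a z| ≤ B * ((a : ℝ) + 1)) →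
        (∀ a x y, c a x - c a y ≤ B * ((a : ℝ) + 1) * dist x y ^ η) →
        (∀ a (z : I), (z : ℝ) < 1 → V (ψ a z) = c a z) → ∫ x, V x ∂lam = 0 →
        ∃ χ : I → ℝ, BddMeas χ ∧
          (∀ x, |χ x| ≤ 2 * B * K * Real.exp (3 * coneConst D η) / (1 - coneRate D η)) ∧
          ∀ w : I → ℝ, BddMeas w → ∫ x, (V x + χ x - χ (G x)) * w (G x) ∂lam = 0 := by
  have hA1 := one_le_coneConst hη hD
  obtain ⟨f, hfL, hf1, hfG, hft⟩ := h.exists_invariant_density hp hD hη hη1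
  set A := coneConst D η with hA
  have hA0 : 0 ≤ A := by linarith
  have hK := h.one_le_moment (by linarith : 0 ≤ p)
  have hfm : Measurable fun x => ENNReal.ofReal (f x) :=
    (hfL.continuous hη).measurable.ennreal_ofReal
  have hfle : ∀ x, f x ≤ Real.exp A := fun x => by
    have := hfL.le_exp_mul_integral hη hA0 x; rwa [hf1, mul_one] at this
  have hfge : ∀ x, Real.exp (-A) ≤ f x := fun x => by
    have := hfL.integral_le_exp_mul hη hA0 x
    rw [hf1] at this
    rw [Real.exp_neg, ← one_div, div_le_iff₀ (Real.exp_pos _)]; linarith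
  set lam : Measure I := volume.withDensity fun x => ENNReal.ofReal (f x) with hlam
  have hint : ∀ g : I → ℝ, ∫ x, g x ∂lam = ∫ x, g x * f x := fun g => by
    rw [hlam, integral_withDensity_eq_integral_toReal_smul hfm (ae_of_all _ fun _ => ENNReal.ofReal_lt_top)]
    exact integral_congr_ae (ae_of_all _ fun x => by
      simp [ENNReal.toReal_ofReal (hfL.1 x), mul_comm])
  have hlint : ∀ g : I → ℝ≥0∞, Measurable g → ∫⁻ x, g x ∂lam = ∫⁻ x, ENNReal.ofReal (f x) * g x :=
    fun g hg => by rw [hlam, lintegral_withDensity_eq_lintegral_mul _ hfm hg]; rfl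
  have hprob : IsProbabilityMeasure lam := ⟨by
    have := hlint (fun _ => 1) measurable_const
    simp only [lintegral_const, one_mul, mul_one] at this
    rw [this, ← ofReal_integral_eq_lintegral_ofReal ((hfL.bddMeas hη hA0).integrable _)
      (ae_of_all _ hfL.1), hf1, ENNReal.ofReal_one]⟩
  have hreal : ∀ s, MeasurableSet s → lam.real s = ∫ x, s.indicator 1 x * f x := fun s hs => by
    rw [← hint, integral_indicator_one hs]
  have hind : ∀ s : Set I, MeasurableSet s → BddMeas (s.indicator (1 : I → ℝ)) := fun s hs =>
    ⟨measurable_one.indicator hs, 1, fun x => by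
      by_cases hx : x ∈ s <;> simp [hx]⟩
  refine ⟨lam, hprob, ⟨h.measurable_map, ?_⟩, ?_, fun w hw => ?_, fun nu hnu hnuG hac => ?_, ?_⟩
  · refine Measure.ext fun s hs => ?_
    rw [Measure.map_apply h.measurable_map hs, ← measureReal_eq_measureReal_iff, hreal s hs,
      hreal _ (h.measurable_map hs), ← hfG _ (hind s hs)]
    rfl
  · refine Measure.le_iff.2 fun s hs => ?_
    rw [Measure.smul_apply, hlam, withDensity_apply _ hs, smul_eq_mul,
      ← lintegral_const_mul _ hfm]
    calc volume s = ∫⁻ _x in s, 1 := by simp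
      _ ≤ _ := lintegral_mono fun x => by
        rw [← ENNReal.ofReal_mul (Real.exp_pos _).le, ENNReal.one_le_ofReal]
        have := mul_le_mul_of_nonneg_left (hfge x) (Real.exp_pos A).le
        rwa [← Real.exp_add, add_neg_cancel, Real.exp_zero] at this
  · have hτm : Measurable fun x => ENNReal.ofReal ((τ x : ℝ) ^ p) :=
      (h.measurable_time_rpow p).ennreal_ofReal
    rw [hlint (fun x => ENNReal.ofReal ((τ x : ℝ) ^ p) * w (G x))
      (hτm.mul (hw.comp h.measurable_map)), hlint _ hw]
    calc ∫⁻ x, ENNReal.ofReal (f x) * (ENNReal.ofReal ((τ x : ℝ) ^ p) * w (G x))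
        ≤ ∫⁻ x, ENNReal.ofReal (Real.exp A) * (w (G x) * ENNReal.ofReal ((τ x : ℝ) ^ p)) :=
          lintegral_mono fun x => by
            rw [mul_comm (w (G x))]
            exact mul_le_mul_left (ENNReal.ofReal_le_ofReal (hfle x)) _
      _ = ENNReal.ofReal (Real.exp A)
          * ∫⁻ z, w z * ∑' a, ENNReal.ofReal (ρ a z) * ENNReal.ofReal ((τ (ψ a z) : ℝ) ^ p) := by
          rw [lintegral_const_mul (f := fun x => w (G x) * ENNReal.ofReal ((τ x : ℝ) ^ p)) _
              ((hw.comp h.measurable_map).mul hτm),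
            h.duality w _ hw hτm]
      -- The series over branches is bounded pointwise by exp D * K, and 1 ≤ exp A * f restores the
      -- density.
      _ ≤ ENNReal.ofReal (Real.exp A) * ∫⁻ z, ENNReal.ofReal (Real.exp D * K * Real.exp A)
            * (ENNReal.ofReal (f z) * w z) := by
          refine mul_le_mul_right (lintegral_mono_ae ?_) _
          filter_upwards [ae_mem_Ioo_unitInterval] with z hz
          have e : ∑' a, ENNReal.ofReal (ρ a z) * ENNReal.ofReal ((τ (ψ a z) : ℝ) ^ p)
              = ∑' a, ENNReal.ofReal (ρ a z * ((a : ℝ) + 1) ^ p) := tsum_congr fun a => by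
            rw [h.time_branch a z hz.2, ENNReal.ofReal_mul (h.weight_pos a z).le]; push_cast; rfl
          have hK0 : 0 ≤ Real.exp D * K := by positivity
          rw [e, mul_comm, ← mul_assoc, ← ENNReal.ofReal_mul (by positivity)]
          refine mul_le_mul_left ((h.tsum_weight_le hD z).trans (ENNReal.ofReal_le_ofReal ?_)) _
          have := mul_le_mul_of_nonneg_left (hfge z) (Real.exp_pos A).le
          rw [← Real.exp_add, add_neg_cancel, Real.exp_zero] at this
          nlinarith
      _ = _ := by
          rw [lintegral_const_mul (f := fun z => ENNReal.ofReal (f z) * w z) _ (hfm.mul hw), ← mul_assoc, ← ENNReal.ofReal_mul (Real.exp_pos _).le]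
          congr 2
          rw [show 2 * A + D = A + A + D by ring, Real.exp_add, Real.exp_add]; ring
  · refine Measure.ext fun s hs => ?_
    have e := h.integral_eq_of_invariant hp hD hη hη1 hfL hf1 hft hnuG hac (hind s hs)
    rw [← hint, integral_indicator_one hs, integral_indicator_one hs] at e
    rw [Measure.smul_apply, smul_eq_mul, ← ENNReal.toReal_eq_toReal_iff' (measure_ne_top _ _)
      (ENNReal.mul_ne_top (measure_ne_top _ _) (measure_ne_top _ _)), ENNReal.toReal_mul]
    exact e
  · intro V c B hB hV hVτ hc hcη hVc hV0
    rw [hint] at hV0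
    obtain ⟨χ, h1, h2, h3⟩ := h.exists_coboundary hp hD hη hη1 hfL hf1 hfG hB hV hVτ hc hcη hVc hV0
    exact ⟨χ, h1, h2, fun w hw => by rw [hint]; exact h3 w hw⟩

end FullBranchMap

/-! ### Excursions away from `[1/2, 1]` -/

/-- The distribution under `μ` of the first point after a visit to `[1/2, 1]`. -/
noncomputable def inducedMeasure (T : I → I) (μ : Measure I) : Measure I :=
  (μ.restrict {x : I | 1 / 2 ≤ (x : ℝ)}).map T

theorem measurableSet_half_le : MeasurableSet {x : I | 1 / 2 ≤ (x : ℝ)} :=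
  measurableSet_le measurable_const measurable_subtype_coe

theorem inducedMeasure_le {T : I → I} {μ : Measure I} (hT : MeasurePreserving T μ μ) :
    inducedMeasure T μ ≤ μ := by
  conv_rhs => rw [← hT.map_eq]
  exact Measure.map_mono Measure.restrict_le_self hT.measurable

theorem lt_excursionTime_iff {T : I → I} {x : I} (hx : ∃ n, 1 / 2 ≤ (T^[n] x : ℝ)) {n : ℕ} :
    n < excursionTime T x ↔ ∀ j < n, (T^[j] x : ℝ) < 1 / 2 := by
  constructor
  · intro h j hj
    exact lt_half_of_lt_excursionTime (by omega)
  · intro h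
    by_contra hlt
    have h3 : 1 / 2 ≤ (T^[sInf {j : ℕ | 1 / 2 ≤ (T^[j] x : ℝ)}] x : ℝ) :=
      Nat.sInf_mem (s := {j : ℕ | 1 / 2 ≤ (T^[j] x : ℝ)}) hx
    have := h (sInf {j : ℕ | 1 / 2 ≤ (T^[j] x : ℝ)}) (by unfold excursionTime at hlt; omega)
    linarith

theorem half_le_iterate_excursionTime {T : I → I} {x : I} (hx : ∃ n, 1 / 2 ≤ (T^[n] x : ℝ)) :
    1 / 2 ≤ (T^[excursionTime T x - 1] x : ℝ) :=
  Nat.sInf_mem (s := {j : ℕ | 1 / 2 ≤ (T^[j] x : ℝ)}) hx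

section Kakutani

variable {T : I → I} {μ : Measure I}

theorem measurable_sum_range_excursionTime {M : Type*} [AddCommMonoid M] [MeasurableSpace M]
    [MeasurableAdd₂ M] (hT : Measurable T) {g : I → M} (hg : Measurable g) :
    Measurable fun x => ∑ n ∈ Finset.range (excursionTime T x), g (T^[n] x) := by
  have h : Measurable fun q : ℕ × I => ∑ n ∈ Finset.range q.1, g (T^[n] q.2) :=
    measurable_from_prod_countable_right fun m =>
      Finset.measurable_fun_sum (Finset.range m) (f := fun n x => g (T^[n] x))
        fun n _ => hg.comp (hT.iterate n)
  exact h.comp ((measurable_excursionTime hT).prodMk measurable_id)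

/-- Kakutani's formula for the integral over excursions. -/
theorem lintegral_eq_lintegral_excursion [IsFiniteMeasure μ] (hT : MeasurePreserving T μ μ)
    (hret : ∀ᵐ x ∂μ, ∃ n, 1 / 2 ≤ (T^[n] x : ℝ)) {g : I → ℝ≥0∞} (hg : Measurable g) {C : ℝ≥0∞}
    (hC : C ≠ ∞) (hgC : ∀ x, g x ≤ C) :
    ∫⁻ x, g x ∂μ
      = ∫⁻ x, ∑ n ∈ Finset.range (excursionTime T x), g (T^[n] x) ∂(inducedMeasure T μ) := by
  have hTm := hT.measurable
  set B : ℕ → Set I := fun n => {x | ∀ j < n, (T^[j] x : ℝ) < 1 / 2} with hB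
  have hBm : ∀ n, MeasurableSet (B n) := fun n => by
    have : B n = ⋂ j < n, {x : I | (T^[j] x : ℝ) < 1 / 2} := by ext; simp [hB]
    rw [this]
    exact MeasurableSet.iInter fun j => MeasurableSet.iInter fun _ =>
      measurableSet_lt (measurable_subtype_coe.comp (hTm.iterate j)) measurable_const
  set G : ℕ → I → ℝ≥0∞ := fun n => (B n).indicator fun x => g (T^[n] x) with hG
  have hGm : ∀ n, Measurable (G n) := fun n => (hg.comp (hTm.iterate n)).indicator (hBm n)
  have hGC : ∀ n x, G n x ≤ (B n).indicator (fun _ => C) x := fun n x =>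
    Set.indicator_le_indicator (hgC _)
  set Y : Set I := {x : I | 1 / 2 ≤ (x : ℝ)} with hY
  have hYm : MeasurableSet Y := measurableSet_half_le
  -- By invariance of μ one may look one step back. If that earlier point is in [1/2, 1] an
  -- excursion starts, giving the induced measure; otherwise the waiting time grows by one.
  have hstep : ∀ n, ∫⁻ x, G n x ∂μ = ∫⁻ x, G n x ∂(inducedMeasure T μ) + ∫⁻ x, G (n + 1) x ∂μ := by
    intro n
    have e1 : ∫⁻ x, G n x ∂μ = ∫⁻ x, G n (T x) ∂μ := (hT.lintegral_comp (hGm n)).symm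
    have e2 : ∫⁻ x, G n x ∂(inducedMeasure T μ) = ∫⁻ x in Y, G n (T x) ∂μ :=
      lintegral_map (hGm n) hTm
    have e3 : ∫⁻ x, G (n + 1) x ∂μ = ∫⁻ x in Yᶜ, G n (T x) ∂μ := by
      rw [← lintegral_indicator hYm.compl]
      refine lintegral_congr fun x => ?_
      have hiff : x ∈ B (n + 1) ↔ x ∈ Yᶜ ∧ T x ∈ B n := by
        simp only [hB, hY, Set.mem_ofPred_eq, Set.mem_compl_iff, not_le]
        constructor
        · intro h
          exact ⟨h 0 (by omega), fun j hj => h (j + 1) (by omega)⟩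
        · rintro ⟨h0, h1⟩ j hj
          cases j with
          | zero => exact h0
          | succ j => exact h1 j (by omega)
      by_cases h1 : x ∈ Yᶜ <;> by_cases h2 : T x ∈ B n <;>
        simp [hG, Set.indicator, hiff, h1, h2]
    rw [e1, e2, e3, lintegral_add_compl _ hYm]
  have hsum : ∀ N, ∫⁻ x, g x ∂μ
      = ∑ n ∈ Finset.range N, ∫⁻ x, G n x ∂(inducedMeasure T μ) + ∫⁻ x, G N x ∂μ := by
    intro N
    induction N with
    | zero =>
      have : B 0 = Set.univ := by ext; simp [hB]
      simp [hG, this]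
    | succ N ih => rw [ih, hstep N, Finset.sum_range_succ, add_assoc]
  -- The remainder lives on points that have avoided [1/2, 1] for N steps, and these sets decrease
  -- to a null set.
  have hrem : Tendsto (fun N => ∫⁻ x, G N x ∂μ) atTop (𝓝 0) := by
    have hanti : Antitone B := fun m n hmn x hx j hj => hx j (by omega)
    have hzero : μ (⋂ n, B n) = 0 := by
      refine measure_mono_null (fun x hx => ?_) hret
      simp only [Set.mem_iInter] at hx
      rintro ⟨n, hn⟩
      have := hx (n + 1) n (by omega)
      linarith
    have t1 := tendsto_measure_iInter_atTop (μ := μ) (fun n => (hBm n).nullMeasurableSet) hanti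
      ⟨0, measure_ne_top _ _⟩
    rw [hzero] at t1
    have t2 := ENNReal.Tendsto.const_mul (a := C) t1 (Or.inr hC)
    rw [mul_zero] at t2
    refine tendsto_of_tendsto_of_tendsto_of_le_of_le tendsto_const_nhds t2 (fun _ => bot_le) fun N => ?_
    calc ∫⁻ x, G N x ∂μ ≤ ∫⁻ x, (B N).indicator (fun _ => C) x ∂μ := lintegral_mono (hGC N)
      _ = C * μ (B N) := by rw [lintegral_indicator (hBm N), setLIntegral_const]
  have hlim := (ENNReal.summable.hasSum (f := fun n => ∫⁻ x, G n x ∂(inducedMeasure T μ))).tendsto_sum_nat.add hrem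
  rw [add_zero] at hlim
  have := tendsto_nhds_unique tendsto_const_nhds (hlim.congr fun N => (hsum N).symm)
  rw [this, ← lintegral_tsum fun n => (hGm n).aemeasurable]
  refine lintegral_congr_ae ?_
  filter_upwards [(Measure.absolutelyContinuous_of_le (inducedMeasure_le hT)).ae_le hret] with x hx
  rw [tsum_eq_sum (s := Finset.range (excursionTime T x))]
  · refine Finset.sum_congr rfl fun n hn => ?_
    exact Set.indicator_of_mem (s := B n) ((lt_excursionTime_iff hx).1 (Finset.mem_range.1 hn)) _
  · intro n hn
    exact Set.indicator_of_notMem (s := B n)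
      (fun h => hn (Finset.mem_range.2 ((lt_excursionTime_iff hx).2 h))) _

/-- Apply Kakutani's formula to the indicator of Y ∩ T⁻¹ s with Y = [1/2, 1]. Only the last point of
an excursion lies in Y, so the excursion sum is the indicator of G⁻¹ s, while the left side is the
induced measure of s. -/
theorem measurePreserving_jumpMap [IsFiniteMeasure μ] (hT : MeasurePreserving T μ μ)
    (hret : ∀ᵐ x ∂μ, ∃ n, 1 / 2 ≤ (T^[n] x : ℝ)) :
    MeasurePreserving (jumpMap T) (inducedMeasure T μ) (inducedMeasure T μ) := by
  have hTm := hT.measurable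
  have hGm := measurable_jumpMap hTm
  refine ⟨hGm, Measure.ext fun s hs => ?_⟩
  set Y : Set I := {x : I | 1 / 2 ≤ (x : ℝ)} with hY
  have hYm : MeasurableSet Y := measurableSet_half_le
  set g : I → ℝ≥0∞ := (Y ∩ T ⁻¹' s).indicator 1 with hg
  have hgm : Measurable g := measurable_one.indicator (hYm.inter (hTm hs))
  have e := lintegral_eq_lintegral_excursion hT hret hgm (C := 1) (by simp)
    (fun x => Set.indicator_le_self' (fun _ _ => zero_le_one) x)
  rw [hg, lintegral_indicator_one (hYm.inter (hTm hs))] at e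
  have e2 : inducedMeasure T μ s = μ (Y ∩ T ⁻¹' s) := by
    rw [inducedMeasure, Measure.map_apply hTm hs, Measure.restrict_apply (hTm hs), Set.inter_comm]
  rw [Measure.map_apply hGm hs, e2, e, ← lintegral_indicator_one (hGm hs)]
  refine lintegral_congr_ae ?_
  filter_upwards [(Measure.absolutelyContinuous_of_le (inducedMeasure_le hT)).ae_le hret] with x hx
  have hτ : excursionTime T x = (excursionTime T x - 1) + 1 := by unfold excursionTime; omega
  rw [hτ, Finset.sum_range_succ, Finset.sum_eq_zero, zero_add]
  · have h1 := half_le_iterate_excursionTime hx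
    have h2 : jumpMap T x = T (T^[excursionTime T x - 1] x) := by
      rw [← Function.iterate_succ_apply' T, jumpMap]; congr 1
    by_cases hs' : jumpMap T x ∈ s
    · rw [Set.indicator_of_mem (show x ∈ jumpMap T ⁻¹' s from hs'),
        Set.indicator_of_mem (show T^[excursionTime T x - 1] x ∈ Y ∩ T ⁻¹' s from
          ⟨h1, by rw [Set.mem_preimage, ← h2]; exact hs'⟩)]
      rfl
    · rw [Set.indicator_of_notMem (show x ∉ jumpMap T ⁻¹' s from hs'),
        Set.indicator_of_notMem fun h => hs' (by rw [h2]; exact h.2)]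
  · intro n hn
    have := lt_half_of_lt_excursionTime (T := T) (x := x) (j := n)
      (by have := Finset.mem_range.1 hn; omega)
    exact Set.indicator_of_notMem (fun h => by
      have h1 : 1 / 2 ≤ (T^[n] x : ℝ) := h.1
      linarith) _

/-- The excursion sum of an observable. -/
noncomputable def excursionSum (T : I → I) (v : I → ℝ) (x : I) : ℝ :=
  ∑ n ∈ Finset.range (excursionTime T x), v (T^[n] x)

theorem abs_excursionSum_le {v : I → ℝ} {C : ℝ} (hv : ∀ x, |v x| ≤ C) (x : I) :
    |excursionSum T v x| ≤ C * excursionTime T x := by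
  refine (Finset.abs_sum_le_sum_abs _ _).trans ((Finset.sum_le_card_nsmul _ _ C fun n _ => hv _).trans ?_)
  simp [mul_comm]

/-- Kakutani's formula for signed observables, by adding a constant. Its use is that a μ-centred v
has centred excursion sums. -/
theorem integral_eq_integral_excursionSum [IsFiniteMeasure μ] (hT : MeasurePreserving T μ μ)
    (hret : ∀ᵐ x ∂μ, ∃ n, 1 / 2 ≤ (T^[n] x : ℝ)) {v : I → ℝ} (hv : BddMeas v)
    (hi : Integrable (fun x => (excursionTime T x : ℝ)) (inducedMeasure T μ)) :
    ∫ x, v x ∂μ = ∫ x, excursionSum T v x ∂(inducedMeasure T μ) := by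
  obtain ⟨C, hC⟩ := hv.2
  have hVm : Measurable (excursionSum T v) := measurable_sum_range_excursionTime hT.measurable hv.1
  have hVi : Integrable (excursionSum T v) (inducedMeasure T μ) :=
    (hi.const_mul C).mono' hVm.aestronglyMeasurable (ae_of_all _ (abs_excursionSum_le hC))
  have key : ∀ w : I → ℝ, BddMeas w → (∀ x, 0 ≤ w x) →
      Integrable (excursionSum T w) (inducedMeasure T μ) →
      ∫ x, w x ∂μ = ∫ x, excursionSum T w x ∂(inducedMeasure T μ) := fun w hw hw0 hwi => by
    obtain ⟨C', hC'⟩ := hw.2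
    have e := lintegral_eq_lintegral_excursion hT hret hw.1.ennreal_ofReal (C := ENNReal.ofReal C')
      ENNReal.ofReal_ne_top (fun x => ENNReal.ofReal_le_ofReal ((le_abs_self _).trans (hC' x)))
    rw [integral_eq_lintegral_of_nonneg_ae (ae_of_all _ hw0) hw.1.aestronglyMeasurable,
      integral_eq_lintegral_of_nonneg_ae (f := excursionSum T w)
        (ae_of_all _ fun x => Finset.sum_nonneg fun n _ => hw0 _)
        hwi.aestronglyMeasurable, e]
    congr 1
    exact lintegral_congr fun x => (ENNReal.ofReal_sum_of_nonneg fun n _ => hw0 _).symm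
  have hadd : ∀ x, excursionSum T (fun y => v y + C) x
      = excursionSum T v x + C * excursionTime T x := fun x => by
    simp only [excursionSum, Finset.sum_add_distrib, Finset.sum_const, Finset.card_range,
      nsmul_eq_mul, mul_comm]
  have hcst : ∀ x, excursionSum T (fun _ => (1 : ℝ)) x = excursionTime T x := fun x => by
    simp [excursionSum]
  have k1 := key (fun y => v y + C) (hv.add (BddMeas.const C))
    (fun x => by have := neg_le_of_abs_le (hC x); linarith)
    ((hVi.add (hi.const_mul C)).congr (ae_of_all _ fun x => (hadd x).symm))
  have k2 := key (fun _ => 1) (BddMeas.const 1) (fun _ => zero_le_one)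
    (hi.congr (ae_of_all _ fun x => (hcst x).symm))
  simp only [hadd] at k1
  simp only [hcst] at k2
  rw [integral_add (hv.integrable μ) (integrable_const C), integral_add hVi (hi.const_mul C),
    integral_const_mul, ← k2] at k1
  simp only [integral_const, smul_eq_mul, mul_one] at k1
  linarith

end Kakutani

/-! ### The first return system of an intermittent map -/

/-- The measure `lam` governs the excursions of `T` from `[1/2, 1]`, with uniform constants, and
excursion sums of `η`-Hölder observables have martingale-coboundary decompositions. -/
structure ExcursionSystem (p η K C : ℝ) (T : I → I) (μ lam : Measure I) : Prop where
  isProbabilityMeasure : IsProbabilityMeasure lam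
  measurable_map : Measurable T
  returnSystem : ∀ k, 0 < k → ReturnSystem p K lam (jumpMap T) (excursionTime T) k
  volume_le : volume ≤ ENNReal.ofReal C • μ
  lintegral_le : ∀ g : I → ℝ≥0∞, Measurable g → ∀ B : ℝ≥0∞, B ≠ ∞ → (∀ x, g x ≤ B) →
    ∫⁻ x, g x ∂μ ≤ ∫⁻ x, ∑ n ∈ Finset.range (excursionTime T x), g (T^[n] x) ∂lam
  exists_decomposition : ∀ v : I → ℝ, (∀ x, |v x| ≤ 1) → (∀ x y, |v x - v y| ≤ dist x y ^ η) →
    ∫ x, v x ∂μ = 0 → ∀ k : ℕ, 0 < k → ∃ (c : ℝ) (V χ : I → ℝ), |c| ≤ C / k ∧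
      (∀ x, V x = (if excursionTime T x ≤ k then excursionSum T v x else 0) - c) ∧
      MartingaleCoboundary C lam (jumpMap T) (excursionTime T) k V χ

theorem continuous_of_abs_sub_le_rpow {η : ℝ} (hη : 0 < η) {v : I → ℝ}
    (hv : ∀ x y, |v x - v y| ≤ dist x y ^ η) : Continuous v := by
  refine continuous_iff_continuousAt.2 fun x => tendsto_iff_dist_tendsto_zero.2 ?_
  refine squeeze_zero (fun _ => dist_nonneg) (fun y => hv y x) ?_
  have : Continuous fun y : I => dist y x ^ η :=
    (continuous_id.dist continuous_const).rpow_const fun _ => Or.inr hη.le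
  simpa [Real.zero_rpow hη.ne'] using this.tendsto x

theorem excursionSum_inverseBranch {γ : ℝ} (hγ : 0 < γ) (v : I → ℝ) (a : ℕ) {z : I} (hz : (z : ℝ) < 1) :
    excursionSum (lsvMap γ hγ) v (inverseBranch hγ a z)
      = ∑ j ∈ Finset.range (a + 1), v (inverseBranch hγ (a - j) z) := by
  rw [excursionSum, excursionTime_inverseBranch hγ a hz]
  refine Finset.sum_congr rfl fun j hj => ?_
  congr 1
  exact Subtype.ext (iterate_lsvMap_inverseBranch hγ (by have := Finset.mem_range.1 hj; omega) hz)

/-- All constants are built from g, p and η before γ is chosen; this is the source of uniformity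
along the sequence. -/
theorem exists_excursionSystem_lsvMap {g p η : ℝ} (hg : 0 < g) (hp : 2 < p) (hgp : g * p < 1)
    (hη : 0 < η) (hη1 : η ≤ 1) : ∃ K C : ℝ, 1 ≤ K ∧ 1 ≤ C ∧ ∀ (γ : ℝ) (hγ : 0 < γ), γ ≤ g →
      ∀ μ : Measure I, IsACIP (lsvMap γ hγ) μ →
        ∃ lam : Measure I, ExcursionSystem p η K C (lsvMap γ hγ) μ lam := by
  set D : ℝ := 16 * Real.exp 4 with hD
  have hD0 : 0 ≤ D := by positivity
  set K₀ : ℝ := (3 / g + 1) ^ p / (1 - g * p) with hK₀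
  set A := coneConst D η with hA
  have hA1 : 1 ≤ A := one_le_coneConst hη hD0
  set K : ℝ := max 1 (Real.exp (2 * A + D) * K₀) with hK
  have hK1 : 1 ≤ K := le_max_left _ _
  set B : ℝ := 1 + K with hB
  set C : ℝ := max (max B (Real.exp A * K)) (2 * B * K₀ * Real.exp (3 * A) / (1 - coneRate D η)) with hC
  have hBC : B ≤ C := (le_max_left _ _).trans (le_max_left _ _)
  refine ⟨K, C, hK1, by linarith, fun γ hγ hγg μ hμ => ?_⟩
  set T := lsvMap γ hγ with hT
  have hp1 : 1 ≤ p := by linarith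
  have hγ1 : γ ≤ 1 := by nlinarith
  have h := fullBranchMap_lsvMap hγ hγg hp1 hgp
  have hTm : Measurable T := measurable_lsvMap hγ
  have hμp := hμ.isProbabilityMeasure
  have hμT := hμ.invariant
  have hret : ∀ᵐ x ∂μ, ∃ n, 1 / 2 ≤ (T^[n] x : ℝ) := by
    filter_upwards [hμ.absolutelyContinuous.ae_le ae_mem_Ioo_unitInterval] with x hx
    obtain ⟨n, -, hn⟩ := exists_half_le_iterate hγ hγ1 hx.1
    exact ⟨n, hn⟩
  obtain ⟨lam, hlam, hGlam, hvol, hkac, huniq, hcob⟩ := h.exists_invariant_measure hp1 hD0 hη hη1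
  set G := jumpMap T with hG
  set τ := excursionTime T with hτ
  have hτm : Measurable τ := measurable_excursionTime hTm
  have hτm' : Measurable fun x => (τ x : ℝ) := measurable_from_top.comp hτm
  have hτ1 : ∀ x, 1 ≤ τ x := h.one_le_time
  have hτ1' : ∀ x, (1 : ℝ) ≤ τ x := fun x => by exact_mod_cast hτ1 x
  have hkacK : ∀ w : I → ℝ≥0∞, Measurable w →
      ∫⁻ x, ENNReal.ofReal ((τ x : ℝ) ^ p) * w (G x) ∂lam ≤ ENNReal.ofReal K * ∫⁻ x, w x ∂lam :=
    fun w hw => (hkac w hw).trans (mul_le_mul_left (ENNReal.ofReal_le_ofReal (le_max_right _ _)) _)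
  have hmom : ∫⁻ x, ENNReal.ofReal ((τ x : ℝ) ^ p) ∂lam ≤ ENNReal.ofReal K := by
    simpa using hkacK (fun _ => 1) measurable_const
  set nu := inducedMeasure T μ with hnu
  have hnule : nu ≤ μ := inducedMeasure_le hμT
  have hnuf : IsFiniteMeasure nu := isFiniteMeasure_of_le μ hnule
  have hnuG : MeasurePreserving G nu nu := measurePreserving_jumpMap hμT hret
  have hnulam : nu = nu Set.univ • lam :=
    huniq nu hnuf hnuG ((Measure.absolutelyContinuous_of_le hnule).trans hμ.absolutelyContinuous)
  set c := nu Set.univ with hc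
  have hc1 : c ≤ 1 := (hnule _).trans_eq (measure_univ (μ := μ))
  have hnule2 : nu ≤ lam := by
    rw [hnulam]
    refine Measure.le_iff.2 fun s _ => ?_
    rw [Measure.smul_apply, smul_eq_mul]
    exact mul_le_of_le_one_left bot_le hc1
  have hτint : ∫⁻ x, ENNReal.ofReal (τ x : ℝ) ∂lam ≤ ENNReal.ofReal K := by
    refine (lintegral_mono fun x => ENNReal.ofReal_le_ofReal ?_).trans hmom
    conv_lhs => rw [← Real.rpow_one (τ x : ℝ)]
    exact Real.rpow_le_rpow_of_exponent_le (hτ1' x) hp1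
  have hτpi : Integrable (fun x => (τ x : ℝ) ^ p) lam := by
    refine ⟨(h.measurable_time_rpow p).aestronglyMeasurable, ?_⟩
    rw [hasFiniteIntegral_iff_ofReal (ae_of_all _ fun x => by positivity)]
    exact hmom.trans_lt ENNReal.ofReal_lt_top
  have hτi : Integrable (fun x => (τ x : ℝ)) lam := by
    refine ⟨hτm'.aestronglyMeasurable, ?_⟩
    rw [hasFiniteIntegral_iff_ofReal (ae_of_all _ fun x => by positivity)]
    exact hτint.trans_lt ENNReal.ofReal_lt_top
  -- Kakutani's formula for the constant 1 says that c times the λ-mean of τ is 1. So c is bounded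
  -- below, and Lebesgue measure is dominated through λ by a multiple of the induced measure, hence
  -- by μ.
  have hcK : 1 ≤ c * ENNReal.ofReal K := by
    have e := lintegral_eq_lintegral_excursion hμT hret (g := fun _ => 1) measurable_const
      (C := 1) (by simp) (fun _ => le_rfl)
    simp only [lintegral_const, measure_univ, mul_one, Finset.sum_const, Finset.card_range,
      nsmul_eq_mul] at e
    rw [e, ← hnu, hnulam, lintegral_smul_measure, smul_eq_mul]
    refine mul_le_mul_right (le_trans (le_of_eq (lintegral_congr fun x => ?_)) hτint) _
    simp [hτ]
  refine ⟨lam, hlam, hTm, fun k hk => ⟨hGlam, hτm, hτ1, hkacK, hk⟩, ?_, ?_, ?_⟩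
  · refine Measure.le_iff.2 fun s hs => ?_
    rw [Measure.smul_apply, smul_eq_mul]
    have h1 := hvol s
    rw [Measure.smul_apply, smul_eq_mul] at h1
    have h2 : c * lam s ≤ μ s := by
      have := hnule s
      rwa [hnulam, Measure.smul_apply, smul_eq_mul] at this
    calc volume s ≤ ENNReal.ofReal (Real.exp A) * (1 * lam s) := by rwa [one_mul]
      _ ≤ ENNReal.ofReal (Real.exp A) * (c * ENNReal.ofReal K * lam s) := by gcongr
      _ = ENNReal.ofReal (Real.exp A * K) * (c * lam s) := by
          rw [ENNReal.ofReal_mul (Real.exp_pos _).le]; ring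
      _ ≤ ENNReal.ofReal C * μ s :=
          mul_le_mul' (ENNReal.ofReal_le_ofReal ((le_max_right _ _).trans (le_max_left _ _))) h2
  · intro w hw b hb hwb
    rw [lintegral_eq_lintegral_excursion hμT hret hw hb hwb]
    exact lintegral_mono' hnule2 le_rfl
  · intro v hv1 hvη hv0 k hk
    have hk1 : (1 : ℝ) ≤ k := by exact_mod_cast hk
    have hvc := continuous_of_abs_sub_le_rpow hη hvη
    have hvb : BddMeas v := ⟨hvc.measurable, 1, hv1⟩
    have hSm : Measurable (excursionSum T v) := measurable_sum_range_excursionTime hTm hvb.1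
    have hSτ : ∀ x, |excursionSum T v x| ≤ τ x := fun x => by
      simpa using abs_excursionSum_le (T := T) hv1 x
    have hSi : Integrable (excursionSum T v) lam :=
      hτi.mono' hSm.aestronglyMeasurable (ae_of_all _ hSτ)
    have hS0 : ∫ x, excursionSum T v x ∂lam = 0 := by
      have e := integral_eq_integral_excursionSum hμT hret hvb (hτi.mono_measure hnule2)
      rw [hv0, ← hnu, hnulam, integral_smul_measure, smul_eq_mul] at e
      rcases mul_eq_zero.1 e.symm with h0 | h0
      · rw [ENNReal.toReal_eq_zero_iff] at h0
        rcases h0 with h0 | h0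
        · rw [h0, zero_mul] at hcK; simp at hcK
        · rw [h0] at hc1; simp at hc1
      · exact h0
    -- Long excursions are discarded, not cut short, so W is still Hölder on each branch. The mean
    -- lost in this way is e.
    set W : I → ℝ := fun x => if τ x ≤ k then excursionSum T v x else 0 with hW
    have hWm : Measurable W := Measurable.ite (measurableSet_le hτm measurable_const) hSm measurable_const
    have hWb : BddMeas W := ⟨hWm, k, fun x => by
      simp only [hW]
      split_ifs with hx
      · exact (hSτ x).trans (by exact_mod_cast hx)
      · simp⟩
    set e := ∫ x, W x ∂lam with he
    -- Where τ > k, one has τ ≤ τ^2 / k ≤ τ^p / k; hence the recentring constant is O(1 / k),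
    -- harmless over k steps.
    have hWS : ∀ x, |W x - excursionSum T v x| ≤ (τ x : ℝ) ^ p / k := fun x => by
      have hp0 : 0 ≤ (τ x : ℝ) ^ p / k := by positivity
      simp only [hW]
      split_ifs with hx
      · simpa using hp0
      · rw [zero_sub, abs_neg]
        refine (hSτ x).trans ?_
        rw [le_div_iff₀ (by linarith)]
        have h1 : (k : ℝ) ≤ τ x := by exact_mod_cast (not_le.1 hx).le
        calc (τ x : ℝ) * k ≤ (τ x : ℝ) * τ x := by gcongr
          _ = (τ x : ℝ) ^ (2 : ℝ) := by rw [Real.rpow_two]; ring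
          _ ≤ (τ x : ℝ) ^ p := Real.rpow_le_rpow_of_exponent_le (hτ1' x) hp.le
    have hτpK : ∫ x, (τ x : ℝ) ^ p ∂lam ≤ K := by
      rw [← ENNReal.ofReal_le_ofReal_iff (by linarith),
        ofReal_integral_eq_lintegral_ofReal hτpi (ae_of_all _ fun x => by positivity)]
      exact hmom
    have heK : |e| ≤ K / k := by
      have h1 : e = ∫ x, (W x - excursionSum T v x) ∂lam := by
        rw [integral_sub (hWb.integrable lam) hSi, hS0, sub_zero]
      rw [h1]
      calc |∫ x, (W x - excursionSum T v x) ∂lam| ≤ ∫ x, |W x - excursionSum T v x| ∂lam :=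
            abs_integral_le_integral_abs
        _ ≤ ∫ x, (τ x : ℝ) ^ p / k ∂lam :=
            integral_mono ((hWb.integrable lam).sub hSi).abs (hτpi.div_const _) hWS
        _ = (∫ x, (τ x : ℝ) ^ p ∂lam) / k := integral_div _ _
        _ ≤ K / k := by gcongr
    have heK1 : |e| ≤ K := heK.trans (div_le_self (by linarith) hk1)
    have hWτ : ∀ x, |W x| ≤ min (τ x : ℝ) k := fun x => by
      simp only [hW]
      split_ifs with hx
      · rw [min_eq_left (by exact_mod_cast hx)]; exact hSτ x
      · rw [abs_zero]; positivity
    have hmin1 : ∀ x, (1 : ℝ) ≤ min (τ x : ℝ) k := fun x => le_min (hτ1' x) hk1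
    have hVmin : ∀ x, |W x - e| ≤ B * min (τ x : ℝ) k := fun x => by
      have h1 := hWτ x
      have h2 := hmin1 x
      have h3 := abs_sub (W x) e
      rw [hB]; nlinarith
    have hVb : BddMeas fun x => W x - e := hWb.sub (BddMeas.const e)
    set β : ℕ → I → ℝ := fun a z =>
      (if a + 1 ≤ k then ∑ j ∈ Finset.range (a + 1), v (inverseBranch hγ (a - j) z) else 0) - e with hβ
    have hβ1 : ∀ a z, |β a z| ≤ B * ((a : ℝ) + 1) := fun a z => by
      have h1 : |if a + 1 ≤ k then ∑ j ∈ Finset.range (a + 1), v (inverseBranch hγ (a - j) z) else 0|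
          ≤ (a : ℝ) + 1 := by
        split_ifs
        · refine (Finset.abs_sum_le_sum_abs _ _).trans
            ((Finset.sum_le_card_nsmul _ _ 1 fun n _ => hv1 _).trans ?_)
          simp
        · rw [abs_zero]; positivity
      refine (abs_sub _ _).trans ?_
      have : (0 : ℝ) ≤ a := a.cast_nonneg
      rw [hB]; nlinarith
    have hβ2 : ∀ a x y, β a x - β a y ≤ B * ((a : ℝ) + 1) * dist x y ^ η := fun a x y => by
      have h0 : 0 ≤ dist x y ^ η := by positivity
      have ha : (0 : ℝ) ≤ a := a.cast_nonneg
      simp only [hβ]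
      rw [sub_sub_sub_cancel_right]
      split_ifs
      · rw [← Finset.sum_sub_distrib]
        calc _ ≤ ∑ j ∈ Finset.range (a + 1), dist x y ^ η := Finset.sum_le_sum fun j _ => by
              refine (le_of_abs_le (hvη _ _)).trans (Real.rpow_le_rpow dist_nonneg ?_ hη.le)
              have := h.contracting (a - j) x y
              have := dist_nonneg (x := x) (y := y)
              linarith
          _ = 1 * ((a : ℝ) + 1) * dist x y ^ η := by simp
          _ ≤ _ := by gcongr; linarith
      · rw [sub_zero]
        have : 0 ≤ B := by linarith
        positivity
    have hβ3 : ∀ a (z : I), (z : ℝ) < 1 → W (inverseBranch hγ a z) - e = β a z := fun a z hz => by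
      simp only [hβ, hW]
      rw [h.time_branch a z hz, excursionSum_inverseBranch hγ v a hz]
    have hβ4 : ∫ x, W x - e ∂lam = 0 := by
      rw [integral_sub (hWb.integrable lam) (integrable_const _)]
      simp [he]
    obtain ⟨χ, hχ1, hχ2, hχ3⟩ := hcob (fun x => W x - e) β B (by linarith) hVb
      (fun x => (hVmin x).trans (mul_le_mul_of_nonneg_left (min_le_left _ _) (by linarith)))
      hβ1 hβ2 hβ3 hβ4
    refine ⟨e, fun x => W x - e, χ, heK.trans ?_, fun x => rfl, hVb, hχ1, fun x => ?_, fun x => ?_, hχ3⟩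
    · gcongr; linarith
    · exact (hVmin x).trans (mul_le_mul_of_nonneg_right hBC (by linarith [hmin1 x]))
    · exact (hχ2 x).trans (le_max_right _ _)

/-! ### Sums along orbits in terms of excursions -/

section Pathwise

theorem iterSum_eq_sum {X : Type*} (G : X → X) (v w : X → ℝ) (n : ℕ) (x : X) :
    iterSum G v w n x = ∑ j ∈ Finset.range n, birkhoffSum G v j x * w (G^[j] x) := by
  induction n with
  | zero => rfl
  | succ n ih =>
    rw [iterSum_add, Finset.sum_range_succ, ← ih]
    simp [iterSum]

theorem abs_birkhoffSum_le {X : Type*} (G : X → X) {v : X → ℝ} (hv : ∀ x, |v x| ≤ 1) (n : ℕ) (x : X) :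
    |birkhoffSum G v n x| ≤ n := by
  refine (Finset.abs_sum_le_sum_abs _ _).trans ((Finset.sum_le_card_nsmul _ _ 1 fun n _ => hv _).trans ?_)
  simp

theorem abs_iterSum_le {X : Type*} (G : X → X) {v w : X → ℝ} (hv : ∀ x, |v x| ≤ 1)
    (hw : ∀ x, |w x| ≤ 1) (n : ℕ) (x : X) : |iterSum G v w n x| ≤ (n : ℝ) ^ 2 := by
  rw [iterSum_eq_sum]
  refine (Finset.abs_sum_le_sum_abs _ _).trans
    ((Finset.sum_le_card_nsmul _ _ (n : ℝ) fun j hj => ?_).trans (le_of_eq ?_))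
  · rw [abs_mul]
    have h1 := abs_birkhoffSum_le G hv j x
    have h2 : (j : ℝ) ≤ n := by exact_mod_cast (Finset.mem_range.1 hj).le
    have h3 := hw (G^[j] x)
    have h4 := abs_nonneg (w (G^[j] x))
    nlinarith
  · simp [sq]

/-- Adding constants changes iterated sums by controlled amounts. -/
theorem abs_iterSum_add_const_le {X : Type*} (G : X → X) (V W : X → ℝ) {c c' C R : ℝ} {k N : ℕ} {x : X}
    (hk : 0 < k) (hN : N ≤ k) (hc : |c| ≤ C / k) (hc' : |c'| ≤ C / k)
    (hV : ∀ n ≤ k, |birkhoffSum G V n x| ≤ R) (hW : ∀ n ≤ k, |birkhoffSum G W n x| ≤ R) :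
    |iterSum G (fun y => V y + c) (fun y => W y + c') N x - iterSum G V W N x|
      ≤ 3 * C * R + C ^ 2 := by
  have hk0 : (0 : ℝ) < k := by exact_mod_cast hk
  have hNk : (N : ℝ) ≤ k := by exact_mod_cast hN
  have hR : 0 ≤ R := (abs_nonneg _).trans (hV 0 (Nat.zero_le _))
  have hC : 0 ≤ C / k := (abs_nonneg _).trans hc
  have hC0 : 0 ≤ C := by
    have := mul_nonneg hC hk0.le
    rwa [div_mul_cancel₀ _ hk0.ne'] at this
  have hbc : ∀ n, birkhoffSum G (fun y => V y + c) n x = birkhoffSum G V n x + n * c := fun n => by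
    simp [birkhoffSum, Finset.sum_add_distrib]
  -- Summation by parts, so that the weights j meet Birkhoff sums of size R and not individual
  -- terms.
  have hby : ∑ j ∈ Finset.range N, (j : ℝ) * W (G^[j] x)
      = ∑ j ∈ Finset.range N, (birkhoffSum G W N x - birkhoffSum G W (j + 1) x) := by
    clear hN hNk
    induction N with
    | zero => simp
    | succ N ih =>
      rw [Finset.sum_range_succ, ih, Finset.sum_range_succ _ N, sub_self, add_zero]
      simp only [birkhoffSum_succ G W N, Finset.sum_sub_distrib, Finset.sum_const, Finset.card_range,
        nsmul_eq_mul]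
      ring
  have key : iterSum G (fun y => V y + c) (fun y => W y + c') N x - iterSum G V W N x
      = ∑ j ∈ Finset.range N, (c * (birkhoffSum G W N x - birkhoffSum G W (j + 1) x)
        + (c' * birkhoffSum G V j x + c * c' * j)) := by
    rw [Finset.sum_add_distrib, ← Finset.mul_sum, ← hby, Finset.mul_sum, ← Finset.sum_add_distrib,
      iterSum_eq_sum, iterSum_eq_sum, ← Finset.sum_sub_distrib]
    refine Finset.sum_congr rfl fun j _ => ?_
    rw [hbc]; ring
  rw [key]
  have hb : ∀ j ∈ Finset.range N, |c * (birkhoffSum G W N x - birkhoffSum G W (j + 1) x)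
        + (c' * birkhoffSum G V j x + c * c' * j)| ≤ C / k * (2 * R) + (C / k * R + C / k * (C / k) * k) := by
    intro j hj
    have hj' := Finset.mem_range.1 hj
    have hjk : (j : ℝ) ≤ k := by exact_mod_cast (hj'.le.trans hN)
    refine (abs_add_le _ _).trans (add_le_add ?_ ((abs_add_le _ _).trans (add_le_add ?_ ?_)))
    · rw [abs_mul]
      refine mul_le_mul hc ((abs_sub _ _).trans ?_) (abs_nonneg _) hC
      have := hW N hN
      have := hW (j + 1) (by omega)
      linarith
    · rw [abs_mul]
      exact mul_le_mul hc' (hV j (by omega)) (abs_nonneg _) hC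
    · rw [abs_mul, abs_mul, Nat.abs_cast]
      exact mul_le_mul (mul_le_mul hc hc' (abs_nonneg _) hC) hjk (Nat.cast_nonneg _) (by positivity)
  refine (Finset.abs_sum_le_sum_abs _ _).trans ((Finset.sum_le_card_nsmul _ _ _ hb).trans ?_)
  rw [Finset.card_range, nsmul_eq_mul]
  calc (N : ℝ) * (C / k * (2 * R) + (C / k * R + C / k * (C / k) * k))
      ≤ k * (C / k * (2 * R) + (C / k * R + C / k * (C / k) * k)) := by gcongr
    _ = 3 * C * R + C ^ 2 := by field_simp; ring

variable {T : I → I}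

theorem excursionTime_pos (T : I → I) (x : I) : 0 < excursionTime T x := Nat.succ_pos _

theorem iterate_birkhoffSum_excursionTime (T : I → I) (N : ℕ) (x : I) :
    T^[birkhoffSum (jumpMap T) (excursionTime T) N x] x = (jumpMap T)^[N] x := by
  induction N generalizing x with
  | zero => rfl
  | succ N ih =>
    rw [birkhoffSum_succ', add_comm, Function.iterate_add_apply, Function.iterate_succ_apply]
    exact ih (jumpMap T x)

/-- Time j falls i steps into the excursion number N, counted from 0. Excursions last at least one
step, whence N ≤ j. -/
theorem exists_excursion_split (T : I → I) (j : ℕ) (x : I) : ∃ N i, N ≤ j ∧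
    birkhoffSum (jumpMap T) (excursionTime T) N x + i = j ∧
      i < excursionTime T ((jumpMap T)^[N] x) := by
  induction j using Nat.strong_induction_on generalizing x with
  | _ j ih =>
    have h0 := excursionTime_pos T x
    by_cases hj : j < excursionTime T x
    · exact ⟨0, j, Nat.zero_le _, by simp, hj⟩
    · obtain ⟨N, i, h1, h2, h3⟩ := ih (j - excursionTime T x) (by omega) (jumpMap T x)
      refine ⟨N + 1, i, by omega, ?_, h3⟩
      rw [birkhoffSum_succ']
      omega

theorem birkhoffSum_excursion (T : I → I) (v : I → ℝ) (N : ℕ) (x : I) :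
    birkhoffSum T v (birkhoffSum (jumpMap T) (excursionTime T) N x) x
      = birkhoffSum (jumpMap T) (excursionSum T v) N x := by
  induction N generalizing x with
  | zero => rfl
  | succ N ih =>
    rw [birkhoffSum_succ', birkhoffSum_add, birkhoffSum_succ', ← ih]
    rfl

/-- Chen's relation over whole excursions: pairs in different excursions form an iterated sum for
the jump map, and pairs in the same excursion give the second term. -/
theorem iterSum_excursion (T : I → I) (v w : I → ℝ) (N : ℕ) (x : I) :
    iterSum T v w (birkhoffSum (jumpMap T) (excursionTime T) N x) x
      = iterSum (jumpMap T) (excursionSum T v) (excursionSum T w) N x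
        + birkhoffSum (jumpMap T) (fun y => iterSum T v w (excursionTime T y) y) N x := by
  induction N generalizing x with
  | zero => simp [iterSum]
  | succ N ih =>
    rw [birkhoffSum_succ', iterSum_add, birkhoffSum_succ' _ (fun y => iterSum T v w _ y)]
    have e : T^[excursionTime T x] x = jumpMap T x := rfl
    have e' : birkhoffSum T v (excursionTime T x) x = excursionSum T v x := rfl
    rw [e, e', ih, birkhoffSum_excursion, iterSum]
    ring

/-- Sums of an observable and of its truncated excursion sums. -/
theorem pathwise_bound {v w V W : I → ℝ} {c c' C h : ℝ} {k : ℕ} {x : I} (hk : 0 < k) (hC : 1 ≤ C)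
    (hv : ∀ x, |v x| ≤ 1) (hw : ∀ x, |w x| ≤ 1) (hc : |c| ≤ C / k) (hc' : |c'| ≤ C / k)
    (hVc : ∀ x, V x = (if excursionTime T x ≤ k then excursionSum T v x else 0) - c)
    (hWc : ∀ x, W x = (if excursionTime T x ≤ k then excursionSum T w x else 0) - c')
    (hV : ∀ N ≤ k, birkhoffSum (jumpMap T) V N x ^ 2 ≤ h ∧ birkhoffSum (jumpMap T) W N x ^ 2 ≤ h)
    (hQ : birkhoffSum (jumpMap T) (fun y => (min (excursionTime T y : ℝ) k) ^ 2) (k + 1) x ≤ h)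
    {j : ℕ} (hj : j ≤ k) :
    birkhoffSum T v j x ^ 2 ≤ 8 * C ^ 2 * (h + 1) ∧
      ((∀ N ≤ k, |iterSum (jumpMap T) V W N x| ≤ h) → |iterSum T v w j x| ≤ 8 * C ^ 2 * (h + 1)) := by
  have hk0 : (0 : ℝ) < k := by exact_mod_cast hk
  have hh : 0 ≤ h := (sq_nonneg _).trans (hV 0 (Nat.zero_le _)).1
  set R := Real.sqrt h with hR
  have hR0 : 0 ≤ R := Real.sqrt_nonneg _
  have hRR : R ^ 2 = h := Real.sq_sqrt hh
  have hVR : ∀ n ≤ k, |birkhoffSum (jumpMap T) V n x| ≤ R := fun n hn =>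
    Real.abs_le_sqrt (hV n hn).1
  have hWR : ∀ n ≤ k, |birkhoffSum (jumpMap T) W n x| ≤ R := fun n hn =>
    Real.abs_le_sqrt (hV n hn).2
  obtain ⟨N, i, hNj, hsum, hi⟩ := exists_excursion_split T j x
  have hNk : N ≤ k := hNj.trans hj
  set t := birkhoffSum (jumpMap T) (excursionTime T) N x with ht
  -- An excursion completed by time j ≤ k is no longer than k, so the truncation is invisible along
  -- this orbit segment.
  have hτk : ∀ l < N, excursionTime T ((jumpMap T)^[l] x) ≤ k := fun l hl => by
    have : excursionTime T ((jumpMap T)^[l] x) ≤ t :=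
      Finset.single_le_sum (f := fun l => excursionTime T ((jumpMap T)^[l] x))
        (fun _ _ => Nat.zero_le _) (Finset.mem_range.2 hl)
    omega
  have hSV : ∀ l < N, excursionSum T v ((jumpMap T)^[l] x) = V ((jumpMap T)^[l] x) + c :=
    fun l hl => by rw [hVc, if_pos (hτk l hl)]; ring
  have hSW : ∀ l < N, excursionSum T w ((jumpMap T)^[l] x) = W ((jumpMap T)^[l] x) + c' :=
    fun l hl => by rw [hWc, if_pos (hτk l hl)]; ring
  have hbV : ∀ n ≤ N, birkhoffSum (jumpMap T) (excursionSum T v) n x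
      = birkhoffSum (jumpMap T) (fun y => V y + c) n x := fun n hn =>
    Finset.sum_congr rfl fun l hl => hSV l ((Finset.mem_range.1 hl).trans_le hn)
  set m : ℝ := min (excursionTime T ((jumpMap T)^[N] x) : ℝ) k with hm
  have him : (i : ℝ) ≤ m := le_min (by exact_mod_cast hi.le) (by exact_mod_cast (by omega : i ≤ k))
  have hi0 : (0 : ℝ) ≤ i := i.cast_nonneg
  set Q : ℝ := birkhoffSum (jumpMap T) (fun y => (min (excursionTime T y : ℝ) k) ^ 2) N x with hQdef
  have hQ0 : 0 ≤ Q := Finset.sum_nonneg fun _ _ => sq_nonneg _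
  -- The unfinished excursion has index N ≤ k; this is why the hypothesis sums k + 1 squared times.
  have hQm : Q + m ^ 2 ≤ h := by
    refine le_trans ?_ hQ
    rw [hQdef, hm, ← birkhoffSum_succ (jumpMap T) (fun y => (min (excursionTime T y : ℝ) k) ^ 2)]
    exact Finset.sum_le_sum_of_subset_of_nonneg (Finset.range_mono (by omega))
      fun _ _ _ => sq_nonneg _
  have hmR : m ≤ R := Real.le_sqrt_of_sq_le (by linarith)
  have hN1 : |(N : ℝ) * c| ≤ C := by
    rw [abs_mul, Nat.abs_cast]
    calc (N : ℝ) * |c| ≤ k * (C / k) :=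
          mul_le_mul (by exact_mod_cast hNk) hc (abs_nonneg _) hk0.le
      _ = C := by field_simp
  have hSt : |birkhoffSum T v t x| ≤ R + C := by
    rw [ht, birkhoffSum_excursion, hbV N le_rfl]
    have e : birkhoffSum (jumpMap T) (fun y => V y + c) N x = birkhoffSum (jumpMap T) V N x + N * c := by
      simp [birkhoffSum, Finset.sum_add_distrib]
    rw [e]
    exact (abs_add_le _ _).trans (add_le_add (hVR N hNk) hN1)
  have hTt : T^[t] x = (jumpMap T)^[N] x := iterate_birkhoffSum_excursionTime T N x
  constructor
  · rw [← hsum, birkhoffSum_add, hTt, ← sq_abs]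
    have h1 : |birkhoffSum T v t x + birkhoffSum T v i ((jumpMap T)^[N] x)| ≤ 2 * R + C := by
      have := abs_birkhoffSum_le T hv i ((jumpMap T)^[N] x)
      refine (abs_add_le _ _).trans ?_
      linarith
    calc _ ≤ (2 * R + C) ^ 2 := pow_le_pow_left₀ (abs_nonneg _) h1 2
      _ ≤ 8 * C ^ 2 * (h + 1) := by
        rw [← hRR]
        have : R ^ 2 ≤ C ^ 2 * R ^ 2 := le_mul_of_one_le_left (sq_nonneg _) (one_le_pow₀ hC)
        nlinarith [sq_nonneg (2 * R - C)]
  · intro hI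
    rw [← hsum, iterSum_add, hTt, ht, iterSum_excursion]
    have e1 : iterSum (jumpMap T) (excursionSum T v) (excursionSum T w) N x
        = iterSum (jumpMap T) (fun y => V y + c) (fun y => W y + c') N x := by
      rw [iterSum_eq_sum, iterSum_eq_sum]
      refine Finset.sum_congr rfl fun l hl => ?_
      have hl' := Finset.mem_range.1 hl
      rw [hbV l hl'.le, hSW l hl']
    have e2 := abs_iterSum_add_const_le (jumpMap T) V W hk hNk hc hc' hVR hWR
    have e3 : |birkhoffSum (jumpMap T) (fun y => iterSum T v w (excursionTime T y) y) N x| ≤ Q := by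
      refine (Finset.abs_sum_le_sum_abs _ _).trans (Finset.sum_le_sum fun l hl => ?_)
      have h1 := hτk l (Finset.mem_range.1 hl)
      simp only
      rw [min_eq_left (by exact_mod_cast h1)]
      exact abs_iterSum_le T hv hw _ _
    have e4 := abs_iterSum_le T hv hw i ((jumpMap T)^[N] x)
    have e5 := abs_birkhoffSum_le T hw i ((jumpMap T)^[N] x)
    have e6 := hI N hNk
    have e7 : (i : ℝ) ^ 2 ≤ m ^ 2 := pow_le_pow_left₀ hi0 him 2
    have e8 : |birkhoffSum T v t x * birkhoffSum T w i ((jumpMap T)^[N] x)| ≤ (R + C) * R := by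
      rw [abs_mul]
      exact mul_le_mul hSt (e5.trans (him.trans hmR)) (abs_nonneg _) (by linarith)
    rw [e1, ← ht]
    have e9 : |iterSum (jumpMap T) (fun y => V y + c) (fun y => W y + c') N x| ≤ 3 * C * R + C ^ 2 + h := by
      have := abs_add_le (iterSum (jumpMap T) (fun y => V y + c) (fun y => W y + c') N x
        - iterSum (jumpMap T) V W N x) (iterSum (jumpMap T) V W N x)
      rw [sub_add_cancel] at this
      linarith
    refine (abs_add_le _ _).trans ?_
    refine (add_le_add_left ((abs_add_le _ _).trans (add_le_add_left (abs_add_le _ _) _)) _).trans ?_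
    have : R ^ 2 ≤ C ^ 2 * R ^ 2 := le_mul_of_one_le_left (sq_nonneg _) (one_le_pow₀ hC)
    nlinarith [sq_nonneg (R - C)]

/-- Sums started inside an excursion. -/
theorem pathwise_bound_iterate {v w : I → ℝ} {z : ℝ} {k n : ℕ} {u : I} (hv : ∀ x, |v x| ≤ 1)
    (hw : ∀ x, |w x| ≤ 1) (hn : n < excursionTime T u)
    (hz : ∀ j ≤ k, birkhoffSum T v j (jumpMap T u) ^ 2 ≤ z ∧ birkhoffSum T w j (jumpMap T u) ^ 2 ≤ z ∧
      |iterSum T v w j (jumpMap T u)| ≤ z) :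
    birkhoffSum T v k (T^[n] u) ^ 2 ≤ 2 * ((min (excursionTime T u : ℝ) k) ^ 2 + z) ∧
      |iterSum T v w k (T^[n] u)| ≤ 2 * ((min (excursionTime T u : ℝ) k) ^ 2 + z) := by
  set m := min (excursionTime T u : ℝ) k with hm
  have hz0 : 0 ≤ z := (sq_nonneg _).trans (hz 0 (Nat.zero_le _)).1
  set r := excursionTime T u - n with hr
  -- Either the whole sum stays in the current excursion and trivial bounds suffice, or it continues
  -- from the start of the next one, where the bound z applies.
  by_cases hk : k ≤ r
  · have hkm : (k : ℝ) ≤ m := le_min (by exact_mod_cast (by omega : k ≤ excursionTime T u)) le_rfl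
    have h1 := abs_birkhoffSum_le T hv k (T^[n] u)
    have h2 := abs_iterSum_le T hv hw k (T^[n] u)
    have h3 : (k : ℝ) ^ 2 ≤ m ^ 2 := pow_le_pow_left₀ (Nat.cast_nonneg _) hkm 2
    have h4 : birkhoffSum T v k (T^[n] u) ^ 2 ≤ (k : ℝ) ^ 2 := by
      rw [← sq_abs]; exact pow_le_pow_left₀ (abs_nonneg _) h1 2
    have h5 := sq_nonneg m
    constructor <;> linarith
  · have hkr : k = r + (k - r) := by omega
    have hrm : (r : ℝ) ≤ m := le_min (by exact_mod_cast (by omega : r ≤ excursionTime T u))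
      (by exact_mod_cast (by omega : r ≤ k))
    have hit : T^[r] (T^[n] u) = jumpMap T u := by
      rw [← Function.iterate_add_apply, jumpMap]; congr 1; omega
    obtain ⟨z1, z2, z3⟩ := hz (k - r) (by omega)
    have h1 := (abs_birkhoffSum_le T hv r (T^[n] u)).trans hrm
    have h2 := abs_iterSum_le T hv hw r (T^[n] u)
    have h3 : (r : ℝ) ^ 2 ≤ m ^ 2 := pow_le_pow_left₀ (Nat.cast_nonneg _) hrm 2
    have h4 : birkhoffSum T v r (T^[n] u) ^ 2 ≤ m ^ 2 := by
      rw [← sq_abs]; exact pow_le_pow_left₀ (abs_nonneg _) h1 2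
    have h6 : |birkhoffSum T v r (T^[n] u) * birkhoffSum T w (k - r) (jumpMap T u)| ≤ (m ^ 2 + z) / 2 := by
      rw [abs_mul]
      nlinarith [sq_nonneg (|birkhoffSum T v r (T^[n] u)| - |birkhoffSum T w (k - r) (jumpMap T u)|),
        sq_abs (birkhoffSum T v r (T^[n] u)), sq_abs (birkhoffSum T w (k - r) (jumpMap T u))]
    constructor
    · rw [hkr, birkhoffSum_add, hit]
      nlinarith [sq_nonneg (birkhoffSum T v r (T^[n] u) - birkhoffSum T v (k - r) (jumpMap T u))]
    · rw [hkr, iterSum_add, hit]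
      refine (abs_add_le _ _).trans ((add_le_add_left (abs_add_le _ _) _).trans ?_)
      nlinarith [sq_nonneg m]

end Pathwise

/-! ### Moment bounds -/

theorem eLpNorm_le_of_lintegral_rpow_le {X : Type*} [MeasurableSpace X] {μ : Measure X} {f : X → ℝ}
    {s M : ℝ} (hs : 0 < s) (hM : 0 ≤ M)
    (h : ∫⁻ x, ENNReal.ofReal (|f x| ^ s) ∂μ ≤ ENNReal.ofReal (M ^ s)) :
    eLpNorm f (ENNReal.ofReal s) μ ≤ ENNReal.ofReal M := by
  rw [eLpNorm_eq_lintegral_rpow_enorm_toReal (by simpa using hs) ENNReal.ofReal_ne_top,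
    ENNReal.toReal_ofReal hs.le, one_div, ENNReal.rpow_inv_le_iff hs,
    ENNReal.ofReal_rpow_of_nonneg hM hs.le]
  refine le_trans (le_of_eq (lintegral_congr fun x => ?_)) h
  rw [Real.enorm_eq_ofReal_abs, ENNReal.ofReal_rpow_of_nonneg (abs_nonneg _) hs.le]

namespace ExcursionSystem

variable {p η K C : ℝ} {T : I → I} {μ lam : Measure I}

/-- Summing over an excursion costs a factor τ. With q = p - 1, of the 2 q powers of min(τ, k) half
are paid by k^q, and the rest combine with τ into τ^p. Z is evaluated after the excursion, so `kac`
separates it from τ. -/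
theorem lintegral_rpow_le (h : ExcursionSystem p η K C T μ lam) (hp : 2 < p) (hK : 1 ≤ K) {k : ℕ}
    (hk : 0 < k) {F Z : I → ℝ} (hF : BddMeas F) (hF0 : ∀ x, 0 ≤ F x) (hZ : BddMeas Z)
    (hZ0 : ∀ x, 0 ≤ Z x) {M : ℝ} (hM : ∫ x, Z x ^ (p - 1) ∂lam ≤ M)
    (hFZ : ∀ u n, n < excursionTime T u →
      F (T^[n] u) ≤ 2 * ((min (excursionTime T u : ℝ) k) ^ 2 + Z (jumpMap T u))) :
    ∫⁻ x, ENNReal.ofReal (F x ^ (p - 1)) ∂μ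
      ≤ ENNReal.ofReal (4 ^ (p - 1) * (K * (k : ℝ) ^ (p - 1) + K * M)) := by
  have := h.isProbabilityMeasure
  have hTm := h.measurable_map
  have hR := h.returnSystem k hk
  have hk0 : (0 : ℝ) < k := by exact_mod_cast hk
  set q := p - 1 with hq
  have hq0 : 0 ≤ q := by linarith
  have hGm := hR.measurePreserving.measurable
  have hFq := hF.rpow hF0 hq0
  have hZq := hZ.rpow hZ0 hq0
  obtain ⟨B, hB⟩ := hFq.2
  have hM0 : 0 ≤ M := (integral_nonneg fun x => Real.rpow_nonneg (hZ0 x) _).trans hM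
  refine (h.lintegral_le _ hFq.1.ennreal_ofReal (ENNReal.ofReal B) ENNReal.ofReal_ne_top
    fun x => ENNReal.ofReal_le_ofReal ((le_abs_self _).trans (hB x))).trans ?_
  have hτm : Measurable fun u => ENNReal.ofReal ((excursionTime T u : ℝ) ^ p) :=
    ((measurable_from_top.comp hR.measurable_time).pow_const p).ennreal_ofReal
  have hpt : ∀ u, ∑ n ∈ Finset.range (excursionTime T u), ENNReal.ofReal (F (T^[n] u) ^ q)
      ≤ ENNReal.ofReal (4 ^ q * (k : ℝ) ^ q) * (ENNReal.ofReal ((excursionTime T u : ℝ) ^ p) * 1)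
        + ENNReal.ofReal (4 ^ q) * (ENNReal.ofReal ((excursionTime T u : ℝ) ^ p)
          * ENNReal.ofReal (Z (jumpMap T u) ^ q)) := by
    intro u
    set t : ℝ := (excursionTime T u : ℝ) with ht
    have ht1 : 1 ≤ t := by rw [ht]; exact_mod_cast hR.one_le_time u
    have ht0 : 0 < t := by linarith
    set z := Z (jumpMap T u) with hz
    have hz0 : 0 ≤ z := hZ0 _
    set m : ℝ := min t k with hm
    have hm0 : 0 ≤ m := le_min ht0.le hk0.le
    have htp : t * t ^ q = t ^ p := by
      conv_lhs => rw [← Real.rpow_one t]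
      rw [Real.rpow_one, ← Real.rpow_one_add' ht0.le (by linarith)]
      congr 1; rw [hq]; ring
    have h1 : ∀ n ∈ Finset.range (excursionTime T u), ENNReal.ofReal (F (T^[n] u) ^ q)
        ≤ ENNReal.ofReal ((2 * (m ^ 2 + z)) ^ q) := fun n hn =>
      ENNReal.ofReal_le_ofReal (Real.rpow_le_rpow (hF0 _) (hFZ u n (Finset.mem_range.1 hn)) hq0)
    refine (Finset.sum_le_card_nsmul _ _ _ h1).trans ?_
    rw [Finset.card_range, nsmul_eq_mul, mul_one, ← ENNReal.ofReal_natCast,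
      ← ENNReal.ofReal_mul (by positivity), ← ENNReal.ofReal_mul (by positivity),
      ← ENNReal.ofReal_mul (by positivity), ← ENNReal.ofReal_mul (by positivity),
      ← ENNReal.ofReal_add (by positivity) (by positivity)]
    refine ENNReal.ofReal_le_ofReal ?_
    have h2 : (2 * (m ^ 2 + z)) ^ q ≤ 4 ^ q * ((m ^ 2) ^ q + z ^ q) := by
      rw [Real.mul_rpow (by norm_num) (by positivity), show (4 : ℝ) = 2 * 2 by norm_num,
        Real.mul_rpow (by norm_num) (by norm_num), mul_assoc]
      exact mul_le_mul_of_nonneg_left (add_rpow_le_two_rpow_mul hq0 (sq_nonneg _) hz0) (by positivity)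
    have h3 : (m ^ 2) ^ q ≤ (k : ℝ) ^ q * t ^ q := by
      rw [sq, Real.mul_rpow hm0 hm0]
      exact mul_le_mul (Real.rpow_le_rpow hm0 (min_le_right _ _) hq0)
        (Real.rpow_le_rpow hm0 (min_le_left _ _) hq0) (by positivity) (by positivity)
    have h4 : t ≤ t ^ p := by
      conv_lhs => rw [← Real.rpow_one t]
      exact Real.rpow_le_rpow_of_exponent_le ht1 (by linarith)
    calc t * (2 * (m ^ 2 + z)) ^ q ≤ t * (4 ^ q * ((k : ℝ) ^ q * t ^ q + z ^ q)) :=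
          mul_le_mul_of_nonneg_left (h2.trans (by gcongr)) ht0.le
      _ = 4 ^ q * (k : ℝ) ^ q * (t * t ^ q) + 4 ^ q * (t * z ^ q) := by ring
      _ ≤ 4 ^ q * (k : ℝ) ^ q * t ^ p + 4 ^ q * (t ^ p * z ^ q) := by
          rw [htp]
          have := Real.rpow_nonneg hz0 q
          gcongr
  have hZi : ∫⁻ x, ENNReal.ofReal (Z x ^ q) ∂lam ≤ ENNReal.ofReal M := by
    rw [← ofReal_integral_eq_lintegral_ofReal (hZq.integrable lam)
      (ae_of_all _ fun x => Real.rpow_nonneg (hZ0 x) _)]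
    exact ENNReal.ofReal_le_ofReal hM
  have hk1 := hR.kac (fun _ => 1) measurable_const
  have hk2 := hR.kac (fun x => ENNReal.ofReal (Z x ^ q)) hZq.1.ennreal_ofReal
  simp only [lintegral_const, measure_univ, mul_one] at hk1
  refine (lintegral_mono hpt).trans ?_
  simp only [mul_one]
  rw [lintegral_add_left (hτm.const_mul _), lintegral_const_mul _ hτm,
    lintegral_const_mul (f := fun u => ENNReal.ofReal ((excursionTime T u : ℝ) ^ p)
      * ENNReal.ofReal (Z (jumpMap T u) ^ q)) _ (hτm.mul (hZq.1.ennreal_ofReal.comp hGm))]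
  calc _ ≤ ENNReal.ofReal (4 ^ q * (k : ℝ) ^ q) * ENNReal.ofReal K
        + ENNReal.ofReal (4 ^ q) * (ENNReal.ofReal K * ENNReal.ofReal M) := by
        gcongr
        exact hk2.trans (mul_le_mul_right hZi _)
    _ = _ := by
        rw [← ENNReal.ofReal_mul (by positivity), ← ENNReal.ofReal_mul (by positivity),
          ← ENNReal.ofReal_mul (by positivity), ← ENNReal.ofReal_add (by positivity) (by positivity)]
        congr 1; ring

/-- Moment bounds for Birkhoff sums and iterated sums. -/
theorem exists_eLpNorm_le (hp : 2 < p) (hη : 0 < η) (hK : 1 ≤ K) (hC : 1 ≤ C) : ∃ C₂ : ℝ, 0 ≤ C₂ ∧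
    ∀ (T : I → I) (μ lam : Measure I), MeasurePreserving T μ μ → ExcursionSystem p η K C T μ lam →
      ∀ v w : I → ℝ, (∀ x, |v x| ≤ 1) → (∀ x, |w x| ≤ 1) →
        (∀ x y, |v x - v y| ≤ dist x y ^ η) → (∀ x y, |w x - w y| ≤ dist x y ^ η) →
        ∫ x, v x ∂μ = 0 → ∫ x, w x ∂μ = 0 → ∀ k ℓ : ℕ, 0 < k →
          eLpNorm (fun x => birkhoffSum T v k (T^[ℓ] x)) (ENNReal.ofReal (2 * (p - 1))) volume
            ≤ ENNReal.ofReal (C₂ * (k : ℝ) ^ (1 / 2 : ℝ)) ∧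
          eLpNorm (fun x => iterSum T v w k (T^[ℓ] x)) (ENNReal.ofReal (p - 1)) volume
            ≤ ENNReal.ofReal (C₂ * k) := by
  obtain ⟨C₁, hC₁, hmaj⟩ := MartingaleCoboundary.exists_iterSum_majorant (X := I) hp hK hC
  set q := p - 1 with hq
  have hq0 : 0 < q := by linarith
  set M₁ : ℝ := (16 * C ^ 2) ^ q * (C₁ + 1) with hM₁
  have hM₁0 : 0 ≤ M₁ := by positivity
  set M₀ : ℝ := C * (4 ^ q * (K + K * M₁)) with hM₀
  have hM₀0 : 0 ≤ M₀ := by positivity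
  refine ⟨max (M₀ ^ (2 * q)⁻¹) (M₀ ^ q⁻¹), le_max_of_le_left (by positivity), ?_⟩
  intro T μ lam hT h v w hv1 hw1 hvη hwη hv0 hw0 k ℓ hk
  have hprob := h.isProbabilityMeasure
  have hTm := h.measurable_map
  have hR := h.returnSystem k hk
  have hGm := hR.measurePreserving.measurable
  have hk1 : (1 : ℝ) ≤ k := by exact_mod_cast hk
  have hk0 : (0 : ℝ) < k := by linarith
  have hvb : BddMeas v := ⟨(continuous_of_abs_sub_le_rpow hη hvη).measurable, 1, hv1⟩
  have hwb : BddMeas w := ⟨(continuous_of_abs_sub_le_rpow hη hwη).measurable, 1, hw1⟩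
  obtain ⟨c, V, χ, hc, hVc, hd⟩ := h.exists_decomposition v hv1 hvη hv0 k hk
  obtain ⟨c', W, χ', hc', hWc, hd'⟩ := h.exists_decomposition w hw1 hwη hw0 k hk
  obtain ⟨H, hHb, hH0, hHi, hHN, hHQ⟩ := hmaj lam _ _ k V χ W χ' hR hd hd'
  set Z : I → ℝ := fun x => 8 * C ^ 2 * (H x + 1) with hZ
  have hZb : BddMeas Z := (hHb.add (BddMeas.const 1)).const_mul _
  have hZ0 : ∀ x, 0 ≤ Z x := fun x => by have := hH0 x; positivity
  have hZi : ∫ x, Z x ^ q ∂lam ≤ M₁ * (k : ℝ) ^ q := by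
    have hHq := hHb.rpow hH0 hq0.le
    have hkq : 1 ≤ (k : ℝ) ^ q := Real.one_le_rpow hk1 hq0.le
    calc ∫ x, Z x ^ q ∂lam ≤ ∫ x, (16 * C ^ 2) ^ q * (H x ^ q + 1) ∂lam := by
          refine integral_mono ((hZb.rpow hZ0 hq0.le).integrable lam)
            (((hHq.add (BddMeas.const 1)).const_mul _).integrable lam) fun x => ?_
          have h1 := add_rpow_le_two_rpow_mul hq0.le (hH0 x) zero_le_one
          rw [Real.one_rpow] at h1
          have h2 := hH0 x
          simp only [hZ]
          have h3 : (16 * C ^ 2) ^ q = (8 * C ^ 2) ^ q * 2 ^ q := by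
            rw [← Real.mul_rpow (by positivity) (by norm_num)]; congr 1; ring
          calc (8 * C ^ 2 * (H x + 1)) ^ q = (8 * C ^ 2) ^ q * (H x + 1) ^ q :=
                Real.mul_rpow (by positivity) (by linarith)
            _ ≤ (8 * C ^ 2) ^ q * (2 ^ q * (H x ^ q + 1)) :=
                mul_le_mul_of_nonneg_left h1 (by positivity)
            _ = (16 * C ^ 2) ^ q * (H x ^ q + 1) := by rw [h3, mul_assoc]
      _ = (16 * C ^ 2) ^ q * ((∫ x, H x ^ q ∂lam) + 1) := by
          rw [integral_const_mul, integral_add (hHq.integrable lam) (integrable_const _)]; simp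
      _ ≤ (16 * C ^ 2) ^ q * (C₁ * (k : ℝ) ^ q + (k : ℝ) ^ q) := by gcongr
      _ = M₁ * (k : ℝ) ^ q := by rw [hM₁]; ring
  have hz : ∀ (u : I) (j : ℕ), j ≤ k →
      birkhoffSum T v j (jumpMap T u) ^ 2 ≤ Z (jumpMap T u) ∧
      birkhoffSum T w j (jumpMap T u) ^ 2 ≤ Z (jumpMap T u) ∧
      |iterSum T v w j (jumpMap T u)| ≤ Z (jumpMap T u) := fun u j hj => by
    have a1 := pathwise_bound hk hC hv1 hw1 hc hc' hVc hWc
      (fun N hN => ⟨(hHN N hN (jumpMap T u)).1, (hHN N hN (jumpMap T u)).2.1⟩) (hHQ _) hj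
    have a2 := pathwise_bound hk hC hw1 hv1 hc' hc hWc hVc
      (fun N hN => ⟨(hHN N hN (jumpMap T u)).2.1, (hHN N hN (jumpMap T u)).1⟩) (hHQ _) hj
    exact ⟨a1.1, a2.1, a1.2 fun N hN => (hHN N hN _).2.2⟩
  have hfin : ∀ F : I → ℝ, BddMeas F → (∀ x, 0 ≤ F x) → (∀ u n, n < excursionTime T u →
      F (T^[n] u) ≤ 2 * ((min (excursionTime T u : ℝ) k) ^ 2 + Z (jumpMap T u))) →
      ∫⁻ x, ENNReal.ofReal (F (T^[ℓ] x) ^ q) ≤ ENNReal.ofReal (M₀ * (k : ℝ) ^ q) := by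
    intro F hF hF0 hFZ
    have h1 := h.lintegral_rpow_le hp hK hk hF hF0 hZb hZ0 hZi hFZ
    have hFm : Measurable fun x => ENNReal.ofReal (F x ^ q) := (hF.rpow hF0 hq0.le).1.ennreal_ofReal
    -- Lebesgue measure is not invariant, so it is first replaced by a multiple of μ; then the shift
    -- by ℓ disappears.
    calc ∫⁻ x, ENNReal.ofReal (F (T^[ℓ] x) ^ q)
        ≤ ∫⁻ x, ENNReal.ofReal (F (T^[ℓ] x) ^ q) ∂(ENNReal.ofReal C • μ) :=
          lintegral_mono' h.volume_le le_rfl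
      _ = ENNReal.ofReal C * ∫⁻ x, ENNReal.ofReal (F x ^ q) ∂μ := by
          rw [lintegral_smul_measure, smul_eq_mul, (hT.iterate ℓ).lintegral_comp hFm]
      _ ≤ ENNReal.ofReal C * ENNReal.ofReal (4 ^ q * (K * (k : ℝ) ^ q + K * (M₁ * (k : ℝ) ^ q))) := by
          gcongr
      _ = ENNReal.ofReal (M₀ * (k : ℝ) ^ q) := by
          rw [← ENNReal.ofReal_mul (by linarith), hM₀]; congr 1; ring
  constructor
  · refine (eLpNorm_le_of_lintegral_rpow_le (M := M₀ ^ (2 * q)⁻¹ * (k : ℝ) ^ (1 / 2 : ℝ))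
      (by linarith) (by positivity) ?_).trans (ENNReal.ofReal_le_ofReal (by gcongr; exact le_max_left _ _))
    have e1 : (M₀ ^ (2 * q)⁻¹ * (k : ℝ) ^ (1 / 2 : ℝ)) ^ (2 * q) = M₀ * (k : ℝ) ^ q := by
      rw [Real.mul_rpow (by positivity) (by positivity), Real.rpow_inv_rpow hM₀0 (by positivity),
        ← Real.rpow_mul hk0.le]
      congr 2; ring
    rw [e1]
    -- The moment of order 2 * q of the sum is the q-th moment of its square, so both estimates come
    -- from `hfin`.
    refine le_trans (le_of_eq (lintegral_congr fun x => ?_)) (hfin (fun x => birkhoffSum T v k x ^ 2)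
      ((hvb.birkhoffSum hTm k).pow 2) (fun x => sq_nonneg _)
      fun u n hn => (pathwise_bound_iterate hv1 hw1 hn (hz u)).1)
    rw [← sq_abs, ← Real.rpow_natCast, ← Real.rpow_mul (abs_nonneg _)]
    norm_num
  · refine (eLpNorm_le_of_lintegral_rpow_le (M := M₀ ^ q⁻¹ * (k : ℝ))
      hq0 (by positivity) ?_).trans (ENNReal.ofReal_le_ofReal (by gcongr; exact le_max_right _ _))
    have e1 : (M₀ ^ q⁻¹ * (k : ℝ)) ^ q = M₀ * (k : ℝ) ^ q := by
      rw [Real.mul_rpow (by positivity) (by positivity), Real.rpow_inv_rpow hM₀0 hq0.ne']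
    rw [e1]
    exact hfin (fun x => |iterSum T v w k x|) (hvb.iterSum hTm hwb k).abs (fun x => abs_nonneg _)
      fun u n hn => (pathwise_bound_iterate hv1 hw1 hn (hz u)).2

end ExcursionSystem

/-! ### Uniform bounds along a sequence of intermittent maps -/

theorem sqrt_sum_sq_le {ι : Type*} (s : Finset ι) (f : ι → ℝ) :
    Real.sqrt (∑ i ∈ s, f i ^ 2) ≤ ∑ i ∈ s, |f i| := by
  refine Real.sqrt_le_iff.2 ⟨Finset.sum_nonneg fun _ _ => abs_nonneg _, ?_⟩
  have := Finset.sum_sq_le_sq_sum_of_nonneg (s := s) (f := fun i => |f i|) (fun i _ => abs_nonneg _)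
  simpa using this

theorem euclideanSpace_norm_le_sum_abs {d : ℕ} (x : EuclideanSpace ℝ (Fin d)) : ‖x‖ ≤ ∑ a, |x a| := by
  rw [EuclideanSpace.norm_eq]
  simpa using sqrt_sum_sq_le Finset.univ fun a => x a

theorem frobenius_norm_le_sum_abs {d : ℕ} (A : Matrix (Fin d) (Fin d) ℝ) :
    ‖A‖ ≤ ∑ q : Fin d × Fin d, |A q.1 q.2| := by
  rw [Matrix.frobenius_norm_def, ← Real.sqrt_eq_rpow, ← Fintype.sum_prod_type']
  simpa using sqrt_sum_sq_le Finset.univ fun q : Fin d × Fin d => A q.1 q.2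

theorem eLpNorm_le_card_mul {ι E : Type*} [Fintype ι] [NormedAddCommGroup E] {f : I → E}
    {F : ι → I → ℝ} (hF : ∀ a, Measurable (F a)) (hfF : ∀ x, ‖f x‖ ≤ ∑ a, |F a x|) {q : ℝ≥0∞} (hq : 1 ≤ q)
    {M : ℝ} (hM : ∀ a, eLpNorm (F a) q volume ≤ ENNReal.ofReal M) :
    eLpNorm f q volume ≤ ENNReal.ofReal (Fintype.card ι * M) := by
  calc eLpNorm f q volume ≤ eLpNorm (fun x => ∑ a, |F a x|) q volume := eLpNorm_mono_real hfF
    _ = eLpNorm (∑ a, fun x => |F a x|) q volume := by congr 1; ext x; simp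
    _ ≤ ∑ a, eLpNorm (fun x => |F a x|) q volume :=
        eLpNorm_sum_le (fun a _ => (hF a).abs.aestronglyMeasurable) hq
    _ = ∑ a, eLpNorm (F a) q volume := Finset.sum_congr rfl fun a _ => eLpNorm_norm (F a)
    _ ≤ ∑ _a : ι, ENNReal.ofReal M := Finset.sum_le_sum fun a _ => hM a
    _ = ENNReal.ofReal (Fintype.card ι * M) := by
        rw [ENNReal.ofReal_mul (Nat.cast_nonneg _)]; simp

/-- Bounds for scalar observables of a convergent sequence of intermittent maps. -/
theorem exists_uniform_eLpNorm_le {γ : ℕ → ℝ} {γinf : ℝ} (hγ0 : ∀ n, 0 < γ n) (hγinf0 : 0 < γinf)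
    (hγ : Tendsto γ atTop (𝓝 γinf)) {μ : ℕ → Measure I}
    (hμ : ∀ n, IsACIP (lsvMap (γ n) (hγ0 n)) (μ n)) {p η : ℝ} (hp2 : 2 < p) (hp : p < γinf⁻¹)
    (hη0 : 0 < η) (hη1 : η ≤ 1) :
    ∃ C : ℝ, 0 ≤ C ∧ ∀ (n : ℕ) (v w : I → ℝ), (∀ x, |v x| ≤ 1) → (∀ x, |w x| ≤ 1) →
      (∀ x y, |v x - v y| ≤ dist x y ^ η) → (∀ x y, |w x - w y| ≤ dist x y ^ η) →
      ∫ x, v x ∂(μ n) = 0 → ∫ x, w x ∂(μ n) = 0 → ∀ m ℓ : ℕ, 0 < m → m < n →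
        eLpNorm (fun x => birkhoffSum (lsvMap (γ n) (hγ0 n)) v m ((lsvMap (γ n) (hγ0 n))^[ℓ] x))
            (ENNReal.ofReal (2 * (p - 1))) volume
          ≤ ENNReal.ofReal (C * (m : ℝ) ^ (1 / 2 : ℝ)) ∧
        eLpNorm (fun x => iterSum (lsvMap (γ n) (hγ0 n)) v w m ((lsvMap (γ n) (hγ0 n))^[ℓ] x))
            (ENNReal.ofReal (p - 1)) volume
          ≤ ENNReal.ofReal (C * m) := by
  have hp0 : 0 < p := by linarith
  have hlt : γinf < p⁻¹ := by
    rw [lt_inv_comm₀ hγinf0 hp0]; exact hp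
  -- A single g above the limit parameter, with g * p < 1, serves every n beyond N.
  obtain ⟨g, hg1, hg2⟩ := exists_between hlt
  have hgp : g * p < 1 := by
    rwa [← lt_div_iff₀ hp0, one_div]
  obtain ⟨N, hN⟩ := eventually_atTop.1 (hγ.eventually_le_const hg1)
  obtain ⟨K, C, hK, hC, hsys⟩ := exists_excursionSystem_lsvMap (hγinf0.trans hg1) hp2 hgp hη0 hη1
  obtain ⟨C₂, hC₂, hbound⟩ := ExcursionSystem.exists_eLpNorm_le hp2 hη0 hK hC
  refine ⟨max C₂ N, le_max_of_le_left hC₂, fun n v w hv1 hw1 hvη hwη hv0 hw0 m ℓ hm hmn => ?_⟩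
  by_cases hn : N ≤ n
  · obtain ⟨lam, hlam⟩ := hsys (γ n) (hγ0 n) (hN n hn) (μ n) (hμ n)
    obtain ⟨h1, h2⟩ := hbound _ _ lam (hμ n).invariant hlam v w hv1 hw1 hvη hwη hv0 hw0 m ℓ hm
    exact ⟨h1.trans (ENNReal.ofReal_le_ofReal (by gcongr; exact le_max_left _ _)),
      h2.trans (ENNReal.ofReal_le_ofReal (by gcongr; exact le_max_left _ _))⟩
  -- For the finitely many remaining n, m < n < N, and the trivial bounds m and m^2 are absorbed by
  -- the constant N. This is where m < n enters.
  · have hmN : (m : ℝ) ≤ N := by exact_mod_cast (by omega : m ≤ N)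
    have hm1 : (1 : ℝ) ≤ m := by exact_mod_cast hm
    have hNC : (N : ℝ) ≤ max C₂ N := le_max_right _ _
    constructor
    · refine (eLpNorm_le_of_ae_bound (C := (m : ℝ))
        (ae_of_all _ fun x => abs_birkhoffSum_le _ hv1 m _)).trans ?_
      simp only [measure_univ, ENNReal.one_rpow, one_mul]
      refine ENNReal.ofReal_le_ofReal ?_
      have h1 : 1 ≤ (m : ℝ) ^ (1 / 2 : ℝ) := Real.one_le_rpow hm1 (by norm_num)
      nlinarith
    · refine (eLpNorm_le_of_ae_bound (C := (m : ℝ) ^ 2)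
        (ae_of_all _ fun x => abs_iterSum_le _ hv1 hw1 m _)).trans ?_
      simp only [measure_univ, ENNReal.one_rpow, one_mul]
      refine ENNReal.ofReal_le_ofReal ?_
      nlinarith

theorem birkhoffSumFromTo_apply {d : ℕ} (T : I → I) (v : I → EuclideanSpace ℝ (Fin d)) (ℓ k : ℕ)
    (x : I) (a : Fin d) :
    birkhoffSumFromTo T v ℓ k x a = birkhoffSum T (fun y => v y a) (k - ℓ) (T^[ℓ] x) := by
  rw [birkhoffSumFromTo, Finset.sum_Ico_eq_sum_range, WithLp.ofLp_sum, Finset.sum_apply]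
  refine Finset.sum_congr rfl fun j _ => ?_
  simp only [← Function.iterate_add_apply, add_comm]

theorem iteratedSumFromTo_apply {d : ℕ} (T : I → I) (v : I → EuclideanSpace ℝ (Fin d)) (ℓ k : ℕ)
    (x : I) (a b : Fin d) :
    iteratedSumFromTo T v ℓ k x a b
      = iterSum T (fun y => v y a) (fun y => v y b) (k - ℓ) (T^[ℓ] x) := by
  rw [iteratedSumFromTo, iterSum_eq_sum, Finset.sum_Ico_eq_sum_range, Matrix.sum_apply]
  refine Finset.sum_congr rfl fun j _ => ?_
  rw [Finset.sum_Ico_eq_sum_range, Matrix.sum_apply, add_tsub_cancel_left, birkhoffSum, Finset.sum_mul]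
  refine Finset.sum_congr rfl fun i _ => ?_
  simp only [Matrix.vecMulVec_apply, ← Function.iterate_add_apply, add_comm]

theorem norm_le_holderNorm {d : ℕ} {η : ℝ≥0} (hη : 0 < η) {v : I → EuclideanSpace ℝ (Fin d)}
    (hv : MemHolder η v) (x : I) : ‖v x‖ ≤ holderNorm η v := by
  have hc : Continuous v := hv.holderWith.continuous hη
  have hb : BddAbove (Set.range fun x => ‖v x‖) := by
    have := (isCompact_range (hc.norm)).bddAbove
    exact this
  exact (le_ciSup hb x).trans (le_add_of_nonneg_right (NNReal.coe_nonneg _))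

theorem norm_sub_le_holderNorm_mul {d : ℕ} {η : ℝ≥0} {v : I → EuclideanSpace ℝ (Fin d)}
    (hv : MemHolder η v) (x y : I) : ‖v x - v y‖ ≤ holderNorm η v * dist x y ^ (η : ℝ) := by
  have h := hv.holderWith.dist_le x y
  rw [dist_eq_norm] at h
  refine h.trans (mul_le_mul_of_nonneg_right ?_ (by positivity))
  exact le_add_of_nonneg_left (Real.iSup_nonneg fun _ => norm_nonneg _)

theorem birkhoffSum_const_mul {X : Type*} (T : X → X) (h : ℝ) (u : X → ℝ) (n : ℕ) (x : X) :
    birkhoffSum T (fun y => h * u y) n x = h * birkhoffSum T u n x := by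
  simp [birkhoffSum, Finset.mul_sum]

theorem iterSum_const_mul {X : Type*} (T : X → X) (h h' : ℝ) (u w : X → ℝ) (n : ℕ) (x : X) :
    iterSum T (fun y => h * u y) (fun y => h' * w y) n x = h * h' * iterSum T u w n x := by
  rw [iterSum_eq_sum, iterSum_eq_sum, Finset.mul_sum]
  refine Finset.sum_congr rfl fun j _ => ?_
  rw [birkhoffSum_const_mul]; ring

theorem eLpNorm_const_mul_le {f : I → ℝ} {q : ℝ≥0∞} {M h : ℝ} (hh : 0 ≤ h)
    (hf : eLpNorm f q volume ≤ ENNReal.ofReal M) :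
    eLpNorm (fun x => h * f x) q volume ≤ ENNReal.ofReal (h * M) := by
  have := eLpNorm_const_smul h f q (volume : Measure I)
  rw [show (fun x => h * f x) = h • f from rfl, this, ENNReal.ofReal_mul hh,
    Real.enorm_eq_ofReal hh]
  exact mul_le_mul_right hf _

theorem mainTheorem11
    (γ : ℕ → ℝ) (γinf : ℝ)
    (hγ0 : ∀ n, 0 < γ n) (hγ1 : ∀ n, γ n < 1 / 2)
    (hγinf0 : 0 < γinf) (hγinf1 : γinf < 1 / 2)
    (hγ : Tendsto γ atTop (𝓝 γinf))
    (μ : ℕ → Measure I) (hμ : ∀ n, IsACIP (lsvMap (γ n) (hγ0 n)) (μ n))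
    (p : ℝ) (hp2 : 2 < p) (hp : p < γinf⁻¹)
    (η : ℝ≥0) (hη0 : 0 < η) (hη1 : η ≤ 1)
    (d : ℕ) :
    ∃ C : ℝ, ∀ (n : ℕ) (v : I → EuclideanSpace ℝ (Fin d)),
      MemHolder η v → ∫ x, v x ∂(μ n) = 0 →
      ∀ ℓ k : ℕ, ℓ < k → k < n →
        eLpNorm (birkhoffSumFromTo (lsvMap (γ n) (hγ0 n)) v ℓ k)
            (ENNReal.ofReal (2 * (p - 1))) (volume : Measure I)
          ≤ ENNReal.ofReal (C * ((k : ℝ) - ℓ) ^ (1 / 2 : ℝ) * holderNorm η v) ∧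
        eLpNorm (iteratedSumFromTo (lsvMap (γ n) (hγ0 n)) v ℓ k)
            (ENNReal.ofReal (p - 1)) (volume : Measure I)
          ≤ ENNReal.ofReal (C * ((k : ℝ) - ℓ) * holderNorm η v ^ 2) := by
  obtain ⟨C, hC0, hC⟩ := exists_uniform_eLpNorm_le hγ0 hγinf0 hγ hμ hp2 hp
    (η := η) (by exact_mod_cast hη0) (by exact_mod_cast hη1)
  have hdd : (0 : ℝ) ≤ (d : ℝ) * C := by positivity
  have hdd2 : (0 : ℝ) ≤ (d : ℝ) * d * C := by positivity
  -- One factor C for each of the d components and for each of the d * d matrix entries.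
  refine ⟨d * C + d * d * C, fun n v hv hv0 ℓ k hℓk hkn => ?_⟩
  set T := lsvMap (γ n) (hγ0 n) with hT
  have hTm : Measurable T := measurable_lsvMap (hγ0 n)
  have := (hμ n).isProbabilityMeasure
  set h := holderNorm η v with hh
  have hvh : ∀ x, ‖v x‖ ≤ h := norm_le_holderNorm hη0 hv
  have hvη : ∀ x y, ‖v x - v y‖ ≤ h * dist x y ^ (η : ℝ) := norm_sub_le_holderNorm_mul hv
  have hh0 : 0 ≤ h := (norm_nonneg _).trans (hvh 0)
  rcases hh0.eq_or_lt with h0 | hpos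
  · have hvz : ∀ x, v x = 0 := fun x => norm_le_zero_iff.1 ((hvh x).trans_eq h0.symm)
    refine ⟨(eLpNorm_le_of_ae_bound (C := 0) (ae_of_all _ fun x => ?_)).trans (by simp),
      (eLpNorm_le_of_ae_bound (C := 0) (ae_of_all _ fun x => ?_)).trans (by simp)⟩
    · have e : birkhoffSumFromTo T v ℓ k x = 0 := by simp [birkhoffSumFromTo, hvz]
      rw [e, norm_zero]
    · have e : iteratedSumFromTo T v ℓ k x = 0 := by simp [iteratedSumFromTo, hvz]
      rw [e, norm_zero]
  have hvc : Continuous v := hv.holderWith.continuous hη0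
  have hvi : Integrable v (μ n) := by
    refine (integrable_const h).mono' hvc.aestronglyMeasurable (ae_of_all _ hvh)
  -- Components normalised so that both the supremum and the Hölder seminorm are at most 1; centring
  -- passes to each component.
  set u : Fin d → I → ℝ := fun a x => h⁻¹ * v x a with hu
  have hvu : ∀ a, (fun y => v y a) = fun y => h * u a y := fun a => by
    funext y; simp only [hu]; field_simp
  have hu1 : ∀ a x, |u a x| ≤ 1 := fun a x => by
    simp only [hu]
    rw [abs_mul, abs_of_pos (inv_pos.2 hpos), inv_mul_le_iff₀ hpos, mul_one]
    exact (PiLp.norm_apply_le (v x) a).trans (hvh x)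
  have huη : ∀ a x y, |u a x - u a y| ≤ dist x y ^ (η : ℝ) := fun a x y => by
    simp only [hu]
    rw [← mul_sub, abs_mul, abs_of_pos (inv_pos.2 hpos), inv_mul_le_iff₀ hpos]
    exact (PiLp.norm_apply_le (v x - v y) a).trans (hvη x y)
  have hu0 : ∀ a, ∫ x, u a x ∂(μ n) = 0 := fun a => by
    simp only [hu]
    rw [integral_const_mul]
    have e := (EuclideanSpace.proj (𝕜 := ℝ) a).integral_comp_comm hvi
    rw [hv0, map_zero] at e
    have e' : ∫ x, v x a ∂(μ n) = 0 := e
    rw [e', mul_zero]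
  have hub : ∀ a, BddMeas (u a) := fun a =>
    ⟨(continuous_of_abs_sub_le_rpow (by exact_mod_cast hη0) (huη a)).measurable, 1, hu1 a⟩
  set m := k - ℓ with hm
  have hm0 : 0 < m := by omega
  have hmR : (k : ℝ) - ℓ = m := by rw [hm, Nat.cast_sub hℓk.le]
  have hTl := hTm.iterate ℓ
  rw [hmR]
  have hmh : (0 : ℝ) ≤ (m : ℝ) ^ (1 / 2 : ℝ) * h := by positivity
  constructor
  · have e := eLpNorm_le_card_mul (f := birkhoffSumFromTo T v ℓ k)
      (F := fun a x => h * birkhoffSum T (u a) m (T^[ℓ] x)) (q := ENNReal.ofReal (2 * (p - 1)))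
      (M := h * (C * (m : ℝ) ^ (1 / 2 : ℝ)))
      (fun a => ((((hub a).birkhoffSum hTm m).comp hTl).const_mul h).1) (fun x => ?_)
      (ENNReal.one_le_ofReal.2 (by linarith)) (fun a => eLpNorm_const_mul_le hh0
        (hC n (u a) (u a) (hu1 a) (hu1 a) (huη a) (huη a) (hu0 a) (hu0 a) m ℓ hm0 (by omega)).1)
    · refine e.trans (ENNReal.ofReal_le_ofReal ?_)
      rw [Fintype.card_fin]
      nlinarith
    · refine (euclideanSpace_norm_le_sum_abs _).trans (le_of_eq (Finset.sum_congr rfl fun a _ => ?_))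
      rw [birkhoffSumFromTo_apply, hvu, birkhoffSum_const_mul]
  · have e := eLpNorm_le_card_mul (f := iteratedSumFromTo T v ℓ k)
      (F := fun (q : Fin d × Fin d) x => h * h * iterSum T (u q.1) (u q.2) m (T^[ℓ] x))
      (q := ENNReal.ofReal (p - 1)) (M := h * h * (C * m))
      (fun q => ((((hub q.1).iterSum hTm (hub q.2) m).comp hTl).const_mul (h * h)).1) (fun x => ?_)
      (ENNReal.one_le_ofReal.2 (by linarith)) (fun q => eLpNorm_const_mul_le (by positivity)
        (hC n (u q.1) (u q.2) (hu1 _) (hu1 _) (huη _) (huη _) (hu0 _) (hu0 _) m ℓ hm0 (by omega)).2)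
    · refine e.trans (ENNReal.ofReal_le_ofReal ?_)
      rw [Fintype.card_prod, Fintype.card_fin]
      push_cast
      have : 0 ≤ (m : ℝ) * h ^ 2 := by positivity
      nlinarith
    · refine (frobenius_norm_le_sum_abs _).trans (le_of_eq (Finset.sum_congr rfl fun q _ => ?_))
      rw [iteratedSumFromTo_apply, hvu, hvu, iterSum_const_mul]
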